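/- **Setting.** An $N=2$ differential superalgebra is a supercommutative $\mathbb C$-algebra $A$ with two odd superderivations $\mathbb D_1,\mathbb D_2$ satisfying $\mathbb D_1^2=\mathbb D_2^2=:\partial_y$ and $\mathbb D_1\mathbb D_2=-\mathbb D_2\mathbb D_1$; for example superfields on the superspace $(y,\varrho_1,\varrho_2)$ with $\mathbb D_k=\partial_{\varrho_k}+\varrho_k\partial_y$. A time derivative $\partial_\tau$ is an even derivation of $A$ commuting with $\mathbb D_1,\mathbb D_2$. Subscripts $y$ denote $\partial_y$. Operators are formal super pseudo-differential operators $\sum_{n\le N}(a_n+b_n\mathbb D_1+c_n\mathbb D_2+e_n\mathbb D_1\mathbb D_2)\partial_y^n$ with coefficients in $A$; $\partial_\tau$ acts on them coefficientwise, and $(\cdot)_{\ge1}$ keeps the terms with $n\ge0$ except the multiplication term $a_0$. For an even superfield $U\in A$ put $$L_{1m}=-\big[\mathbb D_1\mathbb D_2+(\mathbb D_2U)\mathbb D_1-(\mathbb D_1U)\mathbb D_2\big]^2,\qquad \hat L_{1m}=i\big[\mathbb D_1\mathbb D_2+(\mathbb D_2U)\mathbb D_1-(\mathbb D_1U)\mathbb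 D_2\big].$$ **Proposition 1.** (a) *Origin.* Let $x,\theta_1,\theta_2\in A$ ($x$ even, $\theta_k$ odd) define a superconformal change of variables, i.e. $\mathbb D_kx=\theta_1\mathbb D_k\theta_1+\theta_2\mathbb D_k\theta_2$ $(k=1,2)$, $\mathbb D_1\theta_2=-\mathbb D_2\theta_1$, $\mathbb D_2\theta_2=\mathbb D_1\theta_1$, with new superderivatives $\mathcal D_1,\mathcal D_2$ determined by $\mathbb D_k=(\mathbb D_k\theta_1)\mathcal D_1+(\mathbb D_k\theta_2)\mathcal D_2$, and let $K=(\mathbb D_1\theta_1)^2+(\mathbb D_2\theta_1)^2$ be invertible. If $W=K$ and $U=\frac12\log K$ (that is, $\mathbb D_kK=2K\,\mathbb D_kU$), then the Harry Dym Lax operator $L_1=-(W\mathcal D_1\mathcal D_2)^2$ equals $L_{1m}$. (b) *Square roots.* $\hat L_{1m}^2=L_{1m}$, and there is exactly one operator $L_{1m}^{1/2}=\partial_y+\cdots$ (the dots standing for terms of order lower than that of $\partial_y$, where $\mathbb D_1,\mathbb D_2$ have order $\frac12$) whose square is $L_{1m}$. (c) *Hierarchy.* The Lax equations $$\partial_{\tau_n}L_{1m}=\big[(\hat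 L_{1m}^nL_{1m}^{1/2})_{\ge1},L_{1m}\big],\qquad n=0,1,2,\dots$$ define an $N=2$ supersymmetric hierarchy: there are even differential superpolynomials $F_n[U]$ (elements of the free supercommutative algebra on $\partial_y^kU,\partial_y^k\mathbb D_1U,\partial_y^k\mathbb D_2U,\partial_y^k\mathbb D_1\mathbb D_2U$) such that, for evolutionary vector fields on this free algebra, the $n$-th Lax equation holds if and only if $U_{\tau_n}=F_n[U]$ up to an additive complex constant (on which $L_{1m}$ does not depend), and the flows $U_{\tau_n}=F_n[U]$ commute pairwise. In every $N=2$ differential superalgebra, $U_{\tau_n}=F_n[U]$ implies the $n$-th Lax equation, and the latter implies $(U_{\tau_n})_y=(F_n[U])_y$. The flow $n=0$ is the trivial one, $U_{\tau_0}=U_y$, and the first two non-trivial flows are $$U_{\tau_1}=\tfrac i2\Big[(\mathbb D_1\mathbb D_2U_y)+2(\mathbb D_1\mathbb D_2U)U_y+2(\mathbb D_2U_y)(\mathbb D_1U)+2(\mathbb D_2U)(\mathbb D_1U_y)\Big],$$ $$\begin{aligned}U_{\tau_2}=\tfrac14\Big[&U_{3y}-2U_y^3-6(\mathbb D_1\mathbb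 D_2U_y)(\mathbb D_1\mathbb D_2U)-6(\mathbb D_1\mathbb D_2U)^2U_y-3(\mathbb D_2U_y)(\mathbb D_2U)U_y\\&-9(\mathbb D_2U_y)(\mathbb D_1U)(\mathbb D_1\mathbb D_2U)-9(\mathbb D_2U)(\mathbb D_1U_y)(\mathbb D_1\mathbb D_2U)\\&-6(\mathbb D_2U)(\mathbb D_1U)(\mathbb D_1\mathbb D_2U_y)-3(\mathbb D_1U_y)(\mathbb D_1U)U_y\Big].\end{aligned}$$ (d) *Miura map.* If $U$ satisfies the $\tau_2$ flow, then $\Phi=(\mathbb D_1\mathbb D_2U)+(\mathbb D_2U)(\mathbb D_1U)$ satisfies the $N=2$ SKdV$_4$ equation $$\Phi_{\tau_2}=\tfrac14\Big(\Phi_{3y}-3[\Phi(\mathbb D_1\mathbb D_2\Phi)]_y-\tfrac32[\mathbb D_1\mathbb D_2\Phi^2]_y-12\,\Phi^2\Phi_y\Big).$$ -/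

import Mathlib

/-- An `N = 2` differential superalgebra over `ℂ`, i.e. an algebra of superfields: a
supercommutative algebra, with the `ℤ/2`-grading encoded by its parity involution (`a` is even if
`parity a = a` and odd if `parity a = -a`), and two odd superderivations `D₁`, `D₂` such that
`D₁² = D₂²` and `D₁ D₂ = - D₂ D₁`.  The common square is the even derivation `∂_y`. -/
class N2Algebra (A : Type*) [Ring A] [Algebra ℂ A] where
  parity : A →ₐ[ℂ] A
  D₁ : A →ₗ[ℂ] A
  D₂ : A →ₗ[ℂ] A
  parity_parity : ∀ a, parity (parity a) = a
  even_comm : ∀ a b, parity a = a → a * b = b * a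
  odd_anticomm : ∀ a b, parity a = -a → parity b = -b → a * b = -(b * a)
  parity_D₁ : ∀ a, parity (D₁ a) = -D₁ (parity a)
  parity_D₂ : ∀ a, parity (D₂ a) = -D₂ (parity a)
  D₁_mul : ∀ a b, D₁ (a * b) = D₁ a * b + parity a * D₁ b
  D₂_mul : ∀ a b, D₂ (a * b) = D₂ a * b + parity a * D₂ b
  D₁_sq : ∀ a, D₁ (D₁ a) = D₂ (D₂ a)
  D₁_D₂ : ∀ a, D₁ (D₂ a) = -D₂ (D₁ a)

namespace N2Algebra

section

variable {A : Type*} [Ring A] [Algebra ℂ A] [N2Algebra A]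

/-- The derivation `∂_y = D₁² = D₂²`. -/
def dy (a : A) : A := D₁ (D₁ a)

def IsEven (a : A) : Prop := parity a = a

def IsOdd (a : A) : Prop := parity a = -a

end

/-- An even derivation of the superalgebra which commutes with the superderivatives, such as the
derivative with respect to a time, or an evolutionary vector field. -/
structure TimeDerivation (A : Type*) [Ring A] [Algebra ℂ A] [N2Algebra A] where
  toFun : A →ₗ[ℂ] A
  map_mul : ∀ a b, toFun (a * b) = toFun a * b + a * toFun b
  map_parity : ∀ a, toFun (parity a) = parity (toFun a)
  map_D₁ : ∀ a, toFun (D₁ a) = D₁ (toFun a)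
  map_D₂ : ∀ a, toFun (D₂ a) = D₂ (toFun a)

/-- Homomorphisms of `N = 2` differential superalgebras. -/
structure IsSuperHom {A B : Type*} [Ring A] [Algebra ℂ A] [N2Algebra A]
    [Ring B] [Algebra ℂ B] [N2Algebra B] (φ : A →ₐ[ℂ] B) : Prop where
  map_parity : ∀ a, φ (parity a) = parity (φ a)
  map_D₁ : ∀ a, φ (D₁ a) = D₁ (φ a)
  map_D₂ : ∀ a, φ (D₂ a) = D₂ (φ a)

end N2Algebra

open N2Algebra

/-! ### Super pseudo-differential operators -/

/-- Formal super pseudo-differential operators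
`∑_{n ≤ N} (a_{n,0} + a_{n,1} D₁ + a_{n,2} D₂ + a_{n,3} D₁ D₂) ∂_y ^ n`,
with `coeff n s = a_{n,s}`. -/
@[ext]
structure SPDO (A : Type*) [Zero A] where
  coeff : ℤ → Fin 4 → A
  bdd : ∃ N : ℤ, ∀ n, N < n → ∀ s, coeff n s = 0

namespace SPDO

noncomputable section

variable {A : Type*} [Ring A]

instance : Zero (SPDO A) := ⟨⟨fun _ _ => 0, 0, fun _ _ _ => rfl⟩⟩

instance : Add (SPDO A) := ⟨fun P Q => ⟨fun n s => P.coeff n s + Q.coeff n s, by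
  obtain ⟨N, hN⟩ := P.bdd
  obtain ⟨M, hM⟩ := Q.bdd
  exact ⟨max N M, fun n hn s => by
    rw [hN n (lt_of_le_of_lt (le_max_left _ _) hn), hM n (lt_of_le_of_lt (le_max_right _ _) hn),
      add_zero]⟩⟩⟩

instance : Neg (SPDO A) := ⟨fun P => ⟨fun n s => -P.coeff n s, by
  obtain ⟨N, hN⟩ := P.bdd
  exact ⟨N, fun n hn s => by rw [hN n hn, neg_zero]⟩⟩⟩

instance : Sub (SPDO A) := ⟨fun P Q => P + -Q⟩

/-- The operator `a D^s ∂_y ^ n`, where `D^s` is `1, D₁, D₂, D₁ D₂` for `s = 0, 1, 2, 3`. -/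
def mono (n : ℤ) (s : Fin 4) (a : A) : SPDO A :=
  ⟨fun m t => if m = n ∧ t = s then a else 0, n, fun m hm t => by
    rw [if_neg]
    rintro ⟨h, -⟩
    omega⟩

/-- Multiplication by a superfield. -/
def C (a : A) : SPDO A := mono 0 0 a

instance : One (SPDO A) := ⟨C 1⟩

variable [Algebra ℂ A] [N2Algebra A]

/-- Left multiplication by `∂_y ^ n`, for any integer `n`:
`∂_y ^ n a = ∑_k (n choose k) a^{(k)} ∂_y ^ (n - k)`. -/
def dyMul (n : ℤ) (Q : SPDO A) : SPDO A :=
  ⟨fun m t => ∑ᶠ k : ℕ, Ring.choose n k • dy^[k] (Q.coeff (m - n + k) t), by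
    obtain ⟨N, hN⟩ := Q.bdd
    refine ⟨N + n, fun m hm t => ?_⟩
    have h0 : dy (0 : A) = 0 := by simp [dy]
    have h : ∀ k : ℕ, Ring.choose n k • dy^[k] (Q.coeff (m - n + k) t) = 0 := fun k => by
      rw [hN _ (by omega), Function.iterate_fixed h0, smul_zero]
    simp [h]⟩

/-- Left multiplication by `D₁`, from `D₁ a = (D₁ a) + (parity a) D₁`. -/
def D₁Mul (Q : SPDO A) : SPDO A :=
  ⟨fun n t => D₁ (Q.coeff n t) +
      ![parity (Q.coeff (n - 1) 1), parity (Q.coeff n 0),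
        parity (Q.coeff (n - 1) 3), parity (Q.coeff n 2)] t, by
    obtain ⟨N, hN⟩ := Q.bdd
    refine ⟨N + 1, fun n hn t => ?_⟩
    have h1 := hN n (by omega)
    have h2 := hN (n - 1) (by omega)
    fin_cases t <;> simp [h1, h2]⟩

/-- Left multiplication by `D₂`, from `D₂ a = (D₂ a) + (parity a) D₂`; note
`D₂ D₁ = - D₁ D₂` and `D₂ D₁ D₂ = - D₁ ∂_y`. -/
def D₂Mul (Q : SPDO A) : SPDO A :=
  ⟨fun n t => D₂ (Q.coeff n t) +
      ![parity (Q.coeff (n - 1) 2), -parity (Q.coeff (n - 1) 3),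
        parity (Q.coeff n 0), -parity (Q.coeff n 1)] t, by
    obtain ⟨N, hN⟩ := Q.bdd
    refine ⟨N + 1, fun n hn t => ?_⟩
    have h1 := hN n (by omega)
    have h2 := hN (n - 1) (by omega)
    fin_cases t <;> simp [h1, h2]⟩

/-- Left multiplication by `D^s`. -/
def DMul (s : Fin 4) (Q : SPDO A) : SPDO A :=
  ![Q, D₁Mul Q, D₂Mul Q, D₁Mul (D₂Mul Q)] s

lemma dyMul_coeff_eq_zero {Q : SPDO A} {N : ℤ} (hN : ∀ n, N < n → ∀ s, Q.coeff n s = 0)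
    (n m : ℤ) (hm : N + n < m) (t : Fin 4) : (dyMul n Q).coeff m t = 0 := by
  have h0 : dy (0 : A) = 0 := by simp [dy]
  have h : ∀ k : ℕ, Ring.choose n k • dy^[k] (Q.coeff (m - n + k) t) = 0 := fun k => by
    rw [hN _ (by omega), Function.iterate_fixed h0, smul_zero]
  exact (finsum_congr h).trans finsum_zero

lemma D₁Mul_coeff_eq_zero {Q : SPDO A} {N : ℤ} (hN : ∀ n, N < n → ∀ s, Q.coeff n s = 0)
    (m : ℤ) (hm : N + 1 < m) (t : Fin 4) : (D₁Mul Q).coeff m t = 0 := by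
  have h1 := hN m (by omega)
  have h2 := hN (m - 1) (by omega)
  fin_cases t <;> simp [D₁Mul, h1, h2]

lemma D₂Mul_coeff_eq_zero {Q : SPDO A} {N : ℤ} (hN : ∀ n, N < n → ∀ s, Q.coeff n s = 0)
    (m : ℤ) (hm : N + 1 < m) (t : Fin 4) : (D₂Mul Q).coeff m t = 0 := by
  have h1 := hN m (by omega)
  have h2 := hN (m - 1) (by omega)
  fin_cases t <;> simp [D₂Mul, h1, h2]

lemma DMul_coeff_eq_zero {Q : SPDO A} {N : ℤ} (hN : ∀ n, N < n → ∀ s, Q.coeff n s = 0)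
    (s : Fin 4) (m : ℤ) (hm : N + 2 < m) (t : Fin 4) : (DMul s Q).coeff m t = 0 := by
  fin_cases s
  · exact hN m (by omega) t
  · exact D₁Mul_coeff_eq_zero hN m (by omega) t
  · exact D₂Mul_coeff_eq_zero hN m (by omega) t
  · exact D₁Mul_coeff_eq_zero (fun n hn s => D₂Mul_coeff_eq_zero hN n hn s) m (by omega) t

/-- Composition of operators: `(∑ a_{n,s} D^s ∂_y ^ n) Q = ∑ a_{n,s} (D^s (∂_y ^ n Q))`; for each
coefficient of the product only finitely many `n` contribute. -/
instance : Mul (SPDO A) := ⟨fun P Q =>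
  ⟨fun m t => ∑ᶠ n : ℤ, ∑ s : Fin 4, P.coeff n s * (DMul s (dyMul n Q)).coeff m t, by
    obtain ⟨N, hN⟩ := P.bdd
    obtain ⟨M, hM⟩ := Q.bdd
    refine ⟨N + M + 2, fun m hm t => ?_⟩
    have h : ∀ n : ℤ, ∑ s : Fin 4, P.coeff n s * (DMul s (dyMul n Q)).coeff m t = 0 := fun n => by
      refine Finset.sum_eq_zero fun s _ => ?_
      by_cases hn : N < n
      · rw [hN n hn, zero_mul]
      · rw [DMul_coeff_eq_zero (N := M + n) (fun k hk r => dyMul_coeff_eq_zero hM n k hk r) s m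
          (by omega) t, mul_zero]
    simp [h]⟩⟩

instance : Pow (SPDO A) ℕ := ⟨fun P n => npowRec n P⟩

/-- The superderivative `D₁` as an operator. -/
def opD₁ : SPDO A := mono 0 1 1

/-- The superderivative `D₂` as an operator. -/
def opD₂ : SPDO A := mono 0 2 1

/-- The commutator `[P, Q]`. -/
def comm (P Q : SPDO A) : SPDO A := P * Q - Q * P

/-- The projection `P_{≥ 1}`: the differential part of `P` without its term of order zero. -/
def ge1 (P : SPDO A) : SPDO A :=
  ⟨fun n s => if 0 ≤ n ∧ ¬(n = 0 ∧ s = 0) then P.coeff n s else 0, by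
    obtain ⟨N, hN⟩ := P.bdd
    exact ⟨N, fun n hn s => by rw [hN n hn, ite_self]⟩⟩

/-- The time derivative of an operator, taken coefficient by coefficient. -/
def timeDeriv (δ : TimeDerivation A) (P : SPDO A) : SPDO A :=
  ⟨fun n s => δ.toFun (P.coeff n s), by
    obtain ⟨N, hN⟩ := P.bdd
    exact ⟨N, fun n hn s => by rw [hN n hn, map_zero]⟩⟩

/-- `R = ∂_y + ⋯` is a square root of `P`.  Here `⋯` stands for terms of order lower than that of
`∂_y`, where `a D^s ∂_y ^ n` has order `n + |s| / 2` with `|s| = 0, 1, 1, 2`. -/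
def IsSqrt (R P : SPDO A) : Prop :=
  R * R = P ∧ R.coeff 1 0 = 1 ∧
    ∀ (n : ℤ) (s : Fin 4), 2 ≤ 2 * n + ![0, 1, 1, 2] s → ¬(n = 1 ∧ s = 0) → R.coeff n s = 0

end

end SPDO

/-! ### The modified hierarchy -/

section

open SPDO

variable {A : Type*} [Ring A] [Algebra ℂ A] [N2Algebra A]

/-- `D₁ D₂ + (D₂ U) D₁ - (D₁ U) D₂`. -/
noncomputable def laxK (U : A) : SPDO A :=
  opD₁ * opD₂ + C (D₂ U) * opD₁ - C (D₁ U) * opD₂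

/-- `L_{1m} = - [D₁ D₂ + (D₂ U) D₁ - (D₁ U) D₂]²`. -/
noncomputable def laxL (U : A) : SPDO A := -(laxK U * laxK U)

/-- `L̂_{1m} = i [D₁ D₂ + (D₂ U) D₁ - (D₁ U) D₂]`. -/
noncomputable def laxHat (U : A) : SPDO A := C (algebraMap ℂ A Complex.I) * laxK U

/-- The Lax equation `∂_{τ_n} L_{1m} = [(L̂_{1m}^n L_{1m}^{1/2})_{≥ 1}, L_{1m}]`. -/
def LaxEquation (n : ℕ) (U : A) (δ : TimeDerivation A) : Prop :=
  ∀ R : SPDO A, IsSqrt R (laxL U) →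
    timeDeriv δ (laxL U) = comm (ge1 (laxHat U ^ n * R)) (laxL U)

/-- The right-hand side of the first flow. -/
noncomputable def mkdvFlow₁ (U : A) : A :=
  (Complex.I / 2 : ℂ) • (D₁ (D₂ (dy U)) + 2 * D₁ (D₂ U) * dy U + 2 * D₂ (dy U) * D₁ U
    + 2 * D₂ U * D₁ (dy U))

/-- The right-hand side of the second flow. -/
noncomputable def mkdvFlow₂ (U : A) : A :=
  (1 / 4 : ℂ) • (dy (dy (dy U)) - 2 * dy U ^ 3 - 6 * D₁ (D₂ (dy U)) * D₁ (D₂ U)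
    - 6 * D₁ (D₂ U) ^ 2 * dy U - 3 * D₂ (dy U) * D₂ U * dy U
    - 9 * D₂ (dy U) * D₁ U * D₁ (D₂ U) - 9 * D₂ U * D₁ (dy U) * D₁ (D₂ U)
    - 6 * D₂ U * D₁ U * D₁ (D₂ (dy U)) - 3 * D₁ (dy U) * D₁ U * dy U)

/-- The right-hand side of the `N = 2` supersymmetric KdV equation `SKdV_a`. -/
noncomputable def skdv (a : ℂ) (Φ : A) : A :=
  (1 / 4 : ℂ) • (dy (dy (dy Φ)) - 3 * dy (Φ * D₁ (D₂ Φ))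
    - ((a - 1) / 2) • dy (D₁ (D₂ (Φ ^ 2))) - (3 * a) • (Φ ^ 2 * dy Φ))

/-- The Miura map `Φ = D₁ D₂ U + (D₂ U) (D₁ U)`. -/
def miura (U : A) : A := D₁ (D₂ U) + D₂ U * D₁ U

/-- Superconformal change of variables `x = x(y, ϱ)`, `θ_k = θ_k(y, ϱ)`, described by the new
coordinates as superfields in the old ones and by the new superderivatives `E₁`, `E₂` as operators
in the old variables, onto which the old ones are mapped covariantly. -/
structure IsSuperconformal (x θ₁ θ₂ : A) (E₁ E₂ : SPDO A) : Prop where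
  even_x : IsEven x
  odd_θ₁ : IsOdd θ₁
  odd_θ₂ : IsOdd θ₂
  D₁_x : D₁ x = θ₁ * D₁ θ₁ + θ₂ * D₁ θ₂
  D₂_x : D₂ x = θ₁ * D₂ θ₁ + θ₂ * D₂ θ₂
  D₁_θ₂ : D₁ θ₂ = -D₂ θ₁
  D₂_θ₂ : D₂ θ₂ = D₁ θ₁
  chain₁ : opD₁ = C (D₁ θ₁) * E₁ + C (D₁ θ₂) * E₂
  chain₂ : opD₂ = C (D₂ θ₁) * E₁ + C (D₂ θ₂) * E₂

/-- The Lax operator `L₁ = - (W E₁ E₂)²` of the first `N = 2` supersymmetric Harry Dym hierarchy,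
in the superspace with superderivatives `E₁`, `E₂`. -/
noncomputable def harryDymL (W : A) (E₁ E₂ : SPDO A) : SPDO A :=
  -((C W * (E₁ * E₂)) * (C W * (E₁ * E₂)))

end

/-! ### Differential superpolynomials in one even superfield -/

namespace FreeN2

/-- Parity of the generators: `(s, k)` stands for `∂_y ^ k D^s U`, with `D^s = 1, D₁, D₂, D₁ D₂`
for `s = 0, 1, 2, 3`. -/
def sgn (s : Fin 4) : ℂ := ![1, -1, -1, 1] s

/-- The sign in `x y = ± y x` for two generators. -/
def comsgn (s t : Fin 4) : ℂ :=
  ![![1, 1, 1, 1], ![1, -1, -1, 1], ![1, -1, -1, 1], ![1, 1, 1, 1]] s t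

/-- Supercommutativity of the generators. -/
inductive Rel : FreeAlgebra ℂ (Fin 4 × ℕ) → FreeAlgebra ℂ (Fin 4 × ℕ) → Prop
  | swap (x y : Fin 4 × ℕ) : Rel (FreeAlgebra.ι ℂ x * FreeAlgebra.ι ℂ y)
      (comsgn x.1 y.1 • (FreeAlgebra.ι ℂ y * FreeAlgebra.ι ℂ x))

end FreeN2

/-- The algebra of differential superpolynomials in one even superfield `U`: the supercommutative
algebra freely generated by the even elements `∂_y ^ k U`, `∂_y ^ k D₁ D₂ U` and the odd elements
`∂_y ^ k D₁ U`, `∂_y ^ k D₂ U`. -/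
def FreeN2 : Type := RingQuot FreeN2.Rel

namespace FreeN2

noncomputable section

instance : Semiring FreeN2 := inferInstanceAs (Semiring (RingQuot Rel))

instance : Algebra ℂ FreeN2 := inferInstanceAs (Algebra ℂ (RingQuot Rel))

instance : Ring FreeN2 := Algebra.semiringToRing ℂ

/-- The quotient map from the free algebra. -/
def mk : FreeAlgebra ℂ (Fin 4 × ℕ) →ₐ[ℂ] FreeN2 := RingQuot.mkAlgHom ℂ Rel

/-- The generator `∂_y ^ k D^s U`. -/
def gen (x : Fin 4 × ℕ) : FreeN2 := mk (FreeAlgebra.ι ℂ x)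

/-- The superfield `U` itself. -/
def U : FreeN2 := gen (0, 0)

lemma gen_mul (x y : Fin 4 × ℕ) : gen x * gen y = comsgn x.1 y.1 • (gen y * gen x) := by
  have h : mk _ = mk _ := RingQuot.mkAlgHom_rel ℂ (Rel.swap x y)
  simpa [gen] using h

lemma induction {p : FreeN2 → Prop} (h1 : ∀ c : ℂ, p (algebraMap ℂ FreeN2 c))
    (h2 : ∀ x, p (gen x)) (h3 : ∀ a b, p a → p b → p (a * b)) (h4 : ∀ a b, p a → p b → p (a + b))
    (a : FreeN2) : p a := by
  obtain ⟨b, rfl⟩ : ∃ b, mk b = a := RingQuot.mkAlgHom_surjective ℂ Rel a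
  induction b using FreeAlgebra.induction with
  | grade0 c => simpa using h1 c
  | grade1 x => exact h2 x
  | mul a b ha hb => simpa using h3 _ _ ha hb
  | add a b ha hb => simpa using h4 _ _ ha hb

/-- Extension of a map on the generators to an algebra homomorphism. -/
def lift {B : Type*} [Ring B] [Algebra ℂ B] (f : Fin 4 × ℕ → B)
    (hf : ∀ x y, f x * f y = comsgn x.1 y.1 • (f y * f x)) : FreeN2 →ₐ[ℂ] B :=
  RingQuot.liftAlgHom ℂ ⟨FreeAlgebra.lift ℂ f, by
    rintro _ _ ⟨x, y⟩
    simpa using hf x y⟩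

lemma lift_gen {B : Type*} [Ring B] [Algebra ℂ B] (f : Fin 4 × ℕ → B)
    (hf : ∀ x y, f x * f y = comsgn x.1 y.1 • (f y * f x)) (x : Fin 4 × ℕ) :
    lift f hf (gen x) = f x := by
  refine (RingQuot.liftAlgHom_mkAlgHom_apply (A := FreeAlgebra ℂ (Fin 4 × ℕ)) ℂ _ _ _).trans ?_
  simp

/-- The parity involution. -/
def par : FreeN2 →ₐ[ℂ] FreeN2 := lift (fun x => sgn x.1 • gen x) (fun x y => by
  simp only [smul_mul_smul_comm]
  rw [gen_mul x y, smul_smul, smul_smul, mul_comm (sgn x.1), mul_comm (comsgn _ _)])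

lemma par_gen (x : Fin 4 × ℕ) : par (gen x) = sgn x.1 • gen x := lift_gen _ _ x

/-- `D₁` on the generators: `D₁ (1, D₁, D₂, D₁ D₂) = (D₁, ∂_y, D₁ D₂, D₂ ∂_y)`. -/
def d₁ (x : Fin 4 × ℕ) : FreeN2 :=
  gen ((![1, 0, 3, 2] : Fin 4 → Fin 4) x.1, x.2 + (![0, 1, 0, 1] : Fin 4 → ℕ) x.1)

/-- `D₂` on the generators: `D₂ (1, D₁, D₂, D₁ D₂) = (D₂, - D₁ D₂, ∂_y, - D₁ ∂_y)`. -/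
def d₂ (x : Fin 4 × ℕ) : FreeN2 :=
  (![1, -1, 1, -1] : Fin 4 → ℂ) x.1 •
    gen ((![2, 3, 0, 1] : Fin 4 → Fin 4) x.1, x.2 + (![0, 0, 1, 1] : Fin 4 → ℕ) x.1)

/-- A superderivation `d` is encoded by the homomorphism `a ↦ !![parity a, d a; 0, a]`. -/
def derMat (d : Fin 4 × ℕ → FreeN2)
    (hd : ∀ x y, sgn x.1 • (gen x * d y) + d x * gen y
      = comsgn x.1 y.1 • (sgn y.1 • (gen y * d x) + d y * gen x)) :
    FreeN2 →ₐ[ℂ] Matrix (Fin 2) (Fin 2) FreeN2 :=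
  lift (fun x => !![par (gen x), d x; 0, gen x]) (fun x y => by
    have h1 : par (gen x) * par (gen y) = comsgn x.1 y.1 • (par (gen y) * par (gen x)) := by
      rw [← map_mul, gen_mul x y, map_smul, map_mul]
    have h3 := gen_mul x y
    have h2 := hd x y
    ext i j
    fin_cases i <;> fin_cases j
    · simpa [Matrix.mul_apply] using h1
    · simpa [Matrix.mul_apply, par_gen] using h2
    · simp [Matrix.mul_apply]
    · simpa [Matrix.mul_apply] using h3)

lemma hd₁ (x y : Fin 4 × ℕ) : sgn x.1 • (gen x * d₁ y) + d₁ x * gen y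
      = comsgn x.1 y.1 • (sgn y.1 • (gen y * d₁ x) + d₁ y * gen x) := by
  rw [d₁, d₁, gen_mul x, gen_mul _ y]
  obtain ⟨s, k⟩ := x
  obtain ⟨t, l⟩ := y
  fin_cases s <;> fin_cases t <;> simp [sgn, comsgn] <;> abel

lemma hd₂ (x y : Fin 4 × ℕ) : sgn x.1 • (gen x * d₂ y) + d₂ x * gen y
      = comsgn x.1 y.1 • (sgn y.1 • (gen y * d₂ x) + d₂ y * gen x) := by
  rw [d₂, d₂, mul_smul_comm, smul_mul_assoc, gen_mul x, gen_mul _ y]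
  obtain ⟨s, k⟩ := x
  obtain ⟨t, l⟩ := y
  fin_cases s <;> fin_cases t <;> simp [sgn, comsgn] <;> abel

/-- The superderivation with values `d` on the generators. -/
def der (d : Fin 4 × ℕ → FreeN2)
    (hd : ∀ x y, sgn x.1 • (gen x * d y) + d x * gen y
      = comsgn x.1 y.1 • (sgn y.1 • (gen y * d x) + d y * gen x)) : FreeN2 →ₗ[ℂ] FreeN2 where
  toFun a := derMat d hd a 0 1
  map_add' a b := by simp
  map_smul' c a := by simp

section

variable (d : Fin 4 × ℕ → FreeN2)
    (hd : ∀ x y, sgn x.1 • (gen x * d y) + d x * gen y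
      = comsgn x.1 y.1 • (sgn y.1 • (gen y * d x) + d y * gen x))

lemma derMat_eq (a : FreeN2) : derMat d hd a = !![par a, der d hd a; 0, a] := by
  have h : derMat d hd a 0 0 = par a ∧ derMat d hd a 1 0 = 0 ∧ derMat d hd a 1 1 = a := by
    induction a using induction with
    | h1 c => simp [Matrix.algebraMap_matrix_apply]
    | h2 x => simp [derMat, lift_gen, par_gen]
    | h3 a b ha hb => simp [Matrix.mul_apply, ha, hb]
    | h4 a b ha hb => simp [ha, hb]
  ext i j
  fin_cases i <;> fin_cases j
  · simpa using h.1
  · rfl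
  · simpa using h.2.1
  · simpa using h.2.2

lemma der_gen (x : Fin 4 × ℕ) : der d hd (gen x) = d x := by
  simp [der, derMat, lift_gen]

lemma der_algebraMap (c : ℂ) : der d hd (algebraMap ℂ FreeN2 c) = 0 := by
  simp [der, Matrix.algebraMap_matrix_apply]

lemma der_mul (a b : FreeN2) : der d hd (a * b) = der d hd a * b + par a * der d hd b := by
  have h : der d hd (a * b) = (derMat d hd a * derMat d hd b) 0 1 := by rw [← map_mul]; rfl
  rw [h, derMat_eq d hd a, derMat_eq d hd b]
  simp [Matrix.mul_apply, add_comm]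

end

lemma par_par (a : FreeN2) : par (par a) = a := by
  induction a using induction with
  | h1 c => simp
  | h2 x =>
    obtain ⟨s, k⟩ := x
    fin_cases s <;> simp [par_gen, sgn]
  | h3 a b ha hb => simp [ha, hb]
  | h4 a b ha hb => simp [ha, hb]

lemma par_der (d : Fin 4 × ℕ → FreeN2)
    (hd : ∀ x y, sgn x.1 • (gen x * d y) + d x * gen y
      = comsgn x.1 y.1 • (sgn y.1 • (gen y * d x) + d y * gen x))
    (hp : ∀ x, par (d x) = -(sgn x.1 • d x)) (a : FreeN2) :
    par (der d hd a) = -der d hd (par a) := by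
  induction a using induction with
  | h1 c => simp [der_algebraMap]
  | h2 x => simp [der_gen, par_gen, hp]
  | h3 a b ha hb =>
    simp only [der_mul, map_mul, map_add, ha, hb, neg_mul, mul_neg, neg_add]
  | h4 a b ha hb =>
    simp only [map_add, ha, hb, neg_add]

/-- Even generators are central, odd ones are moved past `a` by `gen x * a = par a * gen x`. -/
lemma gen_mul_eq (x : Fin 4 × ℕ) (a : FreeN2) :
    gen x * a = (if sgn x.1 = 1 then a else par a) * gen x := by
  induction a using induction with
  | h1 c => split_ifs <;> simp [Algebra.commutes]
  | h2 y =>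
    rw [gen_mul x y]
    obtain ⟨s, k⟩ := x
    obtain ⟨t, l⟩ := y
    fin_cases s <;> fin_cases t <;> norm_num [sgn, comsgn, par_gen]
  | h3 a b ha hb =>
    rw [← mul_assoc, ha, mul_assoc, hb, ← mul_assoc]
    split_ifs <;> simp
  | h4 a b ha hb =>
    rw [mul_add, ha, hb, ← add_mul]
    split_ifs <;> simp

lemma even_mul (a b : FreeN2) (ha : par a = a) : a * b = b * a := by
  induction b using induction with
  | h1 c => simp [Algebra.commutes]
  | h2 x => rw [gen_mul_eq, ha, ite_self]
  | h3 b c hb hc => rw [← mul_assoc, hb, mul_assoc, hc, mul_assoc]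
  | h4 b c hb hc => rw [mul_add, hb, hc, add_mul]

lemma odd_mul (a b : FreeN2) (ha : par a = -a) : a * b = par b * a := by
  induction b using induction with
  | h1 c => simp [Algebra.commutes]
  | h2 x =>
    rw [par_gen, smul_mul_assoc, gen_mul_eq, ha]
    obtain ⟨s, k⟩ := x
    fin_cases s <;> norm_num [sgn]
  | h3 b c hb hc => rw [← mul_assoc, hb, mul_assoc, hc, map_mul, mul_assoc]
  | h4 b c hb hc => rw [mul_add, hb, hc, map_add, add_mul]

instance : N2Algebra FreeN2 where
  parity := par
  D₁ := der d₁ hd₁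
  D₂ := der d₂ hd₂
  parity_parity := par_par
  even_comm := even_mul
  odd_anticomm a b ha hb := by rw [odd_mul a b ha, hb, neg_mul]
  parity_D₁ := par_der d₁ hd₁ (fun x => by
    obtain ⟨s, k⟩ := x
    fin_cases s <;> simp [d₁, par_gen, sgn])
  parity_D₂ := par_der d₂ hd₂ (fun x => by
    obtain ⟨s, k⟩ := x
    fin_cases s <;> simp [d₂, par_gen, sgn])
  D₁_mul := der_mul d₁ hd₁
  D₂_mul := der_mul d₂ hd₂
  D₁_sq a := by
    induction a using induction with
    | h1 c => simp [der_algebraMap]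
    | h2 x =>
      obtain ⟨s, k⟩ := x
      fin_cases s <;> simp [der_gen, d₁, d₂]
    | h3 a b ha hb =>
      have e1 := par_der d₁ hd₁ (fun x => by
        obtain ⟨s, k⟩ := x
        fin_cases s <;> simp [d₁, par_gen, sgn]) a
      have e2 := par_der d₂ hd₂ (fun x => by
        obtain ⟨s, k⟩ := x
        fin_cases s <;> simp [d₂, par_gen, sgn]) a
      simp only [der_mul, map_add, ha, hb, e1, e2, par_par]
      simp only [neg_mul]
      abel
    | h4 a b ha hb => simp only [map_add, ha, hb]
  D₁_D₂ a := by
    induction a using induction with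
    | h1 c => simp [der_algebraMap]
    | h2 x =>
      obtain ⟨s, k⟩ := x
      fin_cases s <;> simp [der_gen, d₁, d₂]
    | h3 a b ha hb =>
      have e1 := par_der d₁ hd₁ (fun x => by
        obtain ⟨s, k⟩ := x
        fin_cases s <;> simp [d₁, par_gen, sgn]) a
      have e2 := par_der d₂ hd₂ (fun x => by
        obtain ⟨s, k⟩ := x
        fin_cases s <;> simp [d₂, par_gen, sgn]) a
      simp only [der_mul, map_add, ha, hb, e1, e2, par_par]
      simp only [neg_mul, mul_neg]
      abel
    | h4 a b ha hb => simp only [map_add, ha, hb, neg_add]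

end

end FreeN2

/-! Super pseudo-differential operators form an associative ring, filtered by the order in which
`D₁`, `D₂` have order 1/2. The filtration is separated and complete. If `R` and `S` both begin with
`∂_y`, the map `X ↦ X R + S X` has leading part `2 X ∂_y` and is therefore injective
(`eq_zero_of_anticomm`). This gives uniqueness of the square root, shows that the root commutes with
everything that commutes with its square, and determines its time derivative. Existence is Newton
iteration (`exists_sqrt`).

Write `K` for `laxK U`, `P_n = L̂ ^ n L ^ (1/2)`, `B_n = (P_n)_{≥ 1}`, and `F_n` for minus the
multiplication term of `P_n`. Since `P_n` commutes with `K`, the operator `[B_n, K] = -[P_n - B_n,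
K]` has order at most 1/2. It is also differential and kills constants, so it equals `α D₁ + β D₂`.
The coefficients come from a symmetry: for the adjoint with weight `e ^ (2U)` the operator `K` is
symmetric, hence `L ^ (1/2)` and `P_n` are antisymmetric, and `B_n` is antisymmetric up to `2 F_n`
(`adj_ge1`). Comparing `[B_n, K]` with its adjoint yields `α = D₂ F_n`, `β = -D₁ F_n`
(`commutator_ge1_laxK`), which is the variation of `K` under `U_τ = F_n`. Conversely, if the Lax
equation holds and `g = U_τ - F_n`, the variation of `K` along `g` anticommutes with `K`, and the
`∂_y` coefficient of the anticommutator is `2 g_y`; so `g_y = 0` (`dy_eq_of_laxEquation`). In the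
free algebra only constants are killed by `∂_y`, which follows from Euler's formula and
`[∂/∂u_{k+1}, ∂_y] = ∂/∂u_k`.

The flows commute by a zero-curvature argument (`flow_comm`): the multiplication term of `[B_m,
B_n]` vanishes because both factors kill constants, and that of `[P_m - B_m, P_n - B_n]` vanishes
because the symbols `a + e D₁ D₂ ∂_y⁻¹` commute up to negative order. Homomorphisms preserve the
root, so the `F_n` computed in the free algebra serve every algebra of superfields.

For the explicit flows put `d_k = D_k - (D_k U)`, `p = d₁²`, `J = d₁ d₂ p⁻¹` and `Φ = miura U`. Then
`J² = -1`, `J` commutes with `p`, and `K = p J + Φ`, so `p - (Φ J + J Φ) / 2` is a square root of `L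
= -K²` up to an error of order at most -1/2. One further correction suffices for the flow `n = 2`.
The Harry Dym identity and the Miura map are direct computations. -/

set_option linter.unusedSectionVars false

/-! ### Rules for `D₁`, `D₂` and `∂_y` on superfields. -/

namespace N2Algebra

variable {A : Type*} [Ring A] [Algebra ℂ A] [N2Algebra A]

lemma D₁_one : D₁ (1 : A) = 0 := by
  simpa using D₁_mul (1 : A) 1

lemma D₂_one : D₂ (1 : A) = 0 := by
  simpa using D₂_mul (1 : A) 1

lemma D₁_algebraMap (c : ℂ) : D₁ (algebraMap ℂ A c) = 0 := by
  rw [Algebra.algebraMap_eq_smul_one, map_smul, D₁_one, smul_zero]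

lemma D₂_algebraMap (c : ℂ) : D₂ (algebraMap ℂ A c) = 0 := by
  rw [Algebra.algebraMap_eq_smul_one, map_smul, D₂_one, smul_zero]

lemma D₂_D₂ (a : A) : D₂ (D₂ a) = dy a := (D₁_sq a).symm

lemma D₁_D₁ (a : A) : D₁ (D₁ a) = dy a := rfl

lemma D₂_D₁ (a : A) : D₂ (D₁ a) = -D₁ (D₂ a) := by rw [D₁_D₂, neg_neg]

lemma dy_add (a b : A) : dy (a + b) = dy a + dy b := by simp [dy]

lemma dy_sub (a b : A) : dy (a - b) = dy a - dy b := by simp [dy]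

lemma dy_neg (a : A) : dy (-a) = -dy a := by simp [dy]

lemma dy_zero : dy (0 : A) = 0 := by simp [dy]

lemma dy_smul (c : ℂ) (a : A) : dy (c • a) = c • dy a := by simp [dy]

lemma dy_one : dy (1 : A) = 0 := by simp [dy, D₁_one]

lemma dy_algebraMap (c : ℂ) : dy (algebraMap ℂ A c) = 0 := by simp [dy, D₁_algebraMap]

lemma dy_mul (a b : A) : dy (a * b) = dy a * b + a * dy b := by
  simp only [dy, D₁_mul, map_add, parity_D₁, parity_parity, neg_mul]
  abel

lemma parity_dy (a : A) : parity (dy a) = dy (parity a) := by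
  simp [dy, parity_D₁]

lemma D₁_dy (a : A) : D₁ (dy a) = dy (D₁ a) := rfl

lemma D₂_dy (a : A) : D₂ (dy a) = dy (D₂ a) := by
  rw [← D₂_D₂, ← D₂_D₂]

/-- `∂_y` as a linear map. -/
def dyLin : A →ₗ[ℂ] A := D₁ ∘ₗ D₁

lemma dy_iterate (k : ℕ) (a : A) : dy^[k] a = (dyLin ^ k) a := by
  rw [Module.End.pow_apply]; rfl

end N2Algebra

namespace SPDO

noncomputable section

/-! ### The additive group of operators and its filtration by order. -/

section Additive

variable {A : Type*} [Ring A]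

@[simp] lemma zero_coeff (n : ℤ) (s : Fin 4) : (0 : SPDO A).coeff n s = 0 := rfl

@[simp] lemma add_coeff (P Q : SPDO A) (n : ℤ) (s : Fin 4) :
    (P + Q).coeff n s = P.coeff n s + Q.coeff n s := rfl

@[simp] lemma neg_coeff (P : SPDO A) (n : ℤ) (s : Fin 4) : (-P).coeff n s = -P.coeff n s := rfl

@[simp] lemma sub_coeff (P Q : SPDO A) (n : ℤ) (s : Fin 4) :
    (P - Q).coeff n s = P.coeff n s - Q.coeff n s := by
  rw [sub_eq_add_neg]; rfl

lemma mono_coeff (n : ℤ) (s : Fin 4) (a : A) (m : ℤ) (t : Fin 4) :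
    (mono n s a).coeff m t = if m = n ∧ t = s then a else 0 := rfl

lemma ext_coeff {P Q : SPDO A} (h : ∀ n s, P.coeff n s = Q.coeff n s) : P = Q :=
  SPDO.ext (funext fun n => funext fun s => h n s)

instance : AddCommGroup (SPDO A) where
  add_assoc P Q R := ext_coeff fun n s => add_assoc _ _ _
  zero_add P := ext_coeff fun n s => zero_add _
  add_zero P := ext_coeff fun n s => add_zero _
  add_comm P Q := ext_coeff fun n s => add_comm _ _
  neg_add_cancel P := ext_coeff fun n s => neg_add_cancel _
  sub_eq_add_neg P Q := rfl
  nsmul := nsmulRec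
  zsmul := zsmulRec

/-- The coefficient of `D^s ∂_y ^ n`, as an additive map. -/
def coeffHom (n : ℤ) (s : Fin 4) : SPDO A →+ A where
  toFun P := P.coeff n s
  map_zero' := rfl
  map_add' _ _ := rfl

lemma sum_coeff {ι : Type*} (I : Finset ι) (f : ι → SPDO A) (n : ℤ) (s : Fin 4) :
    (∑ i ∈ I, f i).coeff n s = ∑ i ∈ I, (f i).coeff n s :=
  map_sum (coeffHom n s) f I

@[simp] lemma mono_zero (n : ℤ) (s : Fin 4) : mono n s (0 : A) = 0 :=
  ext_coeff fun m t => by simp [mono_coeff]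

lemma mono_add (n : ℤ) (s : Fin 4) (a b : A) : mono n s (a + b) = mono n s a + mono n s b :=
  ext_coeff fun m t => by simp only [mono_coeff, add_coeff]; split_ifs <;> simp

lemma mono_neg (n : ℤ) (s : Fin 4) (a : A) : mono n s (-a) = -mono n s a :=
  ext_coeff fun m t => by simp only [mono_coeff, neg_coeff]; split_ifs <;> simp

/-- Twice the order of `D^s`. -/
def wt (s : Fin 4) : ℤ := ![0, 1, 1, 2] s

@[simp] lemma wt_zero : wt 0 = 0 := rfl
@[simp] lemma wt_one : wt 1 = 1 := rfl
@[simp] lemma wt_two : wt 2 = 1 := rfl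
@[simp] lemma wt_three : wt 3 = 2 := rfl

lemma wt_nonneg (s : Fin 4) : 0 ≤ wt s := by fin_cases s <;> simp

lemma wt_le (s : Fin 4) : wt s ≤ 2 := by fin_cases s <;> simp

/-- The operators of order at most `k / 2`, where `D₁`, `D₂` have order `1 / 2`. -/
def ordLE (A : Type*) [Ring A] (k : ℤ) : AddSubgroup (SPDO A) where
  carrier := {P | ∀ n s, k < 2 * n + wt s → P.coeff n s = 0}
  zero_mem' _ _ _ := rfl
  add_mem' hP hQ n s h := by rw [add_coeff, hP n s h, hQ n s h, add_zero]
  neg_mem' hP n s h := by rw [neg_coeff, hP n s h, neg_zero]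

lemma ordLE_mono {j k : ℤ} (h : j ≤ k) {P : SPDO A} (hP : P ∈ ordLE A j) : P ∈ ordLE A k :=
  fun n s hn => hP n s (by omega)

lemma exists_mem_ordLE (P : SPDO A) : ∃ k, P ∈ ordLE A k := by
  obtain ⟨N, hN⟩ := P.bdd
  exact ⟨2 * N + 2, fun n s h => hN n (by have := wt_le s; omega) s⟩

lemma exists_mem_ordLE₂ (P Q : SPDO A) : ∃ k, P ∈ ordLE A k ∧ Q ∈ ordLE A k := by
  obtain ⟨j, hj⟩ := exists_mem_ordLE P
  obtain ⟨k, hk⟩ := exists_mem_ordLE Q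
  exact ⟨max j k, ordLE_mono (le_max_left _ _) hj, ordLE_mono (le_max_right _ _) hk⟩

lemma mono_mem_ordLE (n : ℤ) (s : Fin 4) (a : A) : mono n s a ∈ ordLE A (2 * n + wt s) := by
  intro m t h
  rw [mono_coeff, if_neg]
  rintro ⟨rfl, rfl⟩
  omega

/-- The filtration is separated, since each coefficient sits at a finite order. The cut-off `k₀` is
for callers whose estimates hold only in low orders. -/
lemma eq_zero_of_forall_mem {P : SPDO A} (k₀ : ℤ) (h : ∀ k ≤ k₀, P ∈ ordLE A k) : P = 0 :=
  ext_coeff fun n s => h (min k₀ (2 * n + wt s - 1)) (min_le_left _ _) n s (by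
    have := min_le_right k₀ (2 * n + wt s - 1); omega)

/-- Up to operators of low order, every operator is a finite sum of monomials. -/
lemma exists_sum_mono (P : SPDO A) (k : ℤ) :
    ∃ I : Finset ℤ, P - ∑ n ∈ I, ∑ s : Fin 4, mono n s (P.coeff n s) ∈ ordLE A k := by
  obtain ⟨N, hN⟩ := P.bdd
  refine ⟨Finset.Icc (k / 2 - 1) N, fun n s h => ?_⟩
  have h2 := wt_le s
  rw [sub_coeff, sum_coeff]
  simp only [sum_coeff, mono_coeff]
  by_cases hn : N < n
  · rw [hN n hn, zero_sub, neg_eq_zero]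
    refine Finset.sum_eq_zero fun m hm => Finset.sum_eq_zero fun t _ => if_neg ?_
    rintro ⟨rfl, -⟩
    rw [Finset.mem_Icc] at hm
    omega
  · rw [Finset.sum_eq_single n, Finset.sum_eq_single s]
    · simp
    · intro t _ ht
      rw [if_neg]
      rintro ⟨-, rfl⟩
      exact ht rfl
    · simp
    · intro m _ hm
      refine Finset.sum_eq_zero fun t _ => if_neg ?_
      rintro ⟨rfl, -⟩
      exact hm rfl
    · intro hn'
      exact absurd (Finset.mem_Icc.2 ⟨by omega, by omega⟩) hn'

lemma one_def : (1 : SPDO A) = mono 0 0 1 := rfl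

end Additive

/-! ### Maps compatible with the filtration. -/

section Bounded

variable {A B : Type*} [Ring A] [Ring B]

/-- Additive maps that raise the order by a bounded amount. -/
def IsBounded (f : SPDO A →+ SPDO B) : Prop :=
  ∃ c : ℤ, ∀ k, ∀ P ∈ ordLE A k, f P ∈ ordLE B (k + c)

/-- A finite sum of monomials approximates `P` up to arbitrarily low order, bounded maps send the
remainder to low order, and the filtration is separated. Most identities between products of
operators below are reduced to monomials in this way. -/
lemma IsBounded.ext {f g : SPDO A →+ SPDO B} (hf : IsBounded f) (hg : IsBounded g)
    (h : ∀ n s a, f (mono n s a) = g (mono n s a)) : f = g := by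
  obtain ⟨c, hc⟩ := hf
  obtain ⟨d, hd⟩ := hg
  ext1 P
  rw [← sub_eq_zero]
  refine eq_zero_of_forall_mem 0 fun k _ => ?_
  obtain ⟨I, hI⟩ := exists_sum_mono P (k - max c d)
  have e : f P - g P = f (P - ∑ n ∈ I, ∑ s : Fin 4, mono n s (P.coeff n s))
      - g (P - ∑ n ∈ I, ∑ s : Fin 4, mono n s (P.coeff n s)) := by
    simp only [map_sub, map_sum, h]
    abel
  rw [e]
  have h1 := le_max_left c d
  have h2 := le_max_right c d
  exact sub_mem (ordLE_mono (by omega) (hc _ _ hI)) (ordLE_mono (by omega) (hd _ _ hI))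

lemma IsBounded.comp {A' : Type*} [Ring A'] {f : SPDO B →+ SPDO A'} {g : SPDO A →+ SPDO B}
    (hf : IsBounded f) (hg : IsBounded g) :
    IsBounded (f.comp g) := by
  obtain ⟨c, hc⟩ := hf
  obtain ⟨d, hd⟩ := hg
  exact ⟨d + c, fun k P hP => by rw [← add_assoc]; exact hc _ _ (hd _ _ hP)⟩

end Bounded

/-! ### Associativity of the composition of operators. -/

section Ring

variable {A : Type*} [Ring A] [Algebra ℂ A] [N2Algebra A]

@[simp] lemma D₁Mul_coeff_zero' (Q : SPDO A) (n : ℤ) :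
    (D₁Mul Q).coeff n 0 = D₁ (Q.coeff n 0) + parity (Q.coeff (n - 1) 1) := rfl
@[simp] lemma D₁Mul_coeff_one (Q : SPDO A) (n : ℤ) :
    (D₁Mul Q).coeff n 1 = D₁ (Q.coeff n 1) + parity (Q.coeff n 0) := rfl
@[simp] lemma D₁Mul_coeff_two (Q : SPDO A) (n : ℤ) :
    (D₁Mul Q).coeff n 2 = D₁ (Q.coeff n 2) + parity (Q.coeff (n - 1) 3) := rfl
@[simp] lemma D₁Mul_coeff_three (Q : SPDO A) (n : ℤ) :
    (D₁Mul Q).coeff n 3 = D₁ (Q.coeff n 3) + parity (Q.coeff n 2) := rfl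
@[simp] lemma D₂Mul_coeff_zero' (Q : SPDO A) (n : ℤ) :
    (D₂Mul Q).coeff n 0 = D₂ (Q.coeff n 0) + parity (Q.coeff (n - 1) 2) := rfl
@[simp] lemma D₂Mul_coeff_one (Q : SPDO A) (n : ℤ) :
    (D₂Mul Q).coeff n 1 = D₂ (Q.coeff n 1) + -parity (Q.coeff (n - 1) 3) := rfl
@[simp] lemma D₂Mul_coeff_two (Q : SPDO A) (n : ℤ) :
    (D₂Mul Q).coeff n 2 = D₂ (Q.coeff n 2) + parity (Q.coeff n 0) := rfl
@[simp] lemma D₂Mul_coeff_three (Q : SPDO A) (n : ℤ) :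
    (D₂Mul Q).coeff n 3 = D₂ (Q.coeff n 3) + -parity (Q.coeff n 1) := rfl

lemma forall_fin_four {p : Fin 4 → Prop} (h0 : p 0) (h1 : p 1) (h2 : p 2) (h3 : p 3) (s : Fin 4) :
    p s := by
  fin_cases s <;> assumption

lemma D₁Mul_add (P Q : SPDO A) : D₁Mul (P + Q) = D₁Mul P + D₁Mul Q :=
  ext_coeff fun n => forall_fin_four (by simp; abel) (by simp; abel) (by simp; abel) (by simp; abel)

lemma D₂Mul_add (P Q : SPDO A) : D₂Mul (P + Q) = D₂Mul P + D₂Mul Q :=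
  ext_coeff fun n => forall_fin_four (by simp; abel) (by simp; abel) (by simp; abel) (by simp; abel)

lemma D₁Mul_D₁Mul_coeff (Q : SPDO A) (n : ℤ) (s : Fin 4) :
    (D₁Mul (D₁Mul Q)).coeff n s = dy (Q.coeff n s) + Q.coeff (n - 1) s := by
  revert s
  refine forall_fin_four ?_ ?_ ?_ ?_ <;> simp [parity_D₁, parity_parity, dy]

lemma D₂Mul_D₂Mul (Q : SPDO A) : D₂Mul (D₂Mul Q) = D₁Mul (D₁Mul Q) := by
  refine ext_coeff fun n s => ?_
  rw [D₁Mul_D₁Mul_coeff]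
  revert s
  refine forall_fin_four ?_ ?_ ?_ ?_ <;>
  · simp [parity_D₂, parity_parity, D₂_D₂]
    try abel

lemma D₂Mul_D₁Mul (Q : SPDO A) : D₂Mul (D₁Mul Q) = -D₁Mul (D₂Mul Q) := by
  refine ext_coeff fun n s => ?_
  revert s
  refine forall_fin_four ?_ ?_ ?_ ?_ <;>
  · simp [parity_D₁, parity_D₂, parity_parity, D₂_D₁]
    try abel

lemma D₁Mul_neg (P : SPDO A) : D₁Mul (-P) = -D₁Mul P :=
  ext_coeff fun n => forall_fin_four (by simp; abel) (by simp; abel) (by simp; abel) (by simp; abel)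

lemma D₁Mul_mem {k : ℤ} {Q : SPDO A} (hQ : Q ∈ ordLE A k) : D₁Mul Q ∈ ordLE A (k + 1) := by
  intro n s
  revert s
  refine forall_fin_four ?_ ?_ ?_ ?_ <;> intro h <;> simp at h ⊢ <;>
  rw [hQ _ _ (by simp; omega), hQ _ _ (by simp; omega)] <;> simp

lemma D₂Mul_mem {k : ℤ} {Q : SPDO A} (hQ : Q ∈ ordLE A k) : D₂Mul Q ∈ ordLE A (k + 1) := by
  intro n s
  revert s
  refine forall_fin_four ?_ ?_ ?_ ?_ <;> intro h <;> simp at h ⊢ <;>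
  rw [hQ _ _ (by simp; omega), hQ _ _ (by simp; omega)] <;> simp

lemma DMul_mem {k : ℤ} {Q : SPDO A} (hQ : Q ∈ ordLE A k) (s : Fin 4) :
    DMul s Q ∈ ordLE A (k + wt s) := by
  revert s
  refine forall_fin_four ?_ ?_ ?_ ?_
  · simpa [DMul] using hQ
  · exact D₁Mul_mem hQ
  · exact D₂Mul_mem hQ
  · have h := D₁Mul_mem (D₂Mul_mem hQ)
    rwa [add_assoc] at h

lemma dyMul_coeff_eq_sum {k : ℤ} {Q : SPDO A} (hQ : Q ∈ ordLE A k) (n m : ℤ) (t : Fin 4) (K : ℕ)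
    (hK : k < 2 * (m - n + K)) :
    (dyMul n Q).coeff m t
      = ∑ i ∈ Finset.range K, Ring.choose n i • dy^[i] (Q.coeff (m - n + i) t) := by
  refine finsum_eq_sum_of_support_subset _ fun i hi => ?_
  by_contra hlt
  simp only [Finset.coe_range, Set.mem_Iio, not_lt] at hlt
  refine hi ?_
  simp only
  rw [hQ _ _ (by have := wt_nonneg t; omega), Function.iterate_fixed dy_zero, smul_zero]

lemma dyMul_mem {k : ℤ} {Q : SPDO A} (hQ : Q ∈ ordLE A k) (n : ℤ) :
    dyMul n Q ∈ ordLE A (k + 2 * n) := by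
  intro m s h
  refine (finsum_congr fun i => ?_).trans finsum_zero
  rw [hQ _ _ (by omega), Function.iterate_fixed dy_zero, smul_zero]

lemma dyMul_add (n : ℤ) (P Q : SPDO A) : dyMul n (P + Q) = dyMul n P + dyMul n Q := by
  refine ext_coeff fun m t => ?_
  obtain ⟨k, hP, hQ⟩ := exists_mem_ordLE₂ P Q
  obtain ⟨K, hK⟩ : ∃ K : ℕ, k < 2 * (m - n + K) := ⟨(k - m + n).toNat + (n - m).toNat + 1, by omega⟩
  rw [add_coeff, dyMul_coeff_eq_sum hP n m t K hK, dyMul_coeff_eq_sum hQ n m t K hK,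
    dyMul_coeff_eq_sum (add_mem hP hQ) n m t K hK, ← Finset.sum_add_distrib]
  refine Finset.sum_congr rfl fun i _ => ?_
  rw [add_coeff, dy_iterate, map_add, smul_add, dy_iterate, dy_iterate]

lemma dyMul_zero (Q : SPDO A) : dyMul 0 Q = Q := by
  refine ext_coeff fun m t => ?_
  refine (finsum_eq_single _ 0 fun i hi => ?_).trans ?_
  · obtain ⟨j, rfl⟩ := Nat.exists_eq_succ_of_ne_zero hi
    rw [Nat.succ_eq_add_one, Ring.choose_zero_succ, zero_smul]
  · simp

/-- Pascal's rule for the generalized binomial coefficients, matched against `∂_y a = a' + a ∂_y`.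
-/
lemma dyMul_succ (n : ℤ) (Q : SPDO A) : dyMul (n + 1) Q = D₁Mul (D₁Mul (dyMul n Q)) := by
  refine ext_coeff fun m t => ?_
  obtain ⟨k, hQ⟩ := exists_mem_ordLE Q
  obtain ⟨K, hK⟩ : ∃ K : ℕ, k < 2 * (m - n - 1 + K) :=
    ⟨(k - m + n).toNat + (n - m).toNat + 2, by omega⟩
  rw [D₁Mul_D₁Mul_coeff, dyMul_coeff_eq_sum hQ (n + 1) m t (K + 1) (by omega),
    dyMul_coeff_eq_sum hQ n m t K (by omega), dyMul_coeff_eq_sum hQ n (m - 1) t (K + 1) (by omega),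
    Finset.sum_range_succ', Finset.sum_range_succ' _ K, ← add_assoc]
  congr 1
  · have h : dy (∑ i ∈ Finset.range K, Ring.choose n i • dy^[i] (Q.coeff (m - n + i) t))
        = ∑ i ∈ Finset.range K, Ring.choose n i • dy^[i + 1] (Q.coeff (m - n + i) t) := by
      change dyLin _ = _
      rw [map_sum]
      refine Finset.sum_congr rfl fun i _ => ?_
      rw [map_zsmul, Function.iterate_succ_apply']
      rfl
    rw [h, ← Finset.sum_add_distrib]
    refine Finset.sum_congr rfl fun i _ => ?_
    rw [Ring.choose_succ_succ, add_smul]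
    have e1 : m - (n + 1) + ((i + 1 : ℕ) : ℤ) = m - n + i := by push_cast; ring
    have e2 : m - 1 - n + ((i + 1 : ℕ) : ℤ) = m - n + i := by push_cast; ring
    rw [e1, e2]
  · simp only [Ring.choose_zero_right, one_smul, Function.iterate_zero, id]
    congr 1
    push_cast
    ring

/-- The top coefficients of `∂_y Q` are those of `Q`, shifted by one power; descending in the order,
the difference of `P` and `Q` vanishes. Cancelling `∂_y` is what extends identities to negative
powers, by induction over the integers. -/
lemma D₁Mul_injective_sq {P Q : SPDO A} (h : D₁Mul (D₁Mul P) = D₁Mul (D₁Mul Q)) : P = Q := by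
  obtain ⟨k, hP, hQ⟩ := exists_mem_ordLE₂ P Q
  have key : ∀ j : ℕ, P - Q ∈ ordLE A (k - j) := by
    intro j
    induction j with
    | zero => simpa using sub_mem hP hQ
    | succ j ih =>
      intro n s hn
      have h1 := congrArg (fun R : SPDO A => R.coeff (n + 1) s) h
      simp only [D₁Mul_D₁Mul_coeff, add_sub_cancel_right] at h1
      have h2 := ih (n + 1) s (by push_cast at hn; omega)
      rw [sub_coeff, sub_eq_zero] at h2 ⊢
      rwa [h2, add_right_inj] at h1
  rw [← sub_eq_zero]
  refine eq_zero_of_forall_mem k fun i hi => ?_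
  have := key (k - i).toNat
  rwa [show k - ((k - i).toNat : ℤ) = i by omega] at this

/-- A map that commutes with left multiplication by `∂_y` commutes with its integral powers. -/
lemma map_dyMul {B : Type*} [Ring B] [Algebra ℂ B] [N2Algebra B] (f : SPDO A → SPDO B)
    (hf : ∀ Q, f (D₁Mul (D₁Mul Q)) = D₁Mul (D₁Mul (f Q))) (n : ℤ) (Q : SPDO A) :
    f (dyMul n Q) = dyMul n (f Q) := by
  induction n using Int.induction_on with
  | zero => rw [dyMul_zero, dyMul_zero]
  | succ n ih => rw [dyMul_succ, hf, ih, ← dyMul_succ]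
  | pred n ih =>
    apply D₁Mul_injective_sq
    rw [← hf, ← dyMul_succ, ← dyMul_succ, sub_add_cancel, ih]

lemma mul_coeff_def (P Q : SPDO A) (m : ℤ) (t : Fin 4) : (P * Q).coeff m t
    = ∑ᶠ n : ℤ, ∑ s : Fin 4, P.coeff n s * (DMul s (dyMul n Q)).coeff m t := rfl

lemma mul_coeff {j k : ℤ} {P Q : SPDO A} (hP : P ∈ ordLE A j) (hQ : Q ∈ ordLE A k) (m : ℤ)
    (t : Fin 4) (I : Finset ℤ) (hI : ∀ n, 2 * m - k - 2 ≤ 2 * n → 2 * n ≤ j → n ∈ I) :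
    (P * Q).coeff m t
      = ∑ n ∈ I, ∑ s : Fin 4, P.coeff n s * (DMul s (dyMul n Q)).coeff m t := by
  rw [mul_coeff_def]
  refine finsum_eq_sum_of_support_subset _ fun n hn => ?_
  by_contra hlt
  refine hn (Finset.sum_eq_zero fun s _ => ?_)
  have ht := wt_nonneg t
  have hs := wt_nonneg s
  have hs' := wt_le s
  by_cases h1 : 2 * n ≤ j
  · rw [DMul_mem (dyMul_mem hQ n) s m t, mul_zero]
    by_contra h2
    exact hlt (hI n (by omega) h1)
  · rw [hP n s (by omega), zero_mul]

lemma mul_mem {j k : ℤ} {P Q : SPDO A} (hP : P ∈ ordLE A j) (hQ : Q ∈ ordLE A k) :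
    P * Q ∈ ordLE A (j + k) := by
  intro m t h
  rw [mul_coeff_def]
  refine (finsum_congr fun n => Finset.sum_eq_zero fun s _ => ?_).trans finsum_zero
  by_cases h1 : 2 * n + wt s ≤ j
  · rw [DMul_mem (dyMul_mem hQ n) s m t (by omega), mul_zero]
  · rw [hP n s (by omega), zero_mul]

lemma exists_finset (m j k : ℤ) : ∃ I : Finset ℤ, ∀ n : ℤ,
    2 * m - k - 2 ≤ 2 * n → 2 * n ≤ j → n ∈ I :=
  ⟨Finset.Icc (m - k / 2 - 2) (j / 2), fun n h1 h2 => Finset.mem_Icc.2 ⟨by omega, by omega⟩⟩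

lemma DMul_add (s : Fin 4) (P Q : SPDO A) : DMul s (P + Q) = DMul s P + DMul s Q := by
  revert s
  refine forall_fin_four ?_ ?_ ?_ ?_ <;> simp [DMul, D₁Mul_add, D₂Mul_add]

lemma left_distrib' (P Q R : SPDO A) : P * (Q + R) = P * Q + P * R := by
  refine ext_coeff fun m t => ?_
  obtain ⟨j, hP⟩ := exists_mem_ordLE P
  obtain ⟨k, hQ, hR⟩ := exists_mem_ordLE₂ Q R
  obtain ⟨I, hI⟩ := exists_finset m j k
  rw [add_coeff, mul_coeff hP hQ m t I hI, mul_coeff hP hR m t I hI,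
    mul_coeff hP (add_mem hQ hR) m t I hI, ← Finset.sum_add_distrib]
  refine Finset.sum_congr rfl fun n _ => ?_
  rw [← Finset.sum_add_distrib]
  refine Finset.sum_congr rfl fun s _ => ?_
  rw [dyMul_add, DMul_add, add_coeff, mul_add]

lemma right_distrib' (P Q R : SPDO A) : (P + Q) * R = P * R + Q * R := by
  refine ext_coeff fun m t => ?_
  obtain ⟨j, hR⟩ := exists_mem_ordLE R
  obtain ⟨k, hP, hQ⟩ := exists_mem_ordLE₂ P Q
  obtain ⟨I, hI⟩ := exists_finset m k j
  rw [add_coeff, mul_coeff hP hR m t I hI, mul_coeff hQ hR m t I hI,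
    mul_coeff (add_mem hP hQ) hR m t I hI, ← Finset.sum_add_distrib]
  refine Finset.sum_congr rfl fun n _ => ?_
  rw [← Finset.sum_add_distrib]
  refine Finset.sum_congr rfl fun s _ => ?_
  rw [add_coeff, add_mul]

lemma mono_mul_coeff (n : ℤ) (s : Fin 4) (a : A) (Q : SPDO A) (m : ℤ) (t : Fin 4) :
    (mono n s a * Q).coeff m t = a * (DMul s (dyMul n Q)).coeff m t := by
  rw [mul_coeff_def, finsum_eq_single _ n, Finset.sum_eq_single s]
  · simp [mono_coeff]
  · intro t _ ht
    rw [mono_coeff, if_neg (by rintro ⟨-, rfl⟩; exact ht rfl), zero_mul]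
  · simp
  · intro k hk
    refine Finset.sum_eq_zero fun t _ => ?_
    rw [mono_coeff, if_neg (by rintro ⟨rfl, -⟩; exact hk rfl), zero_mul]

@[simp] lemma C_mul_coeff (a : A) (Q : SPDO A) (m : ℤ) (t : Fin 4) :
    (C a * Q).coeff m t = a * Q.coeff m t := by
  rw [C, mono_mul_coeff, dyMul_zero]
  rfl

lemma mono_mul (n : ℤ) (s : Fin 4) (a : A) (Q : SPDO A) :
    mono n s a * Q = C a * DMul s (dyMul n Q) :=
  ext_coeff fun m t => by rw [mono_mul_coeff, C_mul_coeff]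

lemma C_mul_mul (a : A) (Q R : SPDO A) : C a * Q * R = C a * (Q * R) := by
  refine ext_coeff fun m t => ?_
  obtain ⟨k, hQ⟩ := exists_mem_ordLE Q
  obtain ⟨j, hR⟩ := exists_mem_ordLE R
  obtain ⟨I, hI⟩ := exists_finset m k j
  have h : C a * Q ∈ ordLE A k := fun n s hn => by rw [C_mul_coeff, hQ n s hn, mul_zero]
  rw [C_mul_coeff, mul_coeff h hR m t I hI, mul_coeff hQ hR m t I hI, Finset.mul_sum]
  refine Finset.sum_congr rfl fun n _ => ?_
  rw [Finset.mul_sum]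
  refine Finset.sum_congr rfl fun s _ => ?_
  rw [C_mul_coeff, mul_assoc]

lemma C_mul_C_mul (a b : A) (Q : SPDO A) : C a * (C b * Q) = C (a * b) * Q :=
  ext_coeff fun m t => by simp [mul_assoc]

lemma D₁Mul_C_mul (a : A) (Q : SPDO A) :
    D₁Mul (C a * Q) = C (D₁ a) * Q + C (parity a) * D₁Mul Q :=
  ext_coeff fun m => forall_fin_four
    (by simp [D₁_mul, mul_add]; abel) (by simp [D₁_mul, mul_add]; abel)
    (by simp [D₁_mul, mul_add]; abel) (by simp [D₁_mul, mul_add]; abel)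

lemma D₂Mul_C_mul (a : A) (Q : SPDO A) :
    D₂Mul (C a * Q) = C (D₂ a) * Q + C (parity a) * D₂Mul Q :=
  ext_coeff fun m => forall_fin_four
    (by simp [D₂_mul, mul_add]; abel) (by simp [D₂_mul, mul_add]; abel)
    (by simp [D₂_mul, mul_add]; abel) (by simp [D₂_mul, mul_add]; abel)

/-- Right multiplication, as an additive map. -/
def mulRightHom (R : SPDO A) : SPDO A →+ SPDO A :=
  AddMonoidHom.mk' (fun P => P * R) fun P Q => right_distrib' P Q R

lemma mulRightHom_bounded (R : SPDO A) : IsBounded (mulRightHom R) := by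
  obtain ⟨c, hc⟩ := exists_mem_ordLE R
  exact ⟨c, fun k P hP => mul_mem hP hc⟩

def D₁Hom : SPDO A →+ SPDO A := AddMonoidHom.mk' D₁Mul D₁Mul_add

def D₂Hom : SPDO A →+ SPDO A := AddMonoidHom.mk' D₂Mul D₂Mul_add

lemma D₁Hom_bounded : IsBounded (D₁Hom (A := A)) := ⟨1, fun _ _ h => D₁Mul_mem h⟩

lemma D₂Hom_bounded : IsBounded (D₂Hom (A := A)) := ⟨1, fun _ _ h => D₂Mul_mem h⟩

lemma D₁Mul_mono (n : ℤ) (s : Fin 4) (a : A) : D₁Mul (mono n s a) = mono n s (D₁ a)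
    + mono (![n, n + 1, n, n + 1] s) ((![1, 0, 3, 2] : Fin 4 → Fin 4) s) (parity a) := by
  refine ext_coeff fun m t => ?_
  have e : m - 1 = n ↔ m = n + 1 := by omega
  revert s t
  refine forall_fin_four ?_ ?_ ?_ ?_ <;> refine forall_fin_four ?_ ?_ ?_ ?_ <;>
  · simp [mono_coeff, e]
    try (split_ifs <;> simp)

lemma D₂Mul_mono (n : ℤ) (s : Fin 4) (a : A) : D₂Mul (mono n s a) = mono n s (D₂ a)
    + mono (![n, n, n + 1, n + 1] s) ((![2, 3, 0, 1] : Fin 4 → Fin 4) s)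
      (![parity a, -parity a, parity a, -parity a] s) := by
  refine ext_coeff fun m t => ?_
  have e : m - 1 = n ↔ m = n + 1 := by omega
  revert s t
  refine forall_fin_four ?_ ?_ ?_ ?_ <;> refine forall_fin_four ?_ ?_ ?_ ?_ <;>
  · simp [mono_coeff, e]
    try (split_ifs <;> simp)

lemma C_neg_mul (a : A) (Q : SPDO A) : C (-a) * Q = -(C a * Q) :=
  ext_coeff fun m t => by simp

lemma C_mul_neg (a : A) (Q : SPDO A) : C a * -Q = -(C a * Q) :=
  ext_coeff fun m t => by simp

/-- Associativity with left factor `D₁`. On a monomial it amounts to the Leibniz rule together with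
the multiplication table of the `D^s`. -/
lemma D₁Mul_mul (Q R : SPDO A) : D₁Mul Q * R = D₁Mul (Q * R) := by
  refine DFunLike.congr_fun (IsBounded.ext (f := (mulRightHom R).comp D₁Hom)
    (g := D₁Hom.comp (mulRightHom R)) ((mulRightHom_bounded R).comp D₁Hom_bounded)
    (D₁Hom_bounded.comp (mulRightHom_bounded R)) fun n s a => ?_) Q
  change D₁Mul (mono n s a) * R = D₁Mul (mono n s a * R)
  rw [D₁Mul_mono, right_distrib', mono_mul, mono_mul, mono_mul, D₁Mul_C_mul]
  congr 2
  revert s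
  refine forall_fin_four ?_ ?_ ?_ ?_ <;> simp [DMul, dyMul_succ, D₂Mul_D₁Mul, D₁Mul_neg]

lemma D₂Mul_mul (Q R : SPDO A) : D₂Mul Q * R = D₂Mul (Q * R) := by
  refine DFunLike.congr_fun (IsBounded.ext (f := (mulRightHom R).comp D₂Hom)
    (g := D₂Hom.comp (mulRightHom R)) ((mulRightHom_bounded R).comp D₂Hom_bounded)
    (D₂Hom_bounded.comp (mulRightHom_bounded R)) fun n s a => ?_) Q
  change D₂Mul (mono n s a) * R = D₂Mul (mono n s a * R)
  rw [D₂Mul_mono, right_distrib', mono_mul, mono_mul, mono_mul, D₂Mul_C_mul]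
  congr 1
  revert s
  refine forall_fin_four ?_ ?_ ?_ ?_ <;>
    simp [DMul, dyMul_succ, D₂Mul_D₁Mul, D₁Mul_neg, D₂Mul_D₂Mul, C_neg_mul, C_mul_neg]

lemma dyMul_mul (n : ℤ) (Q R : SPDO A) : dyMul n Q * R = dyMul n (Q * R) :=
  map_dyMul (fun Q => Q * R) (fun Q => by simp only [D₁Mul_mul]) n Q

lemma DMul_mul (s : Fin 4) (Q R : SPDO A) : DMul s Q * R = DMul s (Q * R) := by
  revert s
  refine forall_fin_four ?_ ?_ ?_ ?_ <;> simp [DMul, D₁Mul_mul, D₂Mul_mul]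

/-- Left multiplication by a monomial is a composite of multiplications by a superfield, by `D^s`
and by a power of `∂_y`, each already known to commute with right multiplication. -/
lemma mul_assoc' (P Q R : SPDO A) : P * Q * R = P * (Q * R) := by
  refine DFunLike.congr_fun (IsBounded.ext (f := (mulRightHom R).comp (mulRightHom Q))
    (g := mulRightHom (Q * R)) ((mulRightHom_bounded R).comp (mulRightHom_bounded Q))
    (mulRightHom_bounded _) fun n s a => ?_) P
  change mono n s a * Q * R = mono n s a * (Q * R)
  rw [mono_mul, mono_mul, C_mul_mul, DMul_mul, dyMul_mul]

lemma dyMul_mono_one (n m : ℤ) : dyMul n (mono m 0 (1 : A)) = mono (n + m) 0 1 := by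
  have h : D₁ (1 : A) = 0 := D₁_one
  have key : ∀ m : ℤ, D₁Mul (D₁Mul (mono m 0 (1 : A))) = mono (m + 1) 0 1 := fun m => by
    simp [D₁Mul_mono, h]
  induction n using Int.induction_on with
  | zero => rw [dyMul_zero, zero_add]
  | succ n ih => rw [dyMul_succ, ih, key]; congr 1; ring
  | pred n ih =>
    apply D₁Mul_injective_sq
    rw [← dyMul_succ, key, sub_add_cancel, ih]
    congr 1
    ring

lemma DMul_mono_one (s : Fin 4) (n : ℤ) : DMul s (mono n 0 (1 : A)) = mono n s 1 := by
  have h1 : D₁ (1 : A) = 0 := D₁_one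
  have h2 : D₂ (1 : A) = 0 := D₂_one
  revert s
  refine forall_fin_four ?_ ?_ ?_ ?_ <;> simp [DMul, D₁Mul_mono, D₂Mul_mono, h1, h2]

lemma one_mul' (P : SPDO A) : 1 * P = P := by
  refine ext_coeff fun m t => ?_
  rw [one_def, ← C, C_mul_coeff, one_mul]

lemma mul_one' (P : SPDO A) : P * 1 = P := by
  refine DFunLike.congr_fun (IsBounded.ext (f := mulRightHom 1) (g := AddMonoidHom.id _)
    (mulRightHom_bounded _) ⟨0, fun k P h => by simpa using h⟩ fun n s a => ?_) P
  change mono n s a * 1 = mono n s a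
  rw [mono_mul, one_def, dyMul_mono_one, DMul_mono_one]
  refine ext_coeff fun m t => ?_
  simp [mono_coeff]

instance : Ring (SPDO A) where
  left_distrib := left_distrib'
  right_distrib := right_distrib'
  zero_mul P := by
    simpa using right_distrib' 0 0 P
  mul_zero P := by
    simpa using left_distrib' P 0 0
  mul_assoc := mul_assoc'
  one_mul := one_mul'
  mul_one := mul_one'
  npow n P := P ^ n
  npow_zero _ := rfl
  npow_succ _ _ := rfl
  neg_add_cancel := neg_add_cancel
  zsmul := zsmulRec

end Ring

end

end SPDO

namespace SPDO

noncomputable section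

variable {A : Type*} [Ring A] [Algebra ℂ A] [N2Algebra A]

/-! ### Generators of the ring of operators and its complex algebra structure. -/

section Basic

lemma C_coeff (a : A) (n : ℤ) (s : Fin 4) : (C a).coeff n s = if n = 0 ∧ s = 0 then a else 0 := rfl

@[simp] lemma C_one : C (1 : A) = 1 := rfl

@[simp] lemma C_zero : C (0 : A) = 0 := mono_zero _ _

lemma C_add (a b : A) : C (a + b) = C a + C b := mono_add _ _ _ _

lemma C_neg (a : A) : C (-a) = -C a := mono_neg _ _ _

lemma C_sub (a b : A) : C (a - b) = C a - C b := by
  rw [sub_eq_add_neg, C_add, C_neg, sub_eq_add_neg]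

lemma C_mul (a b : A) : C (a * b) = C a * C b := by
  rw [← mul_one (C b), C_mul_C_mul, mul_one]

/-- The operator `D^s`. -/
def opD (s : Fin 4) : SPDO A := mono 0 s 1

/-- The operator `∂_y ^ n`. -/
def dyPow (n : ℤ) : SPDO A := mono n 0 1

lemma dyPow_mul (n : ℤ) (Q : SPDO A) : dyPow n * Q = dyMul n Q := by
  rw [dyPow, mono_mul, C_one, one_mul]
  rfl

lemma opD_mul (s : Fin 4) (Q : SPDO A) : opD s * Q = DMul s Q := by
  rw [opD, mono_mul, C_one, one_mul, dyMul_zero]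

lemma opD₁_mul (Q : SPDO A) : opD₁ * Q = D₁Mul Q := opD_mul 1 Q

lemma opD₂_mul (Q : SPDO A) : opD₂ * Q = D₂Mul Q := opD_mul 2 Q

lemma opD_zero : opD (A := A) 0 = 1 := rfl

lemma opD_one : opD (A := A) 1 = opD₁ := rfl

lemma opD_two : opD (A := A) 2 = opD₂ := rfl

lemma dyPow_mul_dyPow (m n : ℤ) : dyPow m * dyPow n = (dyPow (m + n) : SPDO A) := by
  rw [dyPow_mul, dyPow, dyMul_mono_one, dyPow]

@[simp] lemma dyPow_zero : dyPow 0 = (1 : SPDO A) := rfl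

lemma mono_eq (n : ℤ) (s : Fin 4) (a : A) : mono n s a = C a * opD s * dyPow n := by
  rw [mul_assoc, opD_mul, dyPow, DMul_mono_one]
  refine ext_coeff fun m t => ?_
  simp [mono_coeff]

lemma opD_three : opD (A := A) 3 = opD₁ * opD₂ := by
  rw [opD₁_mul, ← mul_one opD₂, opD₂_mul, opD, one_def, ← DMul_mono_one]
  rfl

lemma dyMul_one_eq (Q : SPDO A) : dyMul 1 Q = D₁Mul (D₁Mul Q) := by
  rw [← zero_add (1 : ℤ), dyMul_succ, dyMul_zero]

lemma opD₁_mul_opD₁ : opD₁ * opD₁ = (dyPow 1 : SPDO A) := by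
  rw [← mul_one (opD₁ * opD₁), mul_assoc, opD₁_mul, opD₁_mul, ← dyMul_one_eq, ← dyPow_mul, mul_one]

lemma opD₂_mul_opD₂ : opD₂ * opD₂ = (dyPow 1 : SPDO A) := by
  rw [← mul_one (opD₂ * opD₂), mul_assoc, opD₂_mul, opD₂_mul, D₂Mul_D₂Mul, ← dyMul_one_eq,
    ← dyPow_mul, mul_one]

lemma opD₂_mul_opD₁ : opD₂ * opD₁ = -(opD₁ * opD₂ : SPDO A) := by
  rw [← mul_one (opD₂ * opD₁), mul_assoc, opD₁_mul, opD₂_mul, D₂Mul_D₁Mul, ← opD₂_mul, ← opD₁_mul,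
    mul_one]

lemma opD₁_mul_C (a : A) : opD₁ * C a = C (D₁ a) + C (parity a) * opD₁ := by
  rw [← mul_one (C a), opD₁_mul, D₁Mul_C_mul, ← opD₁_mul, mul_one, mul_one]

lemma opD₂_mul_C (a : A) : opD₂ * C a = C (D₂ a) + C (parity a) * opD₂ := by
  rw [← mul_one (C a), opD₂_mul, D₂Mul_C_mul, ← opD₂_mul, mul_one, mul_one]

lemma dyPow_one_mul_coeff (Q : SPDO A) (n : ℤ) (s : Fin 4) :
    (dyPow 1 * Q).coeff n s = dy (Q.coeff n s) + Q.coeff (n - 1) s := by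
  rw [dyPow_mul, dyMul_one_eq, D₁Mul_D₁Mul_coeff]

lemma dyPow_one_mul_C (a : A) : dyPow 1 * C a = C (dy a) + C a * dyPow 1 := by
  rw [← opD₁_mul_opD₁, mul_assoc, opD₁_mul_C, mul_add, ← mul_assoc, opD₁_mul_C, opD₁_mul_C,
    parity_D₁, parity_parity, C_neg, add_mul, mul_assoc]
  simp only [dy]
  noncomm_ring

lemma mono_mul_dyPow (n k : ℤ) (s : Fin 4) (a : A) : mono n s a * dyPow k = mono (n + k) s a := by
  rw [mono_eq, mul_assoc, dyPow_mul_dyPow, mono_eq]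

/-- Coefficients stand on the left of `∂_y`, so a power on the right is a pure shift. -/
lemma mul_dyPow_coeff (P : SPDO A) (k m : ℤ) (t : Fin 4) :
    (P * dyPow k).coeff m t = P.coeff (m - k) t := by
  obtain ⟨j, hP⟩ := exists_mem_ordLE P
  let sh : SPDO A →+ SPDO A := AddMonoidHom.mk' (fun P => ⟨fun m t => P.coeff (m - k) t, by
    obtain ⟨N, hN⟩ := P.bdd
    exact ⟨N + k, fun n hn => hN _ (by omega)⟩⟩) fun P Q => rfl
  have h : mulRightHom (dyPow k) = sh := by
    refine IsBounded.ext (mulRightHom_bounded _) ⟨2 * k, fun i P hP n s h => hP _ _ (by omega)⟩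
      fun n s a => ?_
    change mono n s a * dyPow k = _
    rw [mono_mul_dyPow]
    refine ext_coeff fun m t => ?_
    change _ = (mono n s a).coeff (m - k) t
    simp only [mono_coeff, sub_eq_iff_eq_add]
  exact congrArg (fun P : SPDO A => P.coeff m t) (DFunLike.congr_fun h P)

lemma opD₁_mem : (opD₁ : SPDO A) ∈ ordLE A 1 := mono_mem_ordLE 0 1 1

lemma opD₂_mem : (opD₂ : SPDO A) ∈ ordLE A 1 := mono_mem_ordLE 0 2 1

lemma C_mem (a : A) : C a ∈ ordLE A 0 := mono_mem_ordLE 0 0 a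

lemma dyPow_mem (n : ℤ) : (dyPow n : SPDO A) ∈ ordLE A (2 * n) := by
  have h := mono_mem_ordLE n 0 (1 : A)
  rwa [wt_zero, add_zero] at h

lemma mul_mem_of_le {i j k : ℤ} {P Q : SPDO A} (hP : P ∈ ordLE A i) (hQ : Q ∈ ordLE A j)
    (h : i + j ≤ k) : P * Q ∈ ordLE A k := ordLE_mono h (mul_mem hP hQ)

/-- `∂_y` as a unit. -/
def dyUnit : (SPDO A)ˣ := ⟨dyPow 1, dyPow (-1), by rw [dyPow_mul_dyPow]; rfl,
  by rw [dyPow_mul_dyPow]; rfl⟩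

lemma dyUnit_zpow (n : ℤ) : ((dyUnit ^ n : (SPDO A)ˣ) : SPDO A) = dyPow n := by
  induction n using Int.induction_on with
  | zero => rfl
  | succ n ih => rw [zpow_add_one, Units.val_mul, ih]; exact dyPow_mul_dyPow _ _
  | pred n ih => rw [zpow_sub_one, Units.val_mul, ih]; exact dyPow_mul_dyPow _ _

lemma mulLeft_bounded (R : SPDO A) : IsBounded (AddMonoidHom.mulLeft R) := by
  obtain ⟨c, hc⟩ := exists_mem_ordLE R
  exact ⟨c, fun k P hP => by rw [add_comm]; exact mul_mem hc hP⟩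

/-- An operator commuting with `A`, `D₁` and `D₂` is central. -/
lemma commute_of_generators {X : SPDO A} (hC : ∀ a, Commute X (C a)) (h1 : Commute X opD₁)
    (h2 : Commute X opD₂) (P : SPDO A) : Commute X P := by
  refine DFunLike.congr_fun (IsBounded.ext (f := AddMonoidHom.mulLeft X) (g := mulRightHom X)
    (mulLeft_bounded X) (mulRightHom_bounded _) fun n s a => ?_) P
  change Commute X (mono n s a)
  have hD : Commute X (opD s) := by
    revert s
    refine forall_fin_four (Commute.one_right X) h1 h2 ?_
    rw [opD_three]
    exact h1.mul_right h2
  have hd : Commute X (dyPow n) := by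
    rw [← dyUnit_zpow]
    refine Commute.units_zpow_right (u := dyUnit) ?_ n
    change Commute X (dyPow 1)
    rw [← opD₁_mul_opD₁]
    exact h1.mul_right h1
  rw [mono_eq]
  exact ((hC a).mul_right hD).mul_right hd

instance : SMul ℂ (SPDO A) := ⟨fun c P => ⟨fun n s => c • P.coeff n s, by
  obtain ⟨N, hN⟩ := P.bdd
  exact ⟨N, fun n hn s => by rw [hN n hn, smul_zero]⟩⟩⟩

@[simp] lemma smul_coeff (c : ℂ) (P : SPDO A) (n : ℤ) (s : Fin 4) :
    (c • P).coeff n s = c • P.coeff n s := rfl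

instance : Module ℂ (SPDO A) where
  one_smul P := ext_coeff fun n s => one_smul _ _
  mul_smul c d P := ext_coeff fun n s => mul_smul _ _ _
  smul_zero c := ext_coeff fun n s => smul_zero _
  smul_add c P Q := ext_coeff fun n s => smul_add _ _ _
  add_smul c d P := ext_coeff fun n s => add_smul _ _ _
  zero_smul P := ext_coeff fun n s => zero_smul _ _

lemma C_algebraMap_mul (c : ℂ) (P : SPDO A) : C (algebraMap ℂ A c) * P = c • P :=
  ext_coeff fun n s => by rw [C_mul_coeff, smul_coeff, Algebra.smul_def]

lemma C_algebraMap_commute (c : ℂ) (P : SPDO A) : Commute (C (algebraMap ℂ A c)) P := by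
  refine commute_of_generators (fun a => ?_) ?_ ?_ P
  · rw [commute_iff_eq, ← C_mul, ← C_mul, Algebra.commutes]
  · rw [commute_iff_eq, opD₁_mul_C, D₁_algebraMap, AlgHom.commutes, C_zero, zero_add]
  · rw [commute_iff_eq, opD₂_mul_C, D₂_algebraMap, AlgHom.commutes, C_zero, zero_add]

instance : Algebra ℂ (SPDO A) := Algebra.ofModule
  (fun c P Q => by rw [← C_algebraMap_mul, ← C_algebraMap_mul, mul_assoc])
  (fun c P Q => by rw [← C_algebraMap_mul, ← C_algebraMap_mul, ← mul_assoc,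
    ← (C_algebraMap_commute c P).eq, mul_assoc])

lemma C_smul (c : ℂ) (a : A) : C (c • a) = c • C a :=
  ext_coeff fun n s => by simp [C_coeff]

lemma smul_mem_ordLE (c : ℂ) {k : ℤ} {P : SPDO A} (hP : P ∈ ordLE A k) : c • P ∈ ordLE A k :=
  fun n s h => by rw [smul_coeff, hP n s h, smul_zero]

lemma smul_mem_ordLE_iff {c : ℂ} (hc : c ≠ 0) {k : ℤ} {P : SPDO A} :
    c • P ∈ ordLE A k ↔ P ∈ ordLE A k :=
  ⟨fun h => by simpa [smul_smul, hc] using smul_mem_ordLE c⁻¹ h, smul_mem_ordLE c⟩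

lemma dyPow_one_commutator_mem {k : ℤ} {X : SPDO A} (hX : X ∈ ordLE A k) :
    dyPow 1 * X - X * dyPow 1 ∈ ordLE A k := fun n s h => by
  rw [sub_coeff, dyPow_one_mul_coeff, mul_dyPow_coeff, hX n s h, dy_zero, zero_add, sub_self]

end Basic

/-! ### Completeness and inverses. -/

section Complete

/-- The space of operators is complete for the filtration by the order. -/
lemma exists_limit (X : ℕ → SPDO A) (c : ℤ) (h : ∀ j : ℕ, X (j + 1) - X j ∈ ordLE A (c - j)) :
    ∃ R : SPDO A, ∀ j : ℕ, R - X j ∈ ordLE A (c - j) := by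
  have hd : ∀ i j : ℕ, X (j + i) - X j ∈ ordLE A (c - j) := by
    intro i j
    induction i with
    | zero => simp [zero_mem]
    | succ i ih =>
      have := add_mem (ordLE_mono (by push_cast; omega) (h (j + i))) ih
      rwa [sub_add_sub_cancel] at this
  have hs : ∀ (i j : ℕ) (n : ℤ) (s : Fin 4), c - i < 2 * n + wt s → c - j < 2 * n + wt s →
      (X i).coeff n s = (X j).coeff n s := by
    intro i j n s hi hj
    rcases le_total i j with hij | hij
    · have := hd (j - i) i n s hi
      rw [Nat.add_sub_cancel' hij, sub_coeff, sub_eq_zero] at this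
      exact this.symm
    · have := hd (i - j) j n s hj
      rwa [Nat.add_sub_cancel' hij, sub_coeff, sub_eq_zero] at this
  -- The coefficient at `(n, s)` no longer changes once `c - j < 2 * n + wt s`, and the index `c - 2
  -- * n + 1` achieves this for every `s`. For large `n` it truncates to `0`, so the bound of `X 0`
  -- applies.
  refine ⟨⟨fun n s => (X (c - 2 * n + 1).toNat).coeff n s, ?_⟩, fun j n s hn => ?_⟩
  · obtain ⟨N, hN⟩ := (X 0).bdd
    refine ⟨max N c.natAbs, fun n hn s => ?_⟩
    have h1 : N < n := lt_of_le_of_lt (le_max_left _ _) hn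
    have h2 : (c.natAbs : ℤ) < n := lt_of_le_of_lt (le_max_right _ _) hn
    rw [show (c - 2 * n + 1).toNat = 0 by omega]
    exact hN n h1 s
  · rw [sub_coeff, sub_eq_zero]
    refine hs _ _ n s ?_ hn
    have := wt_nonneg s
    omega

/-- Geometric series: replacing `T` by `T + (1 - (1 + Y) T)` multiplies the error on the left by
`-Y`, which lowers its order by at least 1/2 at each step. -/
lemma exists_rightInv_one_add {Y : SPDO A} (hY : Y ∈ ordLE A (-1)) :
    ∃ T : SPDO A, (1 + Y) * T = 1 ∧ T - 1 ∈ ordLE A (-1) := by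
  let X : ℕ → SPDO A := fun j => Nat.rec 1 (fun _ T => T + (1 - (1 + Y) * T)) j
  have hX : ∀ j, X (j + 1) = X j + (1 - (1 + Y) * X j) := fun j => rfl
  have he : ∀ j : ℕ, 1 - (1 + Y) * X j ∈ ordLE A (-1 - j) := by
    intro j
    induction j with
    | zero =>
      have : 1 - (1 + Y) * X 0 = -Y := by
        change 1 - (1 + Y) * 1 = -Y
        noncomm_ring
      rw [this]
      simpa using neg_mem hY
    | succ j ih =>
      have : 1 - (1 + Y) * X (j + 1) = -(Y * (1 - (1 + Y) * X j)) := by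
        rw [hX]
        noncomm_ring
      rw [this]
      exact neg_mem (mul_mem_of_le hY ih (by push_cast; omega))
  obtain ⟨T, hT⟩ := exists_limit X (-1) fun j => by rw [hX, add_sub_cancel_left]; exact he j
  refine ⟨T, ?_, ?_⟩
  swap
  · have h0 := hT 0
    rwa [Nat.cast_zero, sub_zero] at h0
  rw [← sub_eq_zero]
  refine eq_zero_of_forall_mem (-1) fun k hk => ?_
  have h1 := hT (-1 - k).toNat
  have h2 := he (-1 - k).toNat
  rw [show (-1 : ℤ) - ((-1 - k).toNat : ℤ) = k by omega] at h1 h2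
  have h3 : (1 : SPDO A) + Y ∈ ordLE A 0 :=
    add_mem (C_one (A := A) ▸ C_mem 1) (ordLE_mono (by omega) hY)
  have := sub_mem (mul_mem_of_le h3 h1 (k := k) (by omega)) h2
  rwa [mul_sub, sub_sub_sub_cancel_right, sub_eq_add_neg, ← sub_eq_add_neg] at this

/-- The right inverse `T` again has the form `1 + ⋯`, so it has a right inverse of its own;
associativity identifies that one with `1 + Y`. -/
lemma exists_inv_one_add {Y : SPDO A} (hY : Y ∈ ordLE A (-1)) :
    ∃ T : SPDO A, (1 + Y) * T = 1 ∧ T * (1 + Y) = 1 ∧ T - 1 ∈ ordLE A (-1) := by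
  obtain ⟨T, h1, hT⟩ := exists_rightInv_one_add hY
  obtain ⟨T', h2, -⟩ := exists_rightInv_one_add hT
  rw [add_sub_cancel] at h2
  refine ⟨T, h1, ?_, hT⟩
  have : 1 + Y = T' := by
    calc 1 + Y = (1 + Y) * (T * T') := by rw [h2, mul_one]
      _ = T' := by rw [← mul_assoc, h1, one_mul]
  rw [this, h2]

/-- Operators `∂_y + ⋯` are invertible. -/
lemma exists_inv_dy {X : SPDO A} (hX : X - dyPow 1 ∈ ordLE A 1) :
    ∃ T : SPDO A, X * T = 1 ∧ T * X = 1 ∧ T - dyPow (-1) ∈ ordLE A (-3) := by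
  have hY : (X - dyPow 1) * dyPow (-1) ∈ ordLE A (-1) :=
    mul_mem_of_le hX (dyPow_mem (-1)) (by norm_num)
  obtain ⟨T, h1, h2, hT⟩ := exists_inv_one_add hY
  have e1 : (dyPow 1 * dyPow (-1) : SPDO A) = 1 := dyUnit.mul_inv
  have e2 : (dyPow (-1) * dyPow 1 : SPDO A) = 1 := dyUnit.inv_mul
  have hXe : X = (1 + (X - dyPow 1) * dyPow (-1)) * dyPow 1 := by
    rw [add_mul, mul_assoc, e2]
    noncomm_ring
  refine ⟨dyPow (-1) * T, ?_, ?_, ?_⟩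
  · rw [hXe, mul_assoc, ← mul_assoc (dyPow 1), e1, one_mul, h1]
  · rw [hXe, mul_assoc, ← mul_assoc T, h2, one_mul, e2]
  · have := mul_mem_of_le (dyPow_mem (A := A) (-1)) hT (k := -3) (by norm_num)
    rwa [mul_sub, mul_one] at this

end Complete

/-! ### Existence and uniqueness of square roots. -/

section Sqrt

lemma mem_of_mul_dyPow_mem {k : ℤ} {X : SPDO A} (h : X * dyPow 1 ∈ ordLE A (k + 2)) :
    X ∈ ordLE A k := by
  have := mul_mem_of_le h (dyPow_mem (A := A) (-1)) (k := k) (by omega)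
  rwa [mul_assoc, dyPow_mul_dyPow, show (1 : ℤ) + -1 = 0 by norm_num, dyPow_zero, mul_one] at this

/-- Operators of low order are detected by anticommutators with `∂_y + ⋯`. -/
lemma mem_of_anticomm_mem {R S X : SPDO A} (hR : R - dyPow 1 ∈ ordLE A 1)
    (hS : S - dyPow 1 ∈ ordLE A 1) (k : ℤ) (h : X * R + S * X ∈ ordLE A (k + 2)) :
    X ∈ ordLE A k := by
  have step : ∀ j, k ≤ j → X ∈ ordLE A (j + 1) → X ∈ ordLE A j := by
    intro j hj hX
    -- Replacing `R` and `S` by `∂_y` loses at least half an order, and commuting `∂_y` with `X` a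
    -- full one, so the bound on `X R + S X` improves the bound on `X` by 1/2.
    have e : (2 : ℂ) • (X * dyPow 1) = (X * R + S * X) - (dyPow 1 * X - X * dyPow 1)
        - X * (R - dyPow 1) - (S - dyPow 1) * X := by
      rw [two_smul]
      noncomm_ring
    apply mem_of_mul_dyPow_mem
    rw [← smul_mem_ordLE_iff (two_ne_zero : (2 : ℂ) ≠ 0), e]
    refine sub_mem (sub_mem (sub_mem (ordLE_mono (by omega) h) ?_) ?_) ?_
    · exact ordLE_mono (by omega) (dyPow_one_commutator_mem hX)
    · exact mul_mem_of_le hX hR (by omega)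
    · exact mul_mem_of_le hS hX (by omega)
  obtain ⟨j, hj⟩ := exists_mem_ordLE X
  have all : ∀ i : ℕ, X ∈ ordLE A (max j k - i) ∨ X ∈ ordLE A k := by
    intro i
    induction i with
    | zero => exact Or.inl (ordLE_mono (by simp) hj)
    | succ i ih =>
      rcases ih with ih | ih
      · by_cases hk : k ≤ max j k - i - 1
        · left
          refine ordLE_mono (by push_cast; omega) (step _ hk ?_)
          rwa [sub_add_cancel]
        · exact Or.inr (ordLE_mono (by omega) ih)
      · exact Or.inr ih
  rcases all (max j k - k).toNat with h | h
  · exact ordLE_mono (by have := le_max_right j k; omega) h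
  · exact h

lemma eq_zero_of_anticomm {R S X : SPDO A} (hR : R - dyPow 1 ∈ ordLE A 1)
    (hS : S - dyPow 1 ∈ ordLE A 1) (h : X * R + S * X = 0) : X = 0 :=
  eq_zero_of_forall_mem 0 fun k _ => mem_of_anticomm_mem hR hS k (h ▸ zero_mem _)

/-- Square roots `∂_y + ⋯` exist. -/
lemma exists_sqrt {L : SPDO A} (hL : L - dyPow 2 ∈ ordLE A 3) :
    ∃ R : SPDO A, R * R = L ∧ R - dyPow 1 ∈ ordLE A 1 := by
  -- Newton iteration. As `X` begins with `∂_y`, adding `(L - X²) ∂_y⁻¹ / 2` cancels the defect up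
  -- to terms at least half an order lower.
  let X : ℕ → SPDO A := fun j =>
    Nat.rec (dyPow 1) (fun _ X => X + (1 / 2 : ℂ) • ((L - X * X) * dyPow (-1))) j
  have hX : ∀ j, X (j + 1) = X j + (1 / 2 : ℂ) • ((L - X j * X j) * dyPow (-1)) := fun j => rfl
  have e2 : (dyPow (-1) * dyPow 1 : SPDO A) = 1 := dyUnit.inv_mul
  have key : ∀ j : ℕ, L - X j * X j ∈ ordLE A (3 - j) ∧ X j - dyPow 1 ∈ ordLE A 1 := by
    intro j
    induction j with
    | zero =>
      constructor
      · have : X 0 * X 0 = dyPow 2 := dyPow_mul_dyPow 1 1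
        rw [this]
        simpa using hL
      · change dyPow 1 - dyPow 1 ∈ _
        rw [sub_self]
        exact zero_mem _
    | succ j ih =>
      obtain ⟨h1, h2⟩ := ih
      have hY : (1 / 2 : ℂ) • ((L - X j * X j) * dyPow (-1)) ∈ ordLE A (1 - j) :=
        smul_mem_ordLE _ (mul_mem_of_le h1 (dyPow_mem (-1)) (by omega))
      have hYE : ((1 / 2 : ℂ) • ((L - X j * X j) * dyPow (-1))) * dyPow 1
          = (1 / 2 : ℂ) • (L - X j * X j) := by
        rw [smul_mul_assoc, mul_assoc, e2, mul_one]
      rw [hX]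
      generalize hYd : (1 / 2 : ℂ) • ((L - X j * X j) * dyPow (-1)) = Y at hY hYE ⊢
      constructor
      · have e : L - (X j + Y) * (X j + Y) = ((L - X j * X j) - (2 : ℂ) • (Y * dyPow 1))
            - (dyPow 1 * Y - Y * dyPow 1) - Y * (X j - dyPow 1) - (X j - dyPow 1) * Y - Y * Y := by
          rw [two_smul]
          noncomm_ring
        rw [e, hYE, smul_smul, show (2 : ℂ) * (1 / 2) = 1 by norm_num, one_smul, sub_self, zero_sub]
        push_cast
        refine sub_mem (sub_mem (sub_mem ?_ ?_) ?_) ?_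
        · have h0 := dyPow_one_commutator_mem hY
          rw [hYE] at h0
          exact neg_mem (ordLE_mono (show (1 : ℤ) - j ≤ 3 - (j + 1) by omega) h0)
        · exact mul_mem_of_le hY h2 (by omega)
        · exact mul_mem_of_le h2 hY (by omega)
        · exact mul_mem_of_le hY hY (by omega)
      · rw [add_sub_right_comm]
        exact add_mem h2 (ordLE_mono (by omega) hY)
  obtain ⟨R, hR⟩ := exists_limit X 1 fun j => by
    rw [hX, add_sub_cancel_left]
    exact smul_mem_ordLE _ (mul_mem_of_le (key j).1 (dyPow_mem (-1)) (by omega))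
  have hR1 : R - dyPow 1 ∈ ordLE A 1 := by
    have h0 := hR 0
    rwa [Nat.cast_zero, sub_zero] at h0
  refine ⟨R, ?_, hR1⟩
  rw [← sub_eq_zero]
  refine eq_zero_of_forall_mem 3 fun k hk => ?_
  have h1 := hR (3 - k).toNat
  have h2 := (key (3 - k).toNat).1
  have h3 := (key (3 - k).toNat).2
  have hd : (dyPow 1 : SPDO A) ∈ ordLE A 2 := dyPow_mem 1
  have h4 : R ∈ ordLE A 2 := by simpa using add_mem (ordLE_mono (by omega) hR1) hd
  have h5 : X (3 - k).toNat ∈ ordLE A 2 := by simpa using add_mem (ordLE_mono (by omega) h3) hd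
  have e : R * R - L = (R - X (3 - k).toNat) * R + X (3 - k).toNat * (R - X (3 - k).toNat)
      - (L - X (3 - k).toNat * X (3 - k).toNat) := by
    noncomm_ring
  rw [e]
  exact sub_mem (add_mem (mul_mem_of_le h1 h4 (by omega)) (mul_mem_of_le h5 h1 (by omega)))
    (ordLE_mono (by omega) h2)

/-- Injectivity of `X ↦ X R + S X`, applied to `(R - S) R + S (R - S) = R² - S²`. -/
lemma sqrt_unique {R S : SPDO A} (hR : R - dyPow 1 ∈ ordLE A 1) (hS : S - dyPow 1 ∈ ordLE A 1)
    (h : R * R = S * S) : R = S := by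
  rw [← sub_eq_zero]
  refine eq_zero_of_anticomm hR hS ?_
  rw [sub_mul, mul_sub, h]
  abel

lemma isSqrt_iff {R P : SPDO A} : IsSqrt R P ↔ R * R = P ∧ R - dyPow 1 ∈ ordLE A 1 := by
  refine and_congr_right fun _ => ⟨fun ⟨h1, h2⟩ n s hn => ?_, fun h => ⟨?_, fun n s hn hne => ?_⟩⟩
  · rw [sub_coeff, dyPow, mono_coeff]
    split_ifs with hc
    · rw [hc.1, hc.2, h1, sub_self]
    · rw [sub_zero]
      exact h2 n s hn hc
  · have := h 1 0 (by simp)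
    rwa [sub_coeff, sub_eq_zero, dyPow, mono_coeff, if_pos ⟨rfl, rfl⟩] at this
  · have := h n s hn
    rwa [sub_coeff, dyPow, mono_coeff, if_neg hne, sub_zero] at this

end Sqrt

end

end SPDO

/-! ### Even and odd superfields. -/

namespace N2Algebra

variable {A : Type*} [Ring A] [Algebra ℂ A] [N2Algebra A]

lemma exists_even_add_odd (a : A) : ∃ e o : A, IsEven e ∧ IsOdd o ∧ a = e + o := by
  refine ⟨(1 / 2 : ℂ) • (a + parity a), (1 / 2 : ℂ) • (a - parity a), ?_, ?_, ?_⟩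
  · simp [IsEven, parity_parity, add_comm]
  · simp only [IsOdd, map_smul, map_sub, parity_parity, ← smul_neg, neg_sub]
  · rw [← smul_add, add_add_sub_cancel, ← two_smul ℂ a, smul_smul]
    norm_num

lemma IsOdd.mul_self {a : A} (ha : IsOdd a) : a * a = 0 := by
  have h := odd_anticomm a a ha ha
  rw [eq_neg_iff_add_eq_zero, ← two_smul ℂ, smul_eq_zero] at h
  exact h.resolve_left two_ne_zero

lemma IsEven.D₁ {a : A} (ha : IsEven a) : IsOdd (D₁ a) := by
  rw [IsOdd, parity_D₁, ha]

lemma IsEven.D₂ {a : A} (ha : IsEven a) : IsOdd (D₂ a) := by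
  rw [IsOdd, parity_D₂, ha]

lemma IsOdd.D₁ {a : A} (ha : IsOdd a) : IsEven (D₁ a) := by
  rw [IsEven, parity_D₁, ha, map_neg, neg_neg]

lemma IsOdd.D₂ {a : A} (ha : IsOdd a) : IsEven (D₂ a) := by
  rw [IsEven, parity_D₂, ha, map_neg, neg_neg]

lemma IsEven.dy {a : A} (ha : IsEven a) : IsEven (dy a) := ha.D₁.D₁

lemma IsOdd.dy {a : A} (ha : IsOdd a) : IsOdd (dy a) := ha.D₁.D₁

lemma IsEven.add {a b : A} (ha : IsEven a) (hb : IsEven b) : IsEven (a + b) := by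
  rw [IsEven, map_add, ha, hb]

lemma IsEven.neg {a : A} (ha : IsEven a) : IsEven (-a) := by
  rw [IsEven, map_neg, ha]

lemma IsEven.sub {a b : A} (ha : IsEven a) (hb : IsEven b) : IsEven (a - b) := by
  rw [IsEven, map_sub, ha, hb]

lemma IsEven.mul {a b : A} (ha : IsEven a) (hb : IsEven b) : IsEven (a * b) := by
  rw [IsEven, map_mul, ha, hb]

lemma IsEven.smul {a : A} (ha : IsEven a) (c : ℂ) : IsEven (c • a) := by
  rw [IsEven, map_smul, ha]

lemma IsOdd.mul {a b : A} (ha : IsOdd a) (hb : IsOdd b) : IsEven (a * b) := by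
  rw [IsEven, map_mul, ha, hb, neg_mul_neg]

end N2Algebra

namespace SPDO

noncomputable section

variable {A : Type*} [Ring A] [Algebra ℂ A] [N2Algebra A]

/-! ### Homomorphisms, parity and time derivatives acting on operators. -/

section Maps

variable {B : Type*} [Ring B] [Algebra ℂ B] [N2Algebra B]

/-- Application of a homomorphism to the coefficients. -/
def mapCoeff (φ : A →ₐ[ℂ] B) : SPDO A →+ SPDO B := AddMonoidHom.mk'
  (fun P => ⟨fun n s => φ (P.coeff n s), by
    obtain ⟨N, hN⟩ := P.bdd
    exact ⟨N, fun n hn s => by rw [hN n hn, map_zero]⟩⟩)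
  fun P Q => ext_coeff fun n s => map_add φ _ _

@[simp] lemma mapCoeff_coeff (φ : A →ₐ[ℂ] B) (P : SPDO A) (n : ℤ) (s : Fin 4) :
    (mapCoeff φ P).coeff n s = φ (P.coeff n s) := rfl

lemma mapCoeff_mem (φ : A →ₐ[ℂ] B) {k : ℤ} {P : SPDO A} (hP : P ∈ ordLE A k) :
    mapCoeff φ P ∈ ordLE B k := fun n s h => by rw [mapCoeff_coeff, hP n s h, map_zero]

lemma mapCoeff_mono (φ : A →ₐ[ℂ] B) (n : ℤ) (s : Fin 4) (a : A) :
    mapCoeff φ (mono n s a) = mono n s (φ a) :=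
  ext_coeff fun m t => by simp only [mapCoeff_coeff, mono_coeff]; split_ifs <;> simp

lemma mapCoeff_C_mul (φ : A →ₐ[ℂ] B) (a : A) (Q : SPDO A) :
    mapCoeff φ (C a * Q) = C (φ a) * mapCoeff φ Q :=
  ext_coeff fun m t => by simp

lemma mapCoeff_D₁Mul {φ : A →ₐ[ℂ] B} (hφ : IsSuperHom φ) (Q : SPDO A) :
    mapCoeff φ (D₁Mul Q) = D₁Mul (mapCoeff φ Q) := by
  refine ext_coeff fun n => forall_fin_four ?_ ?_ ?_ ?_ <;> simp [hφ.map_D₁, hφ.map_parity]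

lemma mapCoeff_D₂Mul {φ : A →ₐ[ℂ] B} (hφ : IsSuperHom φ) (Q : SPDO A) :
    mapCoeff φ (D₂Mul Q) = D₂Mul (mapCoeff φ Q) := by
  refine ext_coeff fun n => forall_fin_four ?_ ?_ ?_ ?_ <;> simp [hφ.map_D₂, hφ.map_parity]

lemma mapCoeff_DMul {φ : A →ₐ[ℂ] B} (hφ : IsSuperHom φ) (s : Fin 4) (Q : SPDO A) :
    mapCoeff φ (DMul s Q) = DMul s (mapCoeff φ Q) := by
  revert s
  refine forall_fin_four ?_ ?_ ?_ ?_ <;> simp [DMul, mapCoeff_D₁Mul hφ, mapCoeff_D₂Mul hφ]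

lemma mapCoeff_mul {φ : A →ₐ[ℂ] B} (hφ : IsSuperHom φ) (P Q : SPDO A) :
    mapCoeff φ (P * Q) = mapCoeff φ P * mapCoeff φ Q := by
  refine DFunLike.congr_fun (IsBounded.ext (f := (mapCoeff φ).comp (mulRightHom Q))
    (g := (mulRightHom (mapCoeff φ Q)).comp (mapCoeff φ))
    (IsBounded.comp ⟨0, fun k P hP => by simpa using mapCoeff_mem φ hP⟩ (mulRightHom_bounded Q))
    ((mulRightHom_bounded _).comp ⟨0, fun k P hP => by simpa using mapCoeff_mem φ hP⟩)
    fun n s a => ?_) P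
  change mapCoeff φ (mono n s a * Q) = mapCoeff φ (mono n s a) * mapCoeff φ Q
  rw [mapCoeff_mono, mono_mul, mono_mul, mapCoeff_C_mul, mapCoeff_DMul hφ,
    map_dyMul (mapCoeff φ) fun Q => by rw [mapCoeff_D₁Mul hφ, mapCoeff_D₁Mul hφ]]

/-- The parity automorphism of the algebra of operators. -/
def parityOp (P : SPDO A) : SPDO A :=
  ⟨fun n s => ![parity (P.coeff n s), -parity (P.coeff n s), -parity (P.coeff n s),
      parity (P.coeff n s)] s, by
    obtain ⟨N, hN⟩ := P.bdd
    refine ⟨N, fun n hn => forall_fin_four ?_ ?_ ?_ ?_⟩ <;> simp [hN n hn]⟩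

lemma parityOp_add (P Q : SPDO A) : parityOp (P + Q) = parityOp P + parityOp Q :=
  ext_coeff fun n => forall_fin_four (map_add _ _ _)
    ((congrArg _ (map_add _ _ _)).trans (neg_add _ _))
    ((congrArg _ (map_add _ _ _)).trans (neg_add _ _)) (map_add _ _ _)

/-- The parity automorphism, as an additive map. -/
def parityHom : SPDO A →+ SPDO A := AddMonoidHom.mk' parityOp parityOp_add

@[simp] lemma parityHom_coeff_zero (P : SPDO A) (n : ℤ) :
    (parityHom P).coeff n 0 = parity (P.coeff n 0) := rfl
@[simp] lemma parityHom_coeff_one (P : SPDO A) (n : ℤ) :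
    (parityHom P).coeff n 1 = -parity (P.coeff n 1) := rfl
@[simp] lemma parityHom_coeff_two (P : SPDO A) (n : ℤ) :
    (parityHom P).coeff n 2 = -parity (P.coeff n 2) := rfl
@[simp] lemma parityHom_coeff_three (P : SPDO A) (n : ℤ) :
    (parityHom P).coeff n 3 = parity (P.coeff n 3) := rfl

lemma parityHom_mem {k : ℤ} {P : SPDO A} (hP : P ∈ ordLE A k) : parityHom P ∈ ordLE A k := by
  intro n s
  revert s
  refine forall_fin_four ?_ ?_ ?_ ?_ <;> intro h <;> simp [hP _ _ h]

lemma parityHom_C_mul (a : A) (Q : SPDO A) :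
    parityHom (C a * Q) = C (parity a) * parityHom Q :=
  ext_coeff fun m => forall_fin_four (by simp) (by simp) (by simp) (by simp)

lemma parityHom_D₁Mul (Q : SPDO A) : parityHom (D₁Mul Q) = -D₁Mul (parityHom Q) := by
  refine ext_coeff fun n => forall_fin_four ?_ ?_ ?_ ?_ <;> simp [parity_D₁, add_comm]

lemma parityHom_D₂Mul (Q : SPDO A) : parityHom (D₂Mul Q) = -D₂Mul (parityHom Q) := by
  refine ext_coeff fun n => forall_fin_four ?_ ?_ ?_ ?_ <;> simp [parity_D₂, add_comm]

lemma parityHom_one : parityHom (1 : SPDO A) = 1 := by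
  refine ext_coeff fun n => forall_fin_four ?_ ?_ ?_ ?_
  · simp only [one_def, mono_coeff, parityHom_coeff_zero]
    split_ifs <;> simp
  all_goals simp [one_def, mono_coeff]

lemma parityHom_mul (P Q : SPDO A) : parityHom (P * Q) = parityHom P * parityHom Q := by
  have hb : IsBounded (parityHom (A := A)) := ⟨0, fun k P hP => by simpa using parityHom_mem hP⟩
  refine DFunLike.congr_fun (IsBounded.ext (f := parityHom.comp (mulRightHom Q))
    (g := (mulRightHom (parityHom Q)).comp parityHom) (hb.comp (mulRightHom_bounded Q))
    ((mulRightHom_bounded _).comp hb) fun n s a => ?_) P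
  change parityHom (mono n s a * Q) = parityHom (mono n s a) * parityHom Q
  have hD : ∀ (s : Fin 4) (X : SPDO A), parityHom (DMul s X)
      = parityHom (DMul s (1 : SPDO A)) * parityHom X := by
    refine forall_fin_four ?_ ?_ ?_ ?_ <;> intro X <;>
      simp only [DMul, Matrix.cons_val, Matrix.cons_val_zero, Matrix.cons_val_one, parityHom_D₁Mul,
        parityHom_D₂Mul, parityHom_one, D₁Mul_neg, neg_neg, neg_mul, D₁Mul_mul, D₂Mul_mul, one_mul]
  have hd : ∀ X : SPDO A, parityHom (dyMul n X) = dyMul n (parityHom X) :=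
    map_dyMul parityHom (fun Q => by rw [parityHom_D₁Mul, parityHom_D₁Mul, D₁Mul_neg, neg_neg]) n
  have h1 : mono n s a = C a * DMul s (dyMul n 1) := by rw [← mono_mul, mul_one]
  rw [mono_mul, h1, parityHom_C_mul, parityHom_C_mul, hD, hD s (dyMul n 1), hd, hd, parityHom_one,
    mul_assoc, mul_assoc, dyMul_mul, one_mul]

lemma timeDeriv_coeff (δ : TimeDerivation A) (P : SPDO A) (n : ℤ) (s : Fin 4) :
    (timeDeriv δ P).coeff n s = δ.toFun (P.coeff n s) := rfl

/-- The time derivative of operators, as an additive map. -/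
def timeHom (δ : TimeDerivation A) : SPDO A →+ SPDO A := AddMonoidHom.mk' (timeDeriv δ)
  fun P Q => ext_coeff fun n s => map_add δ.toFun _ _

lemma timeDeriv_mem (δ : TimeDerivation A) {k : ℤ} {P : SPDO A} (hP : P ∈ ordLE A k) :
    timeDeriv δ P ∈ ordLE A k := fun n s h => by rw [timeDeriv_coeff, hP n s h, map_zero]

lemma timeDeriv_C_mul (δ : TimeDerivation A) (a : A) (Q : SPDO A) :
    timeDeriv δ (C a * Q) = C (δ.toFun a) * Q + C a * timeDeriv δ Q :=
  ext_coeff fun m t => by simp [timeDeriv_coeff, δ.map_mul]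

lemma timeDeriv_D₁Mul (δ : TimeDerivation A) (Q : SPDO A) :
    timeDeriv δ (D₁Mul Q) = D₁Mul (timeDeriv δ Q) := by
  refine ext_coeff fun n => forall_fin_four ?_ ?_ ?_ ?_ <;>
    simp [timeDeriv_coeff, δ.map_D₁, δ.map_parity]

lemma timeDeriv_D₂Mul (δ : TimeDerivation A) (Q : SPDO A) :
    timeDeriv δ (D₂Mul Q) = D₂Mul (timeDeriv δ Q) := by
  refine ext_coeff fun n => forall_fin_four ?_ ?_ ?_ ?_ <;>
    simp [timeDeriv_coeff, δ.map_D₂, δ.map_parity]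

lemma timeDeriv_DMul (δ : TimeDerivation A) (s : Fin 4) (Q : SPDO A) :
    timeDeriv δ (DMul s Q) = DMul s (timeDeriv δ Q) := by
  revert s
  refine forall_fin_four ?_ ?_ ?_ ?_ <;> simp [DMul, timeDeriv_D₁Mul, timeDeriv_D₂Mul]

lemma timeDeriv_mono (δ : TimeDerivation A) (n : ℤ) (s : Fin 4) (a : A) :
    timeDeriv δ (mono n s a) = mono n s (δ.toFun a) :=
  ext_coeff fun m t => by simp only [timeDeriv_coeff, mono_coeff]; split_ifs <;> simp

lemma timeDeriv_mul (δ : TimeDerivation A) (P Q : SPDO A) :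
    timeDeriv δ (P * Q) = timeDeriv δ P * Q + P * timeDeriv δ Q := by
  have hb : IsBounded (timeHom δ) := ⟨0, fun k P hP => by rw [add_zero]; exact timeDeriv_mem δ hP⟩
  refine DFunLike.congr_fun (IsBounded.ext (f := (timeHom δ).comp (mulRightHom Q))
    (g := (mulRightHom Q).comp (timeHom δ) + mulRightHom (timeDeriv δ Q))
    (hb.comp (mulRightHom_bounded Q)) ?_ fun n s a => ?_) P
  · obtain ⟨c, hc⟩ := (mulRightHom_bounded Q).comp hb
    obtain ⟨d, hd⟩ := mulRightHom_bounded (timeDeriv δ Q)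
    exact ⟨max c d, fun k P hP => add_mem
      (ordLE_mono (add_le_add_right (le_max_left _ _) _) (hc k P hP))
      (ordLE_mono (add_le_add_right (le_max_right _ _) _) (hd k P hP))⟩
  · change timeDeriv δ (mono n s a * Q)
      = timeDeriv δ (mono n s a) * Q + mono n s a * timeDeriv δ Q
    rw [timeDeriv_mono, mono_mul, mono_mul, mono_mul, timeDeriv_C_mul, timeDeriv_DMul,
      map_dyMul (timeDeriv δ) fun Q => by rw [timeDeriv_D₁Mul, timeDeriv_D₁Mul]]

lemma timeDeriv_add (δ : TimeDerivation A) (P Q : SPDO A) :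
    timeDeriv δ (P + Q) = timeDeriv δ P + timeDeriv δ Q := map_add (timeHom δ) P Q

lemma timeDeriv_sub (δ : TimeDerivation A) (P Q : SPDO A) :
    timeDeriv δ (P - Q) = timeDeriv δ P - timeDeriv δ Q := map_sub (timeHom δ) P Q

lemma timeDeriv_neg (δ : TimeDerivation A) (P : SPDO A) :
    timeDeriv δ (-P) = -timeDeriv δ P := map_neg (timeHom δ) P

end Maps

/-! ### Maps of operators defined by their values on monomials. -/

section Extend

variable {B : Type*} [Ring B] [Algebra ℂ B] [N2Algebra B]

/-- The additive map with prescribed values on monomials, by summation of the series. -/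
def extend (G : ℤ → Fin 4 → A →+ SPDO B) (hG : ∀ n s a, G n s a ∈ ordLE B (2 * n + wt s)) :
    SPDO A →+ SPDO B := by
  have key : ∀ (P : SPDO A) (k : ℤ), P ∈ ordLE A k → ∀ (m : ℤ) (t : Fin 4),
      ∑ᶠ n : ℤ, ∑ s : Fin 4, (G n s (P.coeff n s)).coeff m t
        = ∑ n ∈ Finset.Icc (m - 1) (k / 2), ∑ s : Fin 4, (G n s (P.coeff n s)).coeff m t := by
    intro P k hP m t
    refine finsum_eq_sum_of_support_subset _ fun n hn => ?_
    by_contra hlt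
    refine hn (Finset.sum_eq_zero fun s _ => ?_)
    have hs := wt_le s
    have hs' := wt_nonneg s
    have ht := wt_nonneg t
    rw [Finset.mem_coe, Finset.mem_Icc, not_and_or] at hlt
    rcases hlt with h | h
    · exact hG n s _ m t (by omega)
    · rw [hP n s (by omega), map_zero, zero_coeff]
  refine AddMonoidHom.mk' (fun P =>
    ⟨fun m t => ∑ᶠ n : ℤ, ∑ s : Fin 4, (G n s (P.coeff n s)).coeff m t, ?_⟩) ?_
  · obtain ⟨k, hP⟩ := exists_mem_ordLE P
    refine ⟨k / 2 + 1, fun m hm t => ?_⟩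
    rw [key P k hP, Finset.Icc_eq_empty (by omega), Finset.sum_empty]
  · intro P Q
    refine ext_coeff fun m t => ?_
    obtain ⟨k, hP, hQ⟩ := exists_mem_ordLE₂ P Q
    change ∑ᶠ n : ℤ, _ = ∑ᶠ n : ℤ, _ + ∑ᶠ n : ℤ, _
    rw [key P k hP, key Q k hQ, key (P + Q) k (add_mem hP hQ), ← Finset.sum_add_distrib]
    refine Finset.sum_congr rfl fun n _ => ?_
    rw [← Finset.sum_add_distrib]
    refine Finset.sum_congr rfl fun s _ => ?_
    rw [add_coeff, map_add, add_coeff]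

variable (G : ℤ → Fin 4 → A →+ SPDO B) (hG : ∀ n s a, G n s a ∈ ordLE B (2 * n + wt s))

lemma extend_coeff (P : SPDO A) (m : ℤ) (t : Fin 4) : (extend G hG P).coeff m t
    = ∑ᶠ n : ℤ, ∑ s : Fin 4, (G n s (P.coeff n s)).coeff m t := rfl

lemma extend_mono (n : ℤ) (s : Fin 4) (a : A) : extend G hG (mono n s a) = G n s a := by
  refine ext_coeff fun m t => ?_
  rw [extend_coeff, finsum_eq_single _ n, Finset.sum_eq_single s]
  · simp [mono_coeff]
  · intro t _ ht
    rw [mono_coeff, if_neg (by rintro ⟨-, rfl⟩; exact ht rfl), map_zero, zero_coeff]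
  · simp
  · intro k hk
    refine Finset.sum_eq_zero fun t _ => ?_
    rw [mono_coeff, if_neg (by rintro ⟨rfl, -⟩; exact hk rfl), map_zero, zero_coeff]

lemma extend_mem {k : ℤ} {P : SPDO A} (hP : P ∈ ordLE A k) : extend G hG P ∈ ordLE B k := by
  intro m t h
  rw [extend_coeff]
  refine (finsum_congr fun n => Finset.sum_eq_zero fun s _ => ?_).trans finsum_zero
  by_cases h1 : 2 * n + wt s ≤ k
  · exact hG n s _ m t (by omega)
  · rw [hP n s (by omega), map_zero, zero_coeff]

/-- A bounded additive map is an antihomomorphism if it is one on generators. -/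
lemma antiHom_of_generators {f : SPDO A →+ SPDO B} (hf : IsBounded f) (h1 : f 1 = 1)
    (hC : ∀ a Q, f (C a * Q) = f Q * f (C a)) (hD₁ : ∀ Q, f (opD₁ * Q) = f Q * f opD₁)
    (hD₂ : ∀ Q, f (opD₂ * Q) = f Q * f opD₂) (hu : IsUnit (f (dyPow 1))) (P Q : SPDO A) :
    f (P * Q) = f Q * f P := by
  have hmul : ∀ X Y : SPDO A, (∀ Q, f (X * Q) = f Q * f X) → (∀ Q, f (Y * Q) = f Q * f Y) →
      ∀ Q, f (X * Y * Q) = f Q * f (X * Y) := fun X Y hX hY Q => by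
    rw [mul_assoc, hX, hY, hX, mul_assoc]
  have hd : ∀ Q, f (dyPow 1 * Q) = f Q * f (dyPow 1) := by
    rw [← opD₁_mul_opD₁]
    exact hmul _ _ hD₁ hD₁
  -- The rule for `∂_y⁻¹` follows from that for `∂_y` by cancelling the unit `f (∂_y)` on the right.
  have hd' : ∀ Q, f (dyPow (-1) * Q) = f Q * f (dyPow (-1)) := fun Q => by
    have e2 : (dyPow 1 * dyPow (-1) : SPDO A) = 1 := dyUnit.mul_inv
    refine hu.mul_left_injective ?_
    simp only
    rw [← hd, ← mul_assoc, e2, one_mul, mul_assoc, ← hd, e2, h1, mul_one]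
  have hdn : ∀ (n : ℤ) (Q : SPDO A), f (dyPow n * Q) = f Q * f (dyPow n) := by
    intro n
    induction n using Int.induction_on with
    | zero => simp [h1]
    | succ n ih => rw [← dyPow_mul_dyPow]; exact hmul _ _ ih hd
    | pred n ih => rw [sub_eq_add_neg, ← dyPow_mul_dyPow]; exact hmul _ _ ih hd'
  have hD : ∀ (s : Fin 4) (Q : SPDO A), f (opD s * Q) = f Q * f (opD s) := by
    refine forall_fin_four ?_ hD₁ hD₂ ?_
    · simp [opD_zero, h1]
    · rw [opD_three]
      exact hmul _ _ hD₁ hD₂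
  refine DFunLike.congr_fun (IsBounded.ext (f := f.comp (mulRightHom Q))
    (g := (AddMonoidHom.mulLeft (f Q)).comp f) (hf.comp (mulRightHom_bounded Q))
    ((mulLeft_bounded _).comp hf) fun n s a => ?_) P
  change f (mono n s a * Q) = f Q * f (mono n s a)
  rw [mono_eq]
  exact hmul _ _ (hmul _ _ (hC a) (hD s)) (hdn n) Q

end Extend

/-! ### Superderivatives conjugated by an exponential. -/

section Gauge

/-- The superderivatives conjugated by `e ^ f`. -/
def gaugeD₁ (f : A) : SPDO A := opD₁ - C (D₁ f)

def gaugeD₂ (f : A) : SPDO A := opD₂ - C (D₂ f)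

def gaugeDy (f : A) : SPDO A := dyPow 1 - C (dy f)

/-- The added term `-(D₁ f)` is odd and supercommutes with `a`, so conjugation leaves the Leibniz
rule unchanged. -/
lemma gaugeD₁_mul_C (f : A) (hf : IsEven f) (a : A) :
    gaugeD₁ f * C a = C (D₁ a) + C (parity a) * gaugeD₁ f := by
  obtain ⟨e, o, he, ho, rfl⟩ := exists_even_add_odd a
  have h1 : D₁ f * e = e * D₁ f := (even_comm _ _ he).symm
  have h2 : D₁ f * o = -(o * D₁ f) := odd_anticomm _ _ hf.D₁ ho
  rw [gaugeD₁, sub_mul, mul_sub, opD₁_mul_C, ← C_mul, ← C_mul, map_add parity, show parity e = e from he,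
    show parity o = -o from ho, mul_add, h1, h2, add_mul, neg_mul]
  abel

lemma gaugeD₂_mul_C (f : A) (hf : IsEven f) (a : A) :
    gaugeD₂ f * C a = C (D₂ a) + C (parity a) * gaugeD₂ f := by
  obtain ⟨e, o, he, ho, rfl⟩ := exists_even_add_odd a
  have h1 : D₂ f * e = e * D₂ f := (even_comm _ _ he).symm
  have h2 : D₂ f * o = -(o * D₂ f) := odd_anticomm _ _ hf.D₂ ho
  rw [gaugeD₂, sub_mul, mul_sub, opD₂_mul_C, ← C_mul, ← C_mul, map_add parity, show parity e = e from he,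
    show parity o = -o from ho, mul_add, h1, h2, add_mul, neg_mul]
  abel

lemma gaugeD₁_sq {f : A} (hf : IsEven f) : gaugeD₁ f * gaugeD₁ f = gaugeDy f := by
  have h : opD₁ * C (D₁ f) = C (dy f) - C (D₁ f) * opD₁ := by
    rw [opD₁_mul_C, hf.D₁, C_neg, neg_mul, ← sub_eq_add_neg, dy]
  rw [gaugeD₁, gaugeDy, sub_mul, mul_sub, mul_sub, opD₁_mul_opD₁, h, ← C_mul, hf.D₁.mul_self, C_zero]
  abel

lemma gaugeD₂_sq {f : A} (hf : IsEven f) : gaugeD₂ f * gaugeD₂ f = gaugeDy f := by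
  have h : opD₂ * C (D₂ f) = C (dy f) - C (D₂ f) * opD₂ := by
    rw [opD₂_mul_C, hf.D₂, C_neg, neg_mul, ← sub_eq_add_neg, D₂_D₂]
  rw [gaugeD₂, gaugeDy, sub_mul, mul_sub, mul_sub, opD₂_mul_opD₂, h, ← C_mul, hf.D₂.mul_self, C_zero]
  abel

lemma gaugeD₂_mul_gaugeD₁ {f : A} (hf : IsEven f) :
    gaugeD₂ f * gaugeD₁ f = -(gaugeD₁ f * gaugeD₂ f) := by
  have h1 : opD₁ * C (D₂ f) = C (D₁ (D₂ f)) - C (D₂ f) * opD₁ := by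
    rw [opD₁_mul_C, hf.D₂, C_neg, neg_mul, ← sub_eq_add_neg]
  have h2 : opD₂ * C (D₁ f) = -C (D₁ (D₂ f)) - C (D₁ f) * opD₂ := by
    rw [opD₂_mul_C, hf.D₁, C_neg, neg_mul, ← sub_eq_add_neg, D₂_D₁, C_neg]
  rw [gaugeD₁, gaugeD₂, sub_mul, mul_sub, mul_sub, sub_mul, mul_sub, mul_sub, opD₂_mul_opD₁, h1, h2,
    ← C_mul, ← C_mul, odd_anticomm _ _ hf.D₂ hf.D₁, C_neg]
  abel

lemma gaugeDy_sub_mem (f : A) : gaugeDy f - dyPow 1 ∈ ordLE A 0 := by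
  rw [gaugeDy, sub_sub_cancel_left]
  exact neg_mem (C_mem _)

lemma exists_gaugeUnit (f : A) : ∃ u : (SPDO A)ˣ, (u : SPDO A) = gaugeDy f ∧
    (↑u⁻¹ : SPDO A) - dyPow (-1) ∈ ordLE A (-3) := by
  obtain ⟨T, h1, h2, h3⟩ := exists_inv_dy (ordLE_mono (by norm_num) (gaugeDy_sub_mem f))
  exact ⟨⟨gaugeDy f, T, h1, h2⟩, rfl, h3⟩

/-- `∂_y` conjugated by `e ^ f`, as a unit. -/
def gaugeUnit (f : A) : (SPDO A)ˣ := (exists_gaugeUnit f).choose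

lemma gaugeUnit_val (f : A) : (gaugeUnit f : SPDO A) = gaugeDy f := (exists_gaugeUnit f).choose_spec.1

lemma gaugeUnit_inv (f : A) : (↑(gaugeUnit f)⁻¹ : SPDO A) - dyPow (-1) ∈ ordLE A (-3) :=
  (exists_gaugeUnit f).choose_spec.2

lemma gaugeDy_mem (f : A) : gaugeDy f ∈ ordLE A 2 := by
  have h := add_mem (ordLE_mono (by norm_num) (gaugeDy_sub_mem f)) (dyPow_mem (A := A) 1)
  rwa [sub_add_cancel] at h

lemma gaugeUnit_inv_mem (f : A) : (↑(gaugeUnit f)⁻¹ : SPDO A) ∈ ordLE A (-2) := by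
  have h := add_mem (ordLE_mono (by norm_num) (gaugeUnit_inv f)) (dyPow_mem (A := A) (-1))
  rwa [sub_add_cancel] at h

lemma gaugeD₁_mem (f : A) : gaugeD₁ f ∈ ordLE A 1 :=
  sub_mem opD₁_mem (ordLE_mono (by norm_num) (C_mem _))

lemma gaugeD₂_mem (f : A) : gaugeD₂ f ∈ ordLE A 1 :=
  sub_mem opD₂_mem (ordLE_mono (by norm_num) (C_mem _))

end Gauge

end

end SPDO

namespace SPDO

noncomputable section

variable {A : Type*} [Ring A] [Algebra ℂ A] [N2Algebra A]

/-! ### The weighted adjoint. -/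

section Adjoint

lemma units_zpow_mem {u : (SPDO A)ˣ} (h : (u : SPDO A) ∈ ordLE A 2)
    (h' : (↑u⁻¹ : SPDO A) ∈ ordLE A (-2)) (n : ℤ) : (↑(u ^ n) : SPDO A) ∈ ordLE A (2 * n) := by
  induction n using Int.induction_on with
  | zero =>
    rw [zpow_zero, Units.val_one, ← C_one]
    exact C_mem 1
  | succ n ih =>
    rw [zpow_add_one, Units.val_mul]
    exact mul_mem_of_le ih h (by omega)
  | pred n ih =>
    rw [zpow_sub_one, Units.val_mul]
    exact mul_mem_of_le ih h' (by omega)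

/-- The anti-automorphism of `A` that fixes even elements and multiplies odd ones by `i`. -/
def revCoeff : A →ₗ[ℂ] A :=
  ((1 + Complex.I) / 2 : ℂ) • LinearMap.id + ((1 - Complex.I) / 2 : ℂ) • parity.toLinearMap

lemma revCoeff_even {a : A} (ha : IsEven a) : revCoeff a = a := by
  have h : parity a = a := ha
  simp only [revCoeff, LinearMap.add_apply, LinearMap.smul_apply, LinearMap.id_apply,
    AlgHom.toLinearMap_apply, h, ← add_smul]
  convert one_smul ℂ a
  ring

lemma revCoeff_odd {a : A} (ha : IsOdd a) : revCoeff a = Complex.I • a := by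
  have h : parity a = -a := ha
  simp only [revCoeff, LinearMap.add_apply, LinearMap.smul_apply, LinearMap.id_apply,
    AlgHom.toLinearMap_apply, h, smul_neg, ← sub_eq_add_neg, ← sub_smul]
  congr 1
  ring

/-- Interchanging two odd factors costs the sign `-1 = i²`, which the factor `i` on each of them
supplies. This is how the adjoint can reverse products without signs. -/
lemma revCoeff_mul (a b : A) : revCoeff (a * b) = revCoeff b * revCoeff a := by
  obtain ⟨e, o, he, ho, rfl⟩ := exists_even_add_odd a
  obtain ⟨e', o', he', ho', rfl⟩ := exists_even_add_odd b
  have h1 : IsOdd (e * o') := by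
    rw [IsOdd, map_mul, show parity e = e from he, show parity o' = -o' from ho', mul_neg]
  have h2 : IsOdd (o * e') := by
    rw [IsOdd, map_mul, show parity e' = e' from he', show parity o = -o from ho, neg_mul]
  simp only [add_mul, mul_add, map_add, revCoeff_even he, revCoeff_even he', revCoeff_odd ho,
    revCoeff_odd ho', revCoeff_even (he.mul he'), revCoeff_even (ho.mul ho'), revCoeff_odd h1,
    revCoeff_odd h2, mul_smul_comm, smul_mul_assoc, smul_add, smul_smul, Complex.I_mul_I,
    neg_one_smul]
  rw [even_comm e e' he, even_comm e o' he, ← even_comm e' o he', odd_anticomm o o' ho ho']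
  abel

variable (f : A)

/-- The images of `D₁`, `D₂` under the adjoint with weight `e ^ f`. -/
def adjD₁ : SPDO A := (-Complex.I) • gaugeD₁ f

def adjD₂ : SPDO A := (-Complex.I) • gaugeD₂ f

def adjD (s : Fin 4) : SPDO A := ![1, adjD₁ f, adjD₂ f, adjD₂ f * adjD₁ f] s

lemma adjD₁_mem : adjD₁ f ∈ ordLE A 1 := smul_mem_ordLE _ (gaugeD₁_mem f)

lemma adjD₂_mem : adjD₂ f ∈ ordLE A 1 := smul_mem_ordLE _ (gaugeD₂_mem f)

lemma adjD_mem (s : Fin 4) : adjD f s ∈ ordLE A (wt s) := by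
  revert s
  refine forall_fin_four ?_ (adjD₁_mem f) (adjD₂_mem f) ?_
  · change (1 : SPDO A) ∈ ordLE A 0
    rw [← C_one]
    exact C_mem 1
  · exact mul_mem_of_le (adjD₂_mem f) (adjD₁_mem f) (by simp)

lemma neg_gaugeUnit_zpow_mem (n : ℤ) : (↑((-gaugeUnit f) ^ n) : SPDO A) ∈ ordLE A (2 * n) := by
  refine units_zpow_mem ?_ ?_ n
  · rw [Units.val_neg, gaugeUnit_val]
    exact neg_mem (gaugeDy_mem f)
  · rw [inv_neg, Units.val_neg]
    exact neg_mem (gaugeUnit_inv_mem f)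

/-- The values of the adjoint on monomials. -/
def adjMono (n : ℤ) (s : Fin 4) : A →+ SPDO A :=
  AddMonoidHom.mk' (fun a => ↑((-gaugeUnit f) ^ n) * adjD f s * C (revCoeff a)) fun a b => by
    rw [map_add, C_add, mul_add]

/-- The formal adjoint with weight `e ^ f`, as an anti-automorphism without signs. -/
def adj : SPDO A →+ SPDO A := extend (adjMono f) fun n s a => by
  have := mul_mem (mul_mem (neg_gaugeUnit_zpow_mem f n) (adjD_mem f s)) (C_mem (revCoeff a))
  rwa [add_zero] at this

lemma adj_mono (n : ℤ) (s : Fin 4) (a : A) :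
    adj f (mono n s a) = ↑((-gaugeUnit f) ^ n) * adjD f s * C (revCoeff a) := extend_mono _ _ n s a

lemma adj_mem {k : ℤ} {P : SPDO A} (hP : P ∈ ordLE A k) : adj f P ∈ ordLE A k := extend_mem _ _ hP

lemma adj_bounded : IsBounded (adj f) := ⟨0, fun k P hP => by rw [add_zero]; exact adj_mem f hP⟩

lemma adj_C (a : A) : adj f (C a) = C (revCoeff a) := by
  rw [C, adj_mono, zpow_zero, Units.val_one, one_mul]
  exact one_mul _

lemma C_mul_mono (a : A) (n : ℤ) (s : Fin 4) (b : A) : C a * mono n s b = mono n s (a * b) := by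
  rw [mono_eq, mono_eq, C_mul]
  noncomm_ring

lemma adj_mul_of_mono {X Y : SPDO A}
    (h : ∀ n s b, adj f (X * mono n s b) = adj f (mono n s b) * Y) (Q : SPDO A) :
    adj f (X * Q) = adj f Q * Y :=
  DFunLike.congr_fun (IsBounded.ext (f := (adj f).comp (AddMonoidHom.mulLeft X))
    (g := (mulRightHom Y).comp (adj f)) ((adj_bounded f).comp (mulLeft_bounded _))
    ((mulRightHom_bounded _).comp (adj_bounded f)) h) Q

lemma adj_C_mul (a : A) (Q : SPDO A) : adj f (C a * Q) = adj f Q * C (revCoeff a) := by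
  refine adj_mul_of_mono f (fun n s b => ?_) Q
  rw [C_mul_mono, adj_mono, adj_mono, revCoeff_mul, C_mul, ← mul_assoc]

variable {f}

lemma adjD₁_sq (hf : IsEven f) : adjD₁ f * adjD₁ f = -gaugeDy f := by
  rw [adjD₁, smul_mul_smul_comm, gaugeD₁_sq hf, neg_mul_neg, Complex.I_mul_I, neg_one_smul]

lemma adjD₂_sq (hf : IsEven f) : adjD₂ f * adjD₂ f = -gaugeDy f := by
  rw [adjD₂, smul_mul_smul_comm, gaugeD₂_sq hf, neg_mul_neg, Complex.I_mul_I, neg_one_smul]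

lemma adjD₂_mul_adjD₁ (hf : IsEven f) : adjD₂ f * adjD₁ f = -(adjD₁ f * adjD₂ f) := by
  rw [adjD₁, adjD₂, smul_mul_smul_comm, smul_mul_smul_comm, gaugeD₂_mul_gaugeD₁ hf, smul_neg]

/-- The mirror image of `D₁ a = (D₁ a) + (parity a) D₁`. The factor `-i` in `adjD₁` is matched to
the factor `i` that `revCoeff` puts on odd elements. -/
lemma C_mul_adjD₁ (hf : IsEven f) (a : A) :
    C (revCoeff a) * adjD₁ f = C (revCoeff (D₁ a)) + adjD₁ f * C (revCoeff (parity a)) := by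
  obtain ⟨e, o, he, ho, rfl⟩ := exists_even_add_odd a
  have he' : parity e = e := he
  have ho' : parity o = -o := ho
  simp only [map_add, map_neg, he', ho', revCoeff_even he, revCoeff_odd ho, revCoeff_even ho.D₁,
    revCoeff_odd he.D₁, C_add, C_neg, C_smul, adjD₁, mul_add, mul_neg, smul_mul_assoc,
    mul_smul_comm, gaugeD₁_mul_C f hf, neg_mul, smul_add, smul_smul, smul_neg, neg_smul, add_mul,
    Complex.I_mul_I, one_smul, neg_neg]
  abel

lemma C_mul_adjD₂ (hf : IsEven f) (a : A) :
    C (revCoeff a) * adjD₂ f = C (revCoeff (D₂ a)) + adjD₂ f * C (revCoeff (parity a)) := by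
  obtain ⟨e, o, he, ho, rfl⟩ := exists_even_add_odd a
  have he' : parity e = e := he
  have ho' : parity o = -o := ho
  simp only [map_add, map_neg, he', ho', revCoeff_even he, revCoeff_odd ho, revCoeff_even ho.D₂,
    revCoeff_odd he.D₂, C_add, C_neg, C_smul, adjD₂, mul_add, mul_neg, smul_mul_assoc,
    mul_smul_comm, gaugeD₂_mul_C f hf, neg_mul, smul_add, smul_smul, smul_neg, neg_smul, add_mul,
    Complex.I_mul_I, one_smul, neg_neg]
  abel

/-- On a monomial, `D₁` is moved to the right of the coefficient and `D₁ D^s` is brought to normal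
form; `key` is the image of this normal form. The extra `∂_y` created when `s` contains `D₁` has
image `-gaugeDy f`, the square of `adjD₁ f`. -/
lemma adj_opD₁_mul (hf : IsEven f) (Q : SPDO A) : adj f (opD₁ * Q) = adj f Q * adjD₁ f := by
  refine adj_mul_of_mono f (fun n s b => ?_) Q
  have hu : (↑((-gaugeUnit f) ^ (n + 1)) : SPDO A)
      = ↑((-gaugeUnit f) ^ n) * (adjD₁ f * adjD₁ f) := by
    rw [zpow_add_one, Units.val_mul, Units.val_neg, gaugeUnit_val, adjD₁_sq hf]
  have h3 : adjD₁ f * adjD₁ f * adjD₂ f = adjD₂ f * adjD₁ f * adjD₁ f := by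
    rw [adjD₂_mul_adjD₁ hf, neg_mul, mul_assoc, mul_assoc, adjD₂_mul_adjD₁ hf, mul_neg, neg_neg]
  have key : (↑((-gaugeUnit f) ^ ((![n, n + 1, n, n + 1] : Fin 4 → ℤ) s)) : SPDO A)
      * adjD f ((![1, 0, 3, 2] : Fin 4 → Fin 4) s) = ↑((-gaugeUnit f) ^ n) * adjD f s * adjD₁ f := by
    revert s
    refine forall_fin_four ?_ ?_ ?_ ?_
    · simp [adjD]
    · simp [adjD, hu, mul_assoc]
    · simp [adjD, mul_assoc]
    · change (↑((-gaugeUnit f) ^ (n + 1)) : SPDO A) * adjD₂ f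
        = ↑((-gaugeUnit f) ^ n) * (adjD₂ f * adjD₁ f) * adjD₁ f
      rw [hu, mul_assoc, h3, ← mul_assoc, ← mul_assoc]
  rw [opD₁_mul, D₁Mul_mono, map_add, adj_mono, adj_mono, adj_mono, key, mul_assoc _ (C _) (adjD₁ f),
    C_mul_adjD₁ hf, mul_add, ← mul_assoc _ (adjD₁ f)]

lemma adj_opD₂_mul (hf : IsEven f) (Q : SPDO A) : adj f (opD₂ * Q) = adj f Q * adjD₂ f := by
  refine adj_mul_of_mono f (fun n s b => ?_) Q
  have hu : (↑((-gaugeUnit f) ^ (n + 1)) : SPDO A)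
      = ↑((-gaugeUnit f) ^ n) * (adjD₂ f * adjD₂ f) := by
    rw [zpow_add_one, Units.val_mul, Units.val_neg, gaugeUnit_val, adjD₂_sq hf]
  have h1 : adjD₁ f * adjD₂ f = -(adjD₂ f * adjD₁ f) := by rw [adjD₂_mul_adjD₁ hf, neg_neg]
  have key : (↑((-gaugeUnit f) ^ ((![n, n, n + 1, n + 1] : Fin 4 → ℤ) s)) : SPDO A)
      * adjD f ((![2, 3, 0, 1] : Fin 4 → Fin 4) s)
      * C (revCoeff ((![parity b, -parity b, parity b, -parity b] : Fin 4 → A) s))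
      = ↑((-gaugeUnit f) ^ n) * adjD f s * adjD₂ f * C (revCoeff (parity b)) := by
    revert s
    refine forall_fin_four ?_ ?_ ?_ ?_
    · simp [adjD]
    · change (↑((-gaugeUnit f) ^ n) : SPDO A) * (adjD₂ f * adjD₁ f) * C (revCoeff (-parity b))
        = ↑((-gaugeUnit f) ^ n) * adjD₁ f * adjD₂ f * C (revCoeff (parity b))
      rw [map_neg, C_neg, mul_assoc _ (adjD₁ f), h1, mul_neg, mul_neg, neg_mul]
    · simp [adjD, hu, mul_assoc]
    · change (↑((-gaugeUnit f) ^ (n + 1)) : SPDO A) * adjD₁ f * C (revCoeff (-parity b))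
        = ↑((-gaugeUnit f) ^ n) * (adjD₂ f * adjD₁ f) * adjD₂ f * C (revCoeff (parity b))
      rw [hu, map_neg, C_neg, mul_assoc _ _ (adjD₂ f), mul_assoc (adjD₂ f) (adjD₁ f), h1, mul_neg,
        mul_neg, mul_neg, neg_mul, mul_assoc _ _ (adjD₁ f), mul_assoc (adjD₂ f) (adjD₂ f)]
  rw [opD₂_mul, D₂Mul_mono, map_add, adj_mono, adj_mono, adj_mono, key, mul_assoc _ (C _) (adjD₂ f),
    C_mul_adjD₂ hf, mul_add, ← mul_assoc _ (adjD₂ f)]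

lemma adj_opD₁ (hf : IsEven f) : adj f opD₁ = adjD₁ f := by
  have h := adj_opD₁_mul hf 1
  rwa [mul_one, ← C_one, adj_C, revCoeff_even (map_one parity), C_one, one_mul] at h

lemma adj_opD₂ (hf : IsEven f) : adj f opD₂ = adjD₂ f := by
  have h := adj_opD₂_mul hf 1
  rwa [mul_one, ← C_one, adj_C, revCoeff_even (map_one parity), C_one, one_mul] at h

lemma adj_one : adj f 1 = 1 := by
  rw [← C_one, adj_C, revCoeff_even (map_one parity)]

lemma adj_dyPow_one (hf : IsEven f) : adj f (dyPow 1) = -gaugeDy f := by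
  rw [← opD₁_mul_opD₁, adj_opD₁_mul hf, adj_opD₁ hf, adjD₁_sq hf]

/-- The adjoint reverses products. -/
lemma adj_mul (hf : IsEven f) (P Q : SPDO A) : adj f (P * Q) = adj f Q * adj f P := by
  refine antiHom_of_generators (adj_bounded f) adj_one (fun a Q => ?_) (fun Q => ?_)
    (fun Q => ?_) ?_ P Q
  · rw [adj_C_mul, adj_C]
  · rw [adj_opD₁_mul hf, adj_opD₁ hf]
  · rw [adj_opD₂_mul hf, adj_opD₂ hf]
  · rw [adj_dyPow_one hf, ← gaugeUnit_val, ← Units.val_neg]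
    exact Units.isUnit _

end Adjoint

end

end SPDO

namespace SPDO

noncomputable section

variable {A : Type*} [Ring A] [Algebra ℂ A] [N2Algebra A]

/-! ### Differential operators and those that kill constants. -/

section Diff

/-- The differential operators. -/
def diffOps (A : Type*) [Ring A] : AddSubgroup (SPDO A) where
  carrier := {P | ∀ n s, n < 0 → P.coeff n s = 0}
  zero_mem' _ _ _ := rfl
  add_mem' hP hQ n s h := by rw [add_coeff, hP n s h, hQ n s h, add_zero]
  neg_mem' hP n s h := by rw [neg_coeff, hP n s h, neg_zero]

/-- The differential operators that annihilate the constants. -/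
def diffOps₀ (A : Type*) [Ring A] : AddSubgroup (SPDO A) where
  carrier := {P | P ∈ diffOps A ∧ P.coeff 0 0 = 0}
  zero_mem' := ⟨zero_mem _, rfl⟩
  add_mem' hP hQ := ⟨add_mem hP.1 hQ.1, by rw [add_coeff, hP.2, hQ.2, add_zero]⟩
  neg_mem' hP := ⟨neg_mem hP.1, by rw [neg_coeff, hP.2, neg_zero]⟩

lemma mono_mem_diffOps {n : ℤ} (hn : 0 ≤ n) (s : Fin 4) (a : A) : mono n s a ∈ diffOps A := by
  intro m t hm
  rw [mono_coeff, if_neg]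
  rintro ⟨rfl, -⟩
  omega

lemma D₁Mul_mem_diffOps {Q : SPDO A} (hQ : Q ∈ diffOps A) : D₁Mul Q ∈ diffOps A := by
  intro n s h
  revert s
  refine forall_fin_four ?_ ?_ ?_ ?_ <;> simp [hQ n _ h, hQ (n - 1) _ (by omega)]

lemma D₂Mul_mem_diffOps {Q : SPDO A} (hQ : Q ∈ diffOps A) : D₂Mul Q ∈ diffOps A := by
  intro n s h
  revert s
  refine forall_fin_four ?_ ?_ ?_ ?_ <;> simp [hQ n _ h, hQ (n - 1) _ (by omega)]

lemma D₁Mul_mem_diffOps₀ {Q : SPDO A} (hQ : Q ∈ diffOps₀ A) : D₁Mul Q ∈ diffOps₀ A :=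
  ⟨D₁Mul_mem_diffOps hQ.1, by simp [hQ.2, hQ.1 (-1) _ (by omega)]⟩

lemma D₂Mul_mem_diffOps₀ {Q : SPDO A} (hQ : Q ∈ diffOps₀ A) : D₂Mul Q ∈ diffOps₀ A :=
  ⟨D₂Mul_mem_diffOps hQ.1, by simp [hQ.2, hQ.1 (-1) _ (by omega)]⟩

lemma DMul_dyMul_mem {Z : AddSubgroup (SPDO A)} (h₁ : ∀ Q ∈ Z, D₁Mul Q ∈ Z)
    (h₂ : ∀ Q ∈ Z, D₂Mul Q ∈ Z) {Q : SPDO A} (hQ : Q ∈ Z) (n : ℕ) (s : Fin 4) :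
    DMul s (dyMul n Q) ∈ Z := by
  have hd : dyMul n Q ∈ Z := by
    induction n with
    | zero => rwa [Nat.cast_zero, dyMul_zero]
    | succ n ih =>
      rw [Nat.cast_add, Nat.cast_one, dyMul_succ]
      exact h₁ _ (h₁ _ ih)
  revert s
  exact forall_fin_four hd (h₁ _ hd) (h₂ _ hd) (h₁ _ (h₂ _ hd))

lemma mul_coeff_eq_zero_of_diffOps {P : SPDO A} (hP : P ∈ diffOps A) {Q : SPDO A} {m : ℤ}
    {t : Fin 4} (h : ∀ (n : ℕ) (s : Fin 4), (DMul s (dyMul n Q)).coeff m t = 0) :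
    (P * Q).coeff m t = 0 := by
  rw [mul_coeff_def]
  refine (finsum_congr fun n => Finset.sum_eq_zero fun s _ => ?_).trans finsum_zero
  rcases lt_or_ge n 0 with hn | hn
  · rw [hP n s hn, zero_mul]
  · obtain ⟨k, rfl⟩ := Int.eq_ofNat_of_zero_le hn
    rw [h k s, mul_zero]

lemma mul_mem_diffOps {P Q : SPDO A} (hP : P ∈ diffOps A) (hQ : Q ∈ diffOps A) :
    P * Q ∈ diffOps A := fun m t hm => mul_coeff_eq_zero_of_diffOps hP fun n s =>
  DMul_dyMul_mem (fun _ => D₁Mul_mem_diffOps) (fun _ => D₂Mul_mem_diffOps) hQ n s m t hm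

/-- The multiplication term of a differential operator is its value on `1`, so killing constants
survives left multiplication by differential operators. Hence `diffOps₀` is closed under
commutators. -/
lemma mul_mem_diffOps₀ {P Q : SPDO A} (hP : P ∈ diffOps A) (hQ : Q ∈ diffOps₀ A) :
    P * Q ∈ diffOps₀ A := ⟨mul_mem_diffOps hP hQ.1, mul_coeff_eq_zero_of_diffOps hP fun n s =>
  (DMul_dyMul_mem (fun _ => D₁Mul_mem_diffOps₀) (fun _ => D₂Mul_mem_diffOps₀) hQ n s).2⟩

lemma smul_mem_diffOps (c : ℂ) {P : SPDO A} (hP : P ∈ diffOps A) : c • P ∈ diffOps A :=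
  fun n s h => by rw [smul_coeff, hP n s h, smul_zero]

lemma C_mem_diffOps (a : A) : C a ∈ diffOps A := mono_mem_diffOps le_rfl _ _

lemma gaugeD₁_mem_diffOps (f : A) : gaugeD₁ f ∈ diffOps A :=
  sub_mem (mono_mem_diffOps le_rfl _ _) (C_mem_diffOps _)

lemma gaugeD₂_mem_diffOps (f : A) : gaugeD₂ f ∈ diffOps A :=
  sub_mem (mono_mem_diffOps le_rfl _ _) (C_mem_diffOps _)

lemma gaugeDy_mem_diffOps (f : A) : gaugeDy f ∈ diffOps A :=
  sub_mem (mono_mem_diffOps zero_le_one _ _) (C_mem_diffOps _)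

lemma adjD_mem_diffOps (f : A) (s : Fin 4) : adjD f s ∈ diffOps A := by
  have h1 : adjD₁ f ∈ diffOps A := smul_mem_diffOps _ (gaugeD₁_mem_diffOps f)
  have h2 : adjD₂ f ∈ diffOps A := smul_mem_diffOps _ (gaugeD₂_mem_diffOps f)
  revert s
  refine forall_fin_four ?_ h1 h2 (mul_mem_diffOps h2 h1)
  change (1 : SPDO A) ∈ _
  rw [← C_one]
  exact C_mem_diffOps 1

lemma adj_mem_diffOps (f : A) {P : SPDO A} (hP : P ∈ diffOps A) : adj f P ∈ diffOps A := by
  intro m t hm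
  refine (extend_coeff _ _ P m t).trans
    ((finsum_congr fun n => Finset.sum_eq_zero fun s _ => ?_).trans finsum_zero)
  rcases lt_or_ge n 0 with hn | hn
  · rw [hP n s hn, map_zero, zero_coeff]
  · obtain ⟨k, rfl⟩ := Int.eq_ofNat_of_zero_le hn
    refine mul_mem_diffOps (mul_mem_diffOps ?_ (adjD_mem_diffOps f s)) (C_mem_diffOps _) m t hm
    induction k with
    | zero =>
      rw [Nat.cast_zero, zpow_zero, Units.val_one, ← C_one]
      exact C_mem_diffOps 1
    | succ k ih =>
      rw [Nat.cast_add, Nat.cast_one, zpow_add_one, Units.val_mul, Units.val_neg, gaugeUnit_val]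
      exact mul_mem_diffOps (ih (Int.natCast_nonneg k)) (neg_mem (gaugeDy_mem_diffOps f))

lemma eq_zero_of_diffOps_of_ordLE {P : SPDO A} (h : P ∈ diffOps A) (h' : P ∈ ordLE A (-1)) :
    P = 0 := ext_coeff fun n s => by
  rcases lt_or_ge n 0 with hn | hn
  · exact h n s hn
  · exact h' n s (by have := wt_nonneg s; omega)

end Diff

/-! ### Leading symbols in order zero. -/

section Symbols

lemma opD₁_mul_opD₂_mul_C {e : A} (he : IsEven e) : opD₁ * opD₂ * C e
    = C e * (opD₁ * opD₂) + C (D₁ e) * opD₂ - C (D₂ e) * opD₁ + C (D₁ (D₂ e)) := by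
  have h : parity e = e := he
  have h2 : parity (D₂ e) = -D₂ e := he.D₂
  rw [mul_assoc, opD₂_mul_C, h, mul_add, opD₁_mul_C, h2, ← mul_assoc, opD₁_mul_C, h, C_neg, add_mul,
    neg_mul, mul_assoc]
  abel

lemma opD_three_commutator_mem {e : A} (he : IsEven e) :
    opD 3 * C e - C e * opD 3 ∈ ordLE A 1 := by
  have h : opD 3 * C e - C e * opD 3 = C (D₁ e) * opD₂ - C (D₂ e) * opD₁ + C (D₁ (D₂ e)) := by
    rw [opD_three, opD₁_mul_opD₂_mul_C he]
    abel
  rw [h]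
  exact add_mem (sub_mem (mul_mem_of_le (C_mem _) opD₂_mem (by norm_num))
    (mul_mem_of_le (C_mem _) opD₁_mem (by norm_num))) (ordLE_mono (by norm_num) (C_mem _))

/-- From `[∂_y⁻¹, X] = -∂_y⁻¹ [∂_y, X] ∂_y⁻¹`. -/
lemma dyPow_neg_one_commutator_mem {k : ℤ} {X : SPDO A} (hX : X ∈ ordLE A k) :
    dyPow (-1) * X - X * dyPow (-1) ∈ ordLE A (k - 4) := by
  have e1 : (dyPow 1 * dyPow (-1) : SPDO A) = 1 := dyUnit.mul_inv
  have e2 : (dyPow (-1) * dyPow 1 : SPDO A) = 1 := dyUnit.inv_mul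
  have h : dyPow (-1) * X - X * dyPow (-1)
      = -(dyPow (-1) * (dyPow 1 * X - X * dyPow 1) * dyPow (-1)) := by
    have h1 : dyPow (-1) * (dyPow 1 * X - X * dyPow 1) * dyPow (-1)
        = dyPow (-1) * dyPow 1 * X * dyPow (-1) - dyPow (-1) * X * (dyPow 1 * dyPow (-1)) := by
      noncomm_ring
    rw [h1, e1, e2, one_mul, mul_one, neg_sub]
  rw [h]
  exact neg_mem (mul_mem_of_le (mul_mem (dyPow_mem (-1)) (dyPow_one_commutator_mem hX))
    (dyPow_mem (-1)) (by omega))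

lemma opD_mem (s : Fin 4) : (opD s : SPDO A) ∈ ordLE A (wt s) := by
  have h := mono_mem_ordLE 0 s (1 : A)
  rwa [mul_zero, zero_add] at h

lemma opD_commute_dyPow (s : Fin 4) (n : ℤ) : Commute (opD s) (dyPow n : SPDO A) := by
  have h1 : Commute (opD₁ : SPDO A) (dyPow 1) := by
    rw [← opD₁_mul_opD₁]
    exact (Commute.refl _).mul_right (Commute.refl _)
  have h2 : Commute (opD₂ : SPDO A) (dyPow 1) := by
    rw [← opD₂_mul_opD₂]
    exact (Commute.refl _).mul_right (Commute.refl _)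
  have h : Commute (opD s) (dyPow 1 : SPDO A) := by
    revert s
    refine forall_fin_four (Commute.one_left _) h1 h2 ?_
    rw [opD_three]
    exact h1.mul_left h2
  rw [← dyUnit_zpow]
  exact Commute.units_zpow_right (u := dyUnit) h n

/-- The operator `D₁ D₂ ∂_y⁻¹`, a square root of `-1` of order zero. -/
def opJ : SPDO A := opD 3 * dyPow (-1)

lemma opJ_mem : (opJ : SPDO A) ∈ ordLE A 0 :=
  mul_mem_of_le (opD_mem 3) (dyPow_mem (-1)) (by simp)

lemma opJ_commutator_mem {e : A} (he : IsEven e) : opJ * C e - C e * opJ ∈ ordLE A (-1) := by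
  have h : opJ * C e - C e * opJ = opD 3 * (dyPow (-1) * C e - C e * dyPow (-1))
      + (opD 3 * C e - C e * opD 3) * dyPow (-1) := by
    rw [opJ]
    noncomm_ring
  rw [h]
  exact add_mem (mul_mem_of_le (opD_mem 3) (dyPow_neg_one_commutator_mem (C_mem e)) (by simp))
    (mul_mem_of_le (opD_three_commutator_mem he) (dyPow_mem (-1)) (by norm_num))

lemma opJ_commute_opD_three : Commute (opJ : SPDO A) (opD 3) := by
  rw [opJ]
  exact (Commute.refl _).mul_left (opD_commute_dyPow 3 (-1)).symm

lemma mono_neg_one_three (e : A) : mono (-1) 3 e = C e * opJ := by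
  rw [mono_eq, opJ, mul_assoc]

/-- To leading order `D₁ D₂` is symmetric and `∂_y` antisymmetric, so `e J` is antisymmetric. In
`adj_ge1` this removes the `D₁ D₂ ∂_y⁻¹` part of the discarded terms, leaving only the
multiplication term. -/
lemma adj_opJ_mem {f e : A} (hf : IsEven f) (he : IsEven e) :
    adj f (C e * opJ) + C e * opJ ∈ ordLE A (-1) := by
  set T : SPDO A := ↑(gaugeUnit f)⁻¹ with hT
  have h1 : adj f (C e * opJ) = -(T * (gaugeD₁ f * gaugeD₂ f) * C e) := by
    rw [← mono_neg_one_three, adj_mono, revCoeff_even he, zpow_neg_one, inv_neg, Units.val_neg]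
    change -T * (adjD₂ f * adjD₁ f) * C e = _
    rw [adjD₂, adjD₁, smul_mul_smul_comm, gaugeD₂_mul_gaugeD₁ hf, neg_mul_neg, Complex.I_mul_I,
      neg_one_smul, neg_neg, neg_mul, neg_mul]
  have h2 : gaugeD₁ f * gaugeD₂ f - opD 3 ∈ ordLE A 1 := by
    have : gaugeD₁ f * gaugeD₂ f - opD 3 = -(opD₁ * C (D₂ f)) - C (D₁ f) * gaugeD₂ f := by
      rw [opD_three, gaugeD₁, gaugeD₂]
      noncomm_ring
    rw [this]
    exact sub_mem (neg_mem (mul_mem_of_le opD₁_mem (C_mem _) (by norm_num)))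
      (mul_mem_of_le (C_mem _) (gaugeD₂_mem f) (by norm_num))
  have h3 : adj f (C e * opJ) + C e * opJ = -((T - dyPow (-1)) * (gaugeD₁ f * gaugeD₂ f) * C e)
      - dyPow (-1) * (gaugeD₁ f * gaugeD₂ f - opD 3) * C e - (opJ * C e - C e * opJ) := by
    rw [h1, opJ, (opD_commute_dyPow 3 (-1)).eq]
    noncomm_ring
  rw [h3]
  refine sub_mem (sub_mem (neg_mem (mul_mem_of_le (mul_mem (gaugeUnit_inv f)
    (mul_mem (gaugeD₁_mem f) (gaugeD₂_mem f))) (C_mem e) (by norm_num))) ?_) (opJ_commutator_mem he)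
  exact mul_mem_of_le (mul_mem (dyPow_mem (-1)) h2) (C_mem e) (by norm_num)

end Symbols

end

end SPDO

/-! ### The Lax operator, its square root and their parity. -/

section Lax

open SPDO

noncomputable section

variable {A : Type*} [Ring A] [Algebra ℂ A] [N2Algebra A]

lemma laxK_eq (U : A) : laxK U = opD 3 + (C (D₂ U) * opD₁ - C (D₁ U) * opD₂) := by
  rw [laxK, opD_three, add_sub_assoc]

lemma laxK_sub_mem (U : A) : laxK U - opD 3 ∈ ordLE A 1 := by
  rw [laxK_eq, add_sub_cancel_left]
  exact sub_mem (mul_mem_of_le (C_mem _) opD₁_mem (by norm_num))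
    (mul_mem_of_le (C_mem _) opD₂_mem (by norm_num))

lemma laxK_mem (U : A) : laxK U ∈ ordLE A 2 := by
  have h := add_mem (ordLE_mono (by norm_num) (laxK_sub_mem U)) (opD_mem (A := A) 3)
  rwa [sub_add_cancel] at h

lemma opD_three_sq : opD 3 * opD 3 = -(dyPow 2 : SPDO A) := by
  have h : opD₁ * opD₂ * (opD₁ * opD₂) = opD₁ * (opD₂ * opD₁) * (opD₂ : SPDO A) := by noncomm_ring
  rw [opD_three, h, opD₂_mul_opD₁, mul_neg, neg_mul, ← mul_assoc, mul_assoc _ opD₂, opD₁_mul_opD₁,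
    opD₂_mul_opD₂, dyPow_mul_dyPow]
  norm_num

lemma laxL_sub_mem (U : A) : laxL U - dyPow 2 ∈ ordLE A 3 := by
  have h : laxL U - dyPow 2
      = -((laxK U - opD 3) * laxK U) - opD 3 * (laxK U - opD 3) := by
    have : laxL U - dyPow 2 = -(laxK U * laxK U) + opD 3 * opD 3 := by
      rw [opD_three_sq, laxL, sub_eq_add_neg]
    rw [this]
    noncomm_ring
  rw [h]
  exact sub_mem (neg_mem (mul_mem_of_le (laxK_sub_mem U) (laxK_mem U) (by norm_num)))
    (mul_mem_of_le (opD_mem 3) (laxK_sub_mem U) (by simp))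

lemma existsUnique_isSqrt (U : A) : ∃! R : SPDO A, IsSqrt R (laxL U) := by
  obtain ⟨R, h1, h2⟩ := exists_sqrt (laxL_sub_mem U)
  refine ⟨R, isSqrt_iff.2 ⟨h1, h2⟩, fun S hS => ?_⟩
  obtain ⟨h3, h4⟩ := isSqrt_iff.1 hS
  exact sqrt_unique h4 h2 (h3.trans h1.symm)

lemma laxHat_eq (U : A) : laxHat U = Complex.I • laxK U := C_algebraMap_mul _ _

lemma laxHat_sq (U : A) : laxHat U * laxHat U = laxL U := by
  rw [laxHat_eq, smul_mul_smul_comm, Complex.I_mul_I, neg_one_smul, laxL]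

/-- The operator `L̂ ^ n L ^ (1/2)`. -/
def laxPower (U : A) (R : SPDO A) (n : ℕ) : SPDO A := laxHat U ^ n * R

section

variable {U : A} {R : SPDO A}

/-- The commutator `X = [R, K]` satisfies `X R + R X = [R², K]`, which vanishes because `R² = -K²`;
hence `X = 0`. -/
lemma commute_sqrt_laxK (hR : IsSqrt R (laxL U)) : Commute R (laxK U) := by
  obtain ⟨h1, h2⟩ := isSqrt_iff.1 hR
  rw [commute_iff_eq, ← sub_eq_zero]
  refine eq_zero_of_anticomm h2 h2 ?_
  have h : (R * laxK U - laxK U * R) * R + R * (R * laxK U - laxK U * R)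
      = R * R * laxK U - laxK U * (R * R) := by noncomm_ring
  rw [h, h1, laxL]
  noncomm_ring

lemma commute_sqrt_laxHat (hR : IsSqrt R (laxL U)) : Commute R (laxHat U) := by
  rw [laxHat_eq]
  exact (commute_sqrt_laxK hR).smul_right _

lemma commute_laxPower_laxK (hR : IsSqrt R (laxL U)) (n : ℕ) : Commute (laxPower U R n) (laxK U) := by
  refine Commute.mul_left (Commute.pow_left ?_ n) (commute_sqrt_laxK hR)
  rw [laxHat_eq]
  exact (Commute.refl _).smul_left _

lemma commute_laxPower (hR : IsSqrt R (laxL U)) (m n : ℕ) :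
    Commute (laxPower U R m) (laxPower U R n) := by
  have h := commute_sqrt_laxHat hR
  exact ((Commute.pow_pow_self _ m n).mul_right (h.symm.pow_left m)).mul_left
    ((h.pow_right n).mul_right (Commute.refl R))

lemma parityHom_laxK (hU : IsEven U) : parityHom (laxK U) = laxK U := by
  have h1 : parityHom (opD₁ : SPDO A) = -opD₁ := by
    rw [← mul_one opD₁, opD₁_mul, parityHom_D₁Mul, parityHom_one]
  have h2 : parityHom (opD₂ : SPDO A) = -opD₂ := by
    rw [← mul_one opD₂, opD₂_mul, parityHom_D₂Mul, parityHom_one]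
  have h3 : parity (D₁ U) = -D₁ U := hU.D₁
  have h4 : parity (D₂ U) = -D₂ U := hU.D₂
  rw [laxK, map_sub, map_add, parityHom_mul, parityHom_C_mul, parityHom_C_mul, h1, h2, h3, h4, C_neg,
    C_neg, neg_mul_neg, neg_mul_neg, neg_mul_neg]

lemma parityHom_dyPow_one : parityHom (dyPow 1 : SPDO A) = dyPow 1 := by
  rw [← opD₁_mul_opD₁, opD₁_mul, parityHom_D₁Mul, ← opD₁_mul, ← mul_one opD₁, opD₁_mul 1,
    parityHom_D₁Mul, parityHom_one, mul_neg, neg_neg, D₁Mul_mul, one_mul]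

lemma parityHom_sqrt (hU : IsEven U) (hR : IsSqrt R (laxL U)) : parityHom R = R := by
  obtain ⟨h1, h2⟩ := isSqrt_iff.1 hR
  refine sqrt_unique ?_ h2 ?_
  · rw [← parityHom_dyPow_one, ← map_sub]
    exact parityHom_mem h2
  · rw [← parityHom_mul, h1, laxL, map_neg, parityHom_mul, parityHom_laxK hU]

lemma parityHom_smul (c : ℂ) (P : SPDO A) : parityHom (c • P) = c • parityHom P :=
  ext_coeff fun n => forall_fin_four (by simp) (by simp) (by simp) (by simp)

lemma parityHom_laxPower (hU : IsEven U) (hR : IsSqrt R (laxL U)) (n : ℕ) :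
    parityHom (laxPower U R n) = laxPower U R n := by
  have h : ∀ n : ℕ, parityHom (laxHat U ^ n) = laxHat U ^ n := by
    intro n
    induction n with
    | zero => rw [pow_zero, parityHom_one]
    | succ n ih =>
      rw [pow_succ, parityHom_mul, ih, laxHat_eq, parityHom_smul, parityHom_laxK hU]
  rw [laxPower, parityHom_mul, h, parityHom_sqrt hU hR]

lemma isEven_laxPower_coeff_zero (hU : IsEven U) (hR : IsSqrt R (laxL U)) (n : ℕ) (m : ℤ) :
    IsEven ((laxPower U R n).coeff m 0) := by
  have h := congrArg (fun P : SPDO A => P.coeff m 0) (parityHom_laxPower hU hR n)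
  exact h

lemma isEven_laxPower_coeff_three (hU : IsEven U) (hR : IsSqrt R (laxL U)) (n : ℕ) (m : ℤ) :
    IsEven ((laxPower U R n).coeff m 3) := by
  have h := congrArg (fun P : SPDO A => P.coeff m 3) (parityHom_laxPower hU hR n)
  exact h

end

end

end Lax

/-! ### The Lax representation of the flows. -/

section Lax

open SPDO

noncomputable section

variable {A : Type*} [Ring A] [Algebra ℂ A] [N2Algebra A]

namespace SPDO

lemma adj_smul (f : A) (c : ℂ) (P : SPDO A) : adj f (c • P) = c • adj f P := by
  rw [← C_algebraMap_mul, adj_C_mul, revCoeff_even (AlgHom.commutes _ c),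
    ← (C_algebraMap_commute c _).eq, C_algebraMap_mul]

lemma ge1_coeff (P : SPDO A) (n : ℤ) (s : Fin 4) :
    (ge1 P).coeff n s = if 0 ≤ n ∧ ¬(n = 0 ∧ s = 0) then P.coeff n s else 0 := rfl

lemma ge1_mem (P : SPDO A) : ge1 P ∈ diffOps₀ A := by
  refine ⟨fun n s hn => ?_, ?_⟩
  · rw [ge1_coeff, if_neg (by omega)]
  · rw [ge1_coeff, if_neg (by simp)]

/-- The part of an operator removed by the projection `ge1` is, up to terms of negative order, of
the form `a + e D₁ D₂ ∂_y⁻¹`. -/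
lemma sub_ge1_symbol (P : SPDO A) :
    P - ge1 P - (C (P.coeff 0 0) + C (P.coeff (-1) 3) * opJ) ∈ ordLE A (-1) := by
  intro n s hn
  rw [← mono_neg_one_three, sub_coeff, sub_coeff, add_coeff, ge1_coeff, mono_coeff, C_coeff]
  rcases lt_trichotomy n (-1) with h | h | h
  · have := wt_le s
    omega
  · subst h
    revert s
    refine forall_fin_four ?_ ?_ ?_ ?_ <;> simp
  · have h0 : 0 ≤ n := by omega
    by_cases hc : n = 0 ∧ s = 0
    · obtain ⟨rfl, rfl⟩ := hc
      simp
    · rw [if_pos ⟨h0, hc⟩, if_neg hc, if_neg (by omega)]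
      simp

/-- Even coefficients commute with each other, and with `J` up to order -1/2. -/
lemma symbol_mul_commutator_mem {a e b g : A} (ha : IsEven a) (he : IsEven e) (hb : IsEven b)
    (hg : IsEven g) : (C a + C e * opJ) * (C b + C g * opJ) - (C b + C g * opJ) * (C a + C e * opJ)
      ∈ ordLE A (-1) := by
  have e1 : C b * C a = C a * C b := by rw [← C_mul, ← C_mul, even_comm b a hb]
  have e2 : C g * C a = C a * C g := by rw [← C_mul, ← C_mul, even_comm g a hg]
  have e3 : C b * C e = C e * C b := by rw [← C_mul, ← C_mul, even_comm b e hb]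
  have e4 : C g * C e = C e * C g := by rw [← C_mul, ← C_mul, even_comm g e hg]
  have h : (C a + C e * opJ) * (C b + C g * opJ) - (C b + C g * opJ) * (C a + C e * opJ)
      = (C a * C b - C b * C a) + (C a * C g - C g * C a) * opJ + (C e * C b - C b * C e) * opJ
        + (C e * C g - C g * C e) * opJ * opJ
        + C e * (opJ * C b - C b * opJ) - C g * (opJ * C a - C a * opJ)
        + C e * (opJ * C g - C g * opJ) * opJ - C g * (opJ * C e - C e * opJ) * opJ := by
    noncomm_ring
  rw [h, e1, e2, e3, e4]
  simp only [sub_self, zero_mul, zero_add]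
  refine sub_mem (add_mem (sub_mem ?_ ?_) ?_) ?_
  · exact mul_mem_of_le (C_mem _) (opJ_commutator_mem hb) (by norm_num)
  · exact mul_mem_of_le (C_mem _) (opJ_commutator_mem ha) (by norm_num)
  · exact mul_mem_of_le (mul_mem (C_mem _) (opJ_commutator_mem hg)) opJ_mem (by norm_num)
  · exact mul_mem_of_le (mul_mem (C_mem _) (opJ_commutator_mem he)) opJ_mem (by norm_num)

/-- Modulo order `k / 2` a commutator depends only on the leading parts of its entries; the
admissible errors in `X` and `Y` are balanced by the orders of `Y'` and `X`. -/
lemma commutator_mem_of_sub_mem {X Y X' Y' : SPDO A} {k : ℤ} {i j : ℤ} (hX : X ∈ ordLE A i)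
    (hY' : Y' ∈ ordLE A j) (h1 : X - X' ∈ ordLE A (k - j)) (h2 : Y - Y' ∈ ordLE A (k - i))
    (h : X' * Y' - Y' * X' ∈ ordLE A k) : X * Y - Y * X ∈ ordLE A k := by
  have e : X * Y - Y * X = X * (Y - Y') + (X - X') * Y' + (X' * Y' - Y' * X')
      - (Y - Y') * X - Y' * (X - X') := by noncomm_ring
  rw [e]
  exact sub_mem (sub_mem (add_mem (add_mem (mul_mem_of_le hX h2 (by omega))
    (mul_mem_of_le h1 hY' (by omega))) h) (mul_mem_of_le h2 hX (by omega)))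
    (mul_mem_of_le hY' h1 (by omega))

lemma symbol_mem (a e : A) : C a + C e * opJ ∈ ordLE A 0 :=
  add_mem (C_mem a) (mul_mem_of_le (C_mem e) opJ_mem (by norm_num))

lemma sub_ge1_mem (P : SPDO A) : P - ge1 P ∈ ordLE A 0 := by
  have h := add_mem (ordLE_mono (by norm_num) (sub_ge1_symbol P)) (symbol_mem (P.coeff 0 0) (P.coeff (-1) 3))
  rwa [sub_add_cancel] at h

end SPDO

variable {U : A} {R : SPDO A}

/-- Heuristically, `laxK U` is `e ^ U D₁ D₂ e ^ (-U)` plus an even superfield. The operator `D₁ D₂`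
is symmetric for the unweighted adjoint, and conjugation by `e ^ U` turns that adjoint into the one
with weight `e ^ (2U)`. -/
lemma adj_laxK (hU : IsEven U) : adj ((2 : ℂ) • U) (laxK U) = laxK U := by
  have hf : IsEven ((2 : ℂ) • U) := hU.smul 2
  have h1 : opD₁ * C (D₂ U) = C (D₁ (D₂ U)) - C (D₂ U) * opD₁ := by
    rw [opD₁_mul_C, show parity (D₂ U) = -D₂ U from hU.D₂, C_neg, neg_mul, sub_eq_add_neg]
  have h2 : opD₂ * C (D₁ U) = -C (D₁ (D₂ U)) - C (D₁ U) * opD₂ := by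
    rw [opD₂_mul_C, show parity (D₁ U) = -D₁ U from hU.D₁, C_neg, neg_mul, sub_eq_add_neg, D₂_D₁,
      C_neg]
  have h3 : C (D₁ U) * C (D₂ U) = -(C (D₂ U) * C (D₁ U)) := by
    rw [← C_mul, ← C_mul, odd_anticomm _ _ hU.D₁ hU.D₂, C_neg]
  have e : adj ((2 : ℂ) • U) (laxK U) = -(gaugeD₂ ((2 : ℂ) • U) * gaugeD₁ ((2 : ℂ) • U))
      + gaugeD₁ ((2 : ℂ) • U) * C (D₂ U) - gaugeD₂ ((2 : ℂ) • U) * C (D₁ U) := by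
    rw [laxK, map_sub, map_add, adj_mul hf, adj_C_mul, adj_C_mul, adj_opD₁ hf, adj_opD₂ hf,
      revCoeff_odd hU.D₁, revCoeff_odd hU.D₂, C_smul, C_smul, adjD₁, adjD₂]
    simp only [smul_mul_assoc, mul_smul_comm, smul_smul, smul_neg, Complex.I_mul_I, neg_neg, one_smul,
      neg_smul, neg_mul, mul_neg]
  rw [e, gaugeD₁, gaugeD₂, map_smul, map_smul, C_smul, C_smul, two_smul, two_smul]
  simp only [sub_mul, mul_sub, add_mul, mul_add, h1, h2, h3, opD₂_mul_opD₁, laxK]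
  abel

/-- The adjoint fixes `L` and sends `∂_y` to `-∂_y + ⋯`, so `-adj R` is another square root of `L`
beginning with `∂_y`. -/
lemma adj_sqrt (hU : IsEven U) (hR : IsSqrt R (laxL U)) : adj ((2 : ℂ) • U) R = -R := by
  have hf : IsEven ((2 : ℂ) • U) := hU.smul 2
  obtain ⟨h1, h2⟩ := isSqrt_iff.1 hR
  rw [← neg_eq_iff_eq_neg]
  refine sqrt_unique ?_ h2 ?_
  · have h3 := add_mem (neg_mem (adj_mem ((2 : ℂ) • U) h2))
      (ordLE_mono (by norm_num) (gaugeDy_sub_mem ((2 : ℂ) • U)))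
    rw [map_sub, adj_dyPow_one hf] at h3
    convert h3 using 1
    abel
  · rw [neg_mul_neg, ← adj_mul hf, h1, laxL, map_neg, adj_mul hf, adj_laxK hU]

lemma adj_laxPower (hU : IsEven U) (hR : IsSqrt R (laxL U)) (n : ℕ) :
    adj ((2 : ℂ) • U) (laxPower U R n) = -laxPower U R n := by
  have hf : IsEven ((2 : ℂ) • U) := hU.smul 2
  have h : ∀ n : ℕ, adj ((2 : ℂ) • U) (laxHat U ^ n) = laxHat U ^ n := by
    intro n
    induction n with
    | zero => rw [pow_zero, adj_one]
    | succ n ih => 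
      have h1 : adj ((2 : ℂ) • U) (laxHat U) = laxHat U := by rw [laxHat_eq, adj_smul, adj_laxK hU]
      rw [pow_succ, adj_mul hf, ih, h1, ← pow_succ', pow_succ]
  rw [laxPower, adj_mul hf, h, adj_sqrt hU hR, neg_mul, ((commute_sqrt_laxHat hR).pow_right n).eq]

lemma laxK_mem_diffOps₀ (U : A) : laxK U ∈ diffOps₀ A := by
  rw [laxK_eq]
  have h : ∀ s : Fin 4, s ≠ 0 → (opD s : SPDO A) ∈ diffOps₀ A := fun s hs =>
    ⟨mono_mem_diffOps le_rfl _ _, by rw [opD, mono_coeff, if_neg (by simpa using hs.symm)]⟩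
  exact add_mem (h 3 (by decide)) (sub_mem (mul_mem_diffOps₀ (C_mem_diffOps _) (h 1 (by decide)))
    (mul_mem_diffOps₀ (C_mem_diffOps _) (h 2 (by decide))))

/-- The right-hand side of the `n`-th flow, in any algebra of superfields. -/
def flow (U : A) (R : SPDO A) (n : ℕ) : A := -(laxPower U R n).coeff 0 0

lemma isEven_flow (hU : IsEven U) (hR : IsSqrt R (laxL U)) (n : ℕ) : IsEven (flow U R n) :=
  (isEven_laxPower_coeff_zero hU hR n 0).neg

/-- The adjoint of the differential part of `L̂ ^ n L ^ (1/2)`. -/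
lemma adj_ge1 (hU : IsEven U) (hR : IsSqrt R (laxL U)) (n : ℕ) :
    adj ((2 : ℂ) • U) (ge1 (laxPower U R n)) = -ge1 (laxPower U R n) + (2 : ℂ) • C (flow U R n) := by
  have hf : IsEven ((2 : ℂ) • U) := hU.smul 2
  have hP := adj_laxPower hU hR n
  have ha := isEven_laxPower_coeff_zero hU hR n 0
  have he := isEven_laxPower_coeff_three hU hR n (-1)
  rw [flow]
  generalize laxPower U R n = P at hP ha he ⊢
  have hs := sub_ge1_symbol P
  have hB := (ge1_mem P).1
  generalize ge1 P = B at hs hB ⊢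
  set M := P - B - (C (P.coeff 0 0) + C (P.coeff (-1) 3) * opJ) with hM
  have e : adj ((2 : ℂ) • U) B - (-B + (2 : ℂ) • C (-P.coeff 0 0))
      = -(adj ((2 : ℂ) • U) M + M
        + (adj ((2 : ℂ) • U) (C (P.coeff (-1) 3) * opJ) + C (P.coeff (-1) 3) * opJ)) := by
    have h1 : adj ((2 : ℂ) • U) M = -P - adj ((2 : ℂ) • U) B
        - (C (P.coeff 0 0) + adj ((2 : ℂ) • U) (C (P.coeff (-1) 3) * opJ)) := by
      rw [hM, map_sub, map_sub, map_add, hP, adj_C, revCoeff_even ha]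
    rw [h1, hM, C_neg, smul_neg, two_smul ℂ (C (P.coeff 0 0))]
    abel
  rw [← sub_eq_zero]
  -- The two sides differ by an operator that is differential and, by `e`, of negative order.
  refine eq_zero_of_diffOps_of_ordLE ?_ ?_
  · exact sub_mem (adj_mem_diffOps _ hB)
      (add_mem (neg_mem hB) (smul_mem_diffOps _ (C_mem_diffOps _)))
  · rw [e]
    exact neg_mem (add_mem (add_mem (adj_mem _ hs) hs) (adj_opJ_mem hf he))

lemma parityHom_ge1 {P : SPDO A} (hP : parityHom P = P) : parityHom (ge1 P) = ge1 P := by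
  refine ext_coeff fun n s => ?_
  have h := congrArg (fun P : SPDO A => P.coeff n s) hP
  revert s
  refine forall_fin_four ?_ ?_ ?_ ?_ <;> intro h <;> simp at h <;>
  · simp [ge1_coeff]
    try split_ifs
    all_goals simp [h]

/-- Since `P` commutes with `K`, the bracket is `-[P - B, K]`. Its leading symbols `a + e J` and `D₁
D₂` commute up to order 1/2, although the product has order 1. -/
lemma commutator_ge1_mem (hU : IsEven U) (hR : IsSqrt R (laxL U)) (n : ℕ) :
    ge1 (laxPower U R n) * laxK U - laxK U * ge1 (laxPower U R n) ∈ ordLE A 1 := by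
  have ha := isEven_laxPower_coeff_zero hU hR n 0
  have he := isEven_laxPower_coeff_three hU hR n (-1)
  have hc := (commute_laxPower_laxK hR n).eq
  generalize laxPower U R n = P at ha he hc ⊢
  have e : ge1 P * laxK U - laxK U * ge1 P
      = -((P - ge1 P) * laxK U - laxK U * (P - ge1 P)) := by
    rw [sub_mul, mul_sub, hc]
    abel
  rw [e]
  refine neg_mem (commutator_mem_of_sub_mem (sub_ge1_mem P) (opD_mem 3) (sub_ge1_symbol P)
    (ordLE_mono (by norm_num) (laxK_sub_mem U)) ?_)
  have e' : (C (P.coeff 0 0) + C (P.coeff (-1) 3) * opJ) * opD 3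
      - opD 3 * (C (P.coeff 0 0) + C (P.coeff (-1) 3) * opJ)
      = -((opD 3 * C (P.coeff 0 0) - C (P.coeff 0 0) * opD 3)
        + (opD 3 * C (P.coeff (-1) 3) - C (P.coeff (-1) 3) * opD 3) * opJ) := by
    rw [add_mul, mul_assoc, opJ_commute_opD_three.eq]
    noncomm_ring
  rw [e']
  exact neg_mem (add_mem (opD_three_commutator_mem ha)
    (mul_mem_of_le (opD_three_commutator_mem he) opJ_mem (by norm_num)))

lemma C_mul_opD_coeff (a : A) (t : Fin 4) (n : ℤ) (s : Fin 4) :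
    (C a * opD t).coeff n s = if n = 0 ∧ s = t then a else 0 := by
  rw [C_mul_coeff, opD, mono_coeff]
  split_ifs <;> simp

/-- The Lax representation: `[(L̂ ^ n L ^ (1/2))_{≥ 1}, L̂]` is the variation of `L̂` along the
flow. -/
theorem commutator_ge1_laxK (hU : IsEven U) (hR : IsSqrt R (laxL U)) (n : ℕ) :
    ge1 (laxPower U R n) * laxK U - laxK U * ge1 (laxPower U R n)
      = C (D₂ (flow U R n)) * opD₁ - C (D₁ (flow U R n)) * opD₂ := by
  have hf : IsEven ((2 : ℂ) • U) := hU.smul 2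
  have hord := commutator_ge1_mem hU hR n
  have hadj := adj_ge1 hU hR n
  have hF := isEven_flow hU hR n
  have hpar := parityHom_ge1 (parityHom_laxPower hU hR n)
  have hB := ge1_mem (laxPower U R n)
  generalize ge1 (laxPower U R n) = B at *
  generalize flow U R n = F at *
  have hd : B * laxK U - laxK U * B ∈ diffOps₀ A := sub_mem
    (mul_mem_diffOps₀ hB.1 (laxK_mem_diffOps₀ U)) (mul_mem_diffOps₀ (laxK_mem_diffOps₀ U).1 hB)
  have hYp : parityHom (B * laxK U - laxK U * B) = B * laxK U - laxK U * B := by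
    rw [map_sub, parityHom_mul, parityHom_mul, hpar, parityHom_laxK hU]
  have hYa : adj ((2 : ℂ) • U) (B * laxK U - laxK U * B) = (B * laxK U - laxK U * B)
      + (2 : ℂ) • (laxK U * C F - C F * laxK U) := by
    rw [map_sub, adj_mul hf, adj_mul hf, adj_laxK hU, hadj, mul_add, add_mul, mul_smul_comm,
      smul_mul_assoc, smul_sub, mul_neg, neg_mul]
    abel
  generalize hY : B * laxK U - laxK U * B = Y at *
  set α := Y.coeff 0 1 with hα
  set β := Y.coeff 0 2 with hβ
  -- A differential operator of order at most 1/2 without multiplication term has only `D₁` and `D₂`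
  -- terms.
  have hYe : Y = C α * opD 1 + C β * opD 2 := by
    refine ext_coeff fun n s => ?_
    rw [add_coeff, C_mul_opD_coeff, C_mul_opD_coeff]
    rcases lt_trichotomy n 0 with h | h | h
    · rw [hd.1 n s h, if_neg (by omega), if_neg (by omega), add_zero]
    · subst h
      revert s
      refine forall_fin_four ?_ ?_ ?_ ?_
      · simpa using hd.2
      · simp [hα]
      · simp [hβ]
      · simpa using hord 0 3 (by simp)
    · rw [hord n s (by have := wt_nonneg s; omega), if_neg (by omega), if_neg (by omega), add_zero]
  have hαo : IsOdd α := by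
    have h := congrArg (fun P : SPDO A => P.coeff 0 1) hYp
    simp only [parityHom_coeff_one] at h
    rw [IsOdd, ← neg_eq_iff_eq_neg]
    exact h
  have hβo : IsOdd β := by
    have h := congrArg (fun P : SPDO A => P.coeff 0 2) hYp
    simp only [parityHom_coeff_two] at h
    rw [IsOdd, ← neg_eq_iff_eq_neg]
    exact h
  have hL : adj ((2 : ℂ) • U) Y = C (D₁ α) - C α * (opD 1 - C (D₁ ((2 : ℂ) • U)))
      + (C (D₂ β) - C β * (opD 2 - C (D₂ ((2 : ℂ) • U)))) := by
    rw [hYe, map_add, adj_C_mul, adj_C_mul, opD_one, opD_two, adj_opD₁ hf, adj_opD₂ hf,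
      revCoeff_odd hαo, revCoeff_odd hβo, C_smul, C_smul, adjD₁, adjD₂, smul_mul_smul_comm,
      smul_mul_smul_comm, neg_mul, Complex.I_mul_I, neg_neg, one_smul, one_smul,
      gaugeD₁_mul_C _ hf, gaugeD₂_mul_C _ hf, show parity α = -α from hαo,
      show parity β = -β from hβo, C_neg, C_neg, neg_mul, neg_mul, ← sub_eq_add_neg,
      ← sub_eq_add_neg, gaugeD₁, gaugeD₂]
  have hK : laxK U * C F - C F * laxK U
      = C (D₁ F) * opD 2 - C (D₂ F) * opD 1 + C (D₁ (D₂ F) + D₂ U * D₁ F - D₁ U * D₂ F) := by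
    have hFp : parity F = F := hF
    have c1 : C F * C (D₁ U) = C (D₁ U) * C F := by rw [← C_mul, ← C_mul, even_comm F _ hF]
    have c2 : C F * C (D₂ U) = C (D₂ U) * C F := by rw [← C_mul, ← C_mul, even_comm F _ hF]
    rw [laxK, sub_mul, add_mul, opD₁_mul_opD₂_mul_C hF, mul_assoc, mul_assoc, opD₁_mul_C, opD₂_mul_C,
      hFp, mul_sub, mul_add (C F), ← mul_assoc (C F) (C (D₂ U)), ← mul_assoc (C F) (C (D₁ U)), c1, c2,
      C_sub, C_add, C_mul, C_mul, opD_one, opD_two]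
    noncomm_ring
  rw [hL, hK] at hYa
  -- In `adj Y = Y + 2 [K, F]` the adjoint reverses the sign of `α` and `β`, so the `D₁` and `D₂`
  -- coefficients read `-α = α - 2 D₂ F` and `-β = β + 2 D₁ F`.
  have k1 := congrArg (fun P : SPDO A => P.coeff 0 1) hYa
  have k2 := congrArg (fun P : SPDO A => P.coeff 0 2) hYa
  simp only [add_coeff, sub_coeff, smul_coeff, mul_sub, ← C_mul, C_mul_opD_coeff, C_coeff] at k1 k2
  simp [← hα, ← hβ] at k1 k2
  have l1 : α = D₂ F := by
    have h : (2 : ℂ) • (α - D₂ F) = 0 := by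
      rw [smul_sub, two_smul ℂ α]
      have := congrArg (fun x => α - x) k1
      simp only [sub_neg_eq_add] at this
      rw [this]
      abel
    simpa [sub_eq_zero] using h
  have l2 : β = -D₁ F := by
    have h : (2 : ℂ) • (β + D₁ F) = 0 := by
      rw [smul_add, two_smul ℂ β]
      have := congrArg (fun x => β - x) k2
      simp only [sub_neg_eq_add] at this
      rw [this]
      abel
    exact add_eq_zero_iff_eq_neg.1 ((smul_eq_zero.1 h).resolve_left two_ne_zero)
  rw [hYe, l1, l2, C_neg, neg_mul, ← sub_eq_add_neg, opD_one, opD_two]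

end

end Lax

/-! ### Equivalence of flows and Lax equations. -/

section Lax

open SPDO

noncomputable section

variable {A : Type*} [Ring A] [Algebra ℂ A] [N2Algebra A] {U : A} {R : SPDO A}

lemma TimeDerivation.map_one (δ : TimeDerivation A) : δ.toFun 1 = 0 := by
  simpa using δ.map_mul 1 1

lemma timeDeriv_opD (δ : TimeDerivation A) (s : Fin 4) : timeDeriv δ (opD s) = 0 := by
  rw [opD, timeDeriv_mono, TimeDerivation.map_one, mono_zero]

lemma timeDeriv_laxK (δ : TimeDerivation A) (U : A) :
    timeDeriv δ (laxK U) = C (D₂ (δ.toFun U)) * opD₁ - C (D₁ (δ.toFun U)) * opD₂ := by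
  rw [laxK_eq, timeDeriv_add, timeDeriv_sub, timeDeriv_C_mul, timeDeriv_C_mul, timeDeriv_opD,
    ← opD_one, ← opD_two, timeDeriv_opD, timeDeriv_opD, δ.map_D₁, δ.map_D₂]
  simp

lemma timeDeriv_laxK_of_flow (hU : IsEven U) (hR : IsSqrt R (laxL U)) {n : ℕ} {c : ℂ}
    {δ : TimeDerivation A} (hδ : δ.toFun U = flow U R n + algebraMap ℂ A c) :
    timeDeriv δ (laxK U)
      = ge1 (laxPower U R n) * laxK U - laxK U * ge1 (laxPower U R n) := by
  rw [timeDeriv_laxK, hδ, map_add, map_add, D₁_algebraMap, D₂_algebraMap, add_zero, add_zero,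
    commutator_ge1_laxK hU hR]

lemma timeDeriv_laxL_of_flow (hU : IsEven U) (hR : IsSqrt R (laxL U)) {n : ℕ} {c : ℂ}
    {δ : TimeDerivation A} (hδ : δ.toFun U = flow U R n + algebraMap ℂ A c) :
    timeDeriv δ (laxL U) = ge1 (laxPower U R n) * laxL U - laxL U * ge1 (laxPower U R n) := by
  rw [laxL, timeDeriv_neg, timeDeriv_mul, timeDeriv_laxK_of_flow hU hR hδ]
  noncomm_ring

lemma laxEquation_of_flow (hU : IsEven U) (hR : IsSqrt R (laxL U)) {n : ℕ} {c : ℂ}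
    {δ : TimeDerivation A} (hδ : δ.toFun U = flow U R n + algebraMap ℂ A c) :
    LaxEquation n U δ := fun S hS => by
  rw [(existsUnique_isSqrt U).unique hS hR]
  exact timeDeriv_laxL_of_flow hU hR hδ

/-- The Lax equation concerns `L = -K²`, so it controls only the anticommutator of a variation of
`K` with `K`. This coefficient is what can be recovered about `g`; the mixed products of odd
derivatives of `g` and `U` cancel. -/
lemma laxVariation_anticomm_coeff (hU : IsEven U) {g : A} (hg : IsEven g) :
    ((C (D₂ g) * opD 1 - C (D₁ g) * opD 2) * laxK U
      + laxK U * (C (D₂ g) * opD 1 - C (D₁ g) * opD 2)).coeff 1 0 = (2 : ℂ) • dy g := by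
  have h1 : parity (D₁ U) = -D₁ U := hU.D₁
  have h2 : parity (D₂ U) = -D₂ U := hU.D₂
  have h3 : parity (D₁ g) = -D₁ g := hg.D₁
  have h4 : parity (D₂ g) = -D₂ g := hg.D₂
  have h5 : parity (dy g) = dy g := hg.dy
  have a1 : D₁ g * D₁ U = -(D₁ U * D₁ g) := odd_anticomm _ _ hg.D₁ hU.D₁
  have a2 : D₂ g * D₂ U = -(D₂ U * D₂ g) := odd_anticomm _ _ hg.D₂ hU.D₂
  have hK : ∀ n s, (laxK U).coeff n s = (if n = 0 ∧ s = 3 then 1 else 0)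
      + ((if n = 0 ∧ s = 1 then D₂ U else 0) - if n = 0 ∧ s = 2 then D₁ U else 0) := fun n s => by
    rw [laxK_eq, add_coeff, sub_coeff, ← opD_one, ← opD_two, C_mul_opD_coeff, C_mul_opD_coeff, opD,
      mono_coeff]
  have hX : ∀ n s, (C (D₂ g) * opD 1 - C (D₁ g) * opD 2).coeff n s
      = (if n = 0 ∧ s = 1 then D₂ g else 0) - if n = 0 ∧ s = 2 then D₁ g else 0 := fun n s => by
    rw [sub_coeff, C_mul_opD_coeff, C_mul_opD_coeff]
  have e : (C (D₂ g) * opD 1 - C (D₁ g) * opD 2) * laxK U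
      + laxK U * (C (D₂ g) * opD 1 - C (D₁ g) * opD 2)
      = C (D₂ g) * D₁Mul (laxK U) - C (D₁ g) * D₂Mul (laxK U)
        + (D₁Mul (D₂Mul (C (D₂ g) * opD 1 - C (D₁ g) * opD 2))
          + C (D₂ U) * D₁Mul (C (D₂ g) * opD 1 - C (D₁ g) * opD 2)
          - C (D₁ U) * D₂Mul (C (D₂ g) * opD 1 - C (D₁ g) * opD 2)) := by
    generalize hXd : C (D₂ g) * opD 1 - C (D₁ g) * opD 2 = X
    have : X * laxK U = C (D₂ g) * D₁Mul (laxK U) - C (D₁ g) * D₂Mul (laxK U) := by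
      rw [← hXd, sub_mul, mul_assoc, mul_assoc, opD_one, opD_two, opD₁_mul, opD₂_mul]
    have h' : laxK U * X
        = D₁Mul (D₂Mul X) + C (D₂ U) * D₁Mul X - C (D₁ U) * D₂Mul X := by
      rw [laxK, sub_mul, add_mul, mul_assoc, mul_assoc, mul_assoc, opD₂_mul, opD₁_mul, opD₁_mul]
    rw [this, h']
  rw [e]
  simp only [add_coeff, sub_coeff, C_mul_coeff, D₁Mul_coeff_zero', D₂Mul_coeff_zero',
    D₂Mul_coeff_one, hK, hX]
  simp [h1, h2, h3, h4, h5, a1, a2, D₂_D₂, D₁_D₁, two_smul]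

/-- By linearity, the variation of `K` along `g = δ U - F` is the variation along `δ` minus `[B,
K]`. It anticommutes with `K` when the Lax equation holds, so `2 g_y = 0`. -/
lemma dy_eq_of_laxEquation (hU : IsEven U) (hR : IsSqrt R (laxL U)) {n : ℕ} {δ : TimeDerivation A}
    (h : LaxEquation n U δ) : dy (δ.toFun U) = dy (flow U R n) := by
  have hg : IsEven (δ.toFun U - flow U R n) := by
    refine IsEven.sub ?_ (isEven_flow hU hR n)
    rw [IsEven, ← δ.map_parity, hU]
  have h1 := h R hR
  have h2 := commutator_ge1_laxK hU hR n
  change timeDeriv δ (laxL U) = ge1 (laxPower U R n) * laxL U - laxL U * ge1 (laxPower U R n) at h1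
  rw [laxL, timeDeriv_neg, timeDeriv_mul, timeDeriv_laxK] at h1
  have h3 : (C (D₂ (δ.toFun U - flow U R n)) * opD 1 - C (D₁ (δ.toFun U - flow U R n)) * opD 2)
      * laxK U + laxK U * (C (D₂ (δ.toFun U - flow U R n)) * opD 1
        - C (D₁ (δ.toFun U - flow U R n)) * opD 2) = 0 := by
    have e : C (D₂ (δ.toFun U - flow U R n)) * opD 1 - C (D₁ (δ.toFun U - flow U R n)) * opD 2
        = (C (D₂ (δ.toFun U)) * opD₁ - C (D₁ (δ.toFun U)) * opD₂)
          - (ge1 (laxPower U R n) * laxK U - laxK U * ge1 (laxPower U R n)) := by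
      rw [h2, map_sub, map_sub, C_sub, C_sub, opD_one, opD_two]
      noncomm_ring
    rw [e]
    generalize C (D₂ (δ.toFun U)) * opD₁ - C (D₁ (δ.toFun U)) * opD₂ = Y at *
    rw [neg_eq_iff_eq_neg] at h1
    calc _ = (Y * laxK U + laxK U * Y)
        - (ge1 (laxPower U R n) * laxK U * laxK U - laxK U * laxK U * ge1 (laxPower U R n)) := by
          noncomm_ring
      _ = 0 := by
        rw [h1]
        noncomm_ring
  have h4 := laxVariation_anticomm_coeff hU hg
  rw [h3, zero_coeff] at h4
  have h5 := (smul_eq_zero.1 h4.symm).resolve_left two_ne_zero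
  rwa [dy_sub, sub_eq_zero] at h5

/-! ### Commutativity of the flows. -/

section Commute

lemma timeDeriv_smul (δ : TimeDerivation A) (c : ℂ) (P : SPDO A) :
    timeDeriv δ (c • P) = c • timeDeriv δ P :=
  ext_coeff fun n s => map_smul δ.toFun c _

lemma timeDeriv_laxPower (hU : IsEven U) (hR : IsSqrt R (laxL U)) {m : ℕ} {δ : TimeDerivation A}
    (hδ : δ.toFun U = flow U R m) (n : ℕ) : timeDeriv δ (laxPower U R n)
      = ge1 (laxPower U R m) * laxPower U R n - laxPower U R n * ge1 (laxPower U R m) := by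
  have hδ' : δ.toFun U = flow U R m + algebraMap ℂ A 0 := by rw [hδ, map_zero, add_zero]
  have hK := timeDeriv_laxK_of_flow hU hR hδ'
  have hL := timeDeriv_laxL_of_flow hU hR hδ'
  obtain ⟨h1, h2⟩ := isSqrt_iff.1 hR
  generalize ge1 (laxPower U R m) = B at *
  -- Differentiating `R² = L` shows that `X = ∂_τ R - [B, R]` satisfies `X R + R X = 0`.
  have hRd : timeDeriv δ R = B * R - R * B := by
    rw [← sub_eq_zero]
    refine eq_zero_of_anticomm h2 h2 ?_
    rw [← h1, timeDeriv_mul] at hL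
    calc _ = (timeDeriv δ R * R + R * timeDeriv δ R) - (B * (R * R) - R * R * B) := by noncomm_ring
      _ = 0 := by rw [hL, sub_self]
  have hH : timeDeriv δ (laxHat U) = B * laxHat U - laxHat U * B := by
    rw [laxHat_eq, timeDeriv_smul, hK, smul_sub, mul_smul_comm, smul_mul_assoc]
  have hp : ∀ k : ℕ, timeDeriv δ (laxHat U ^ k) = B * laxHat U ^ k - laxHat U ^ k * B := by
    intro k
    induction k with
    | zero =>
      rw [pow_zero, mul_one, one_mul, sub_self]
      exact timeDeriv_opD δ 0
    | succ k ih =>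
      rw [pow_succ, timeDeriv_mul, ih, hH]
      noncomm_ring
  rw [laxPower, timeDeriv_mul, hp, hRd]
  noncomm_ring

/-- The flows commute. -/
lemma flow_comm (hU : IsEven U) (hR : IsSqrt R (laxL U)) {m n : ℕ} {δ ε : TimeDerivation A}
    (hδ : δ.toFun U = flow U R m) (hε : ε.toFun U = flow U R n) :
    δ.toFun (flow U R n) = ε.toFun (flow U R m) := by
  have h1 := timeDeriv_laxPower hU hR hδ n
  have h2 := timeDeriv_laxPower hU hR hε m
  have hc := (commute_laxPower hR m n).eq
  have a1 := isEven_laxPower_coeff_zero hU hR m 0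
  have a2 := isEven_laxPower_coeff_zero hU hR n 0
  have e1 := isEven_laxPower_coeff_three hU hR m (-1)
  have e2 := isEven_laxPower_coeff_three hU hR n (-1)
  have d1 : δ.toFun (flow U R n) = -(timeDeriv δ (laxPower U R n)).coeff 0 0 := by
    rw [flow, map_neg, timeDeriv_coeff]
  have d2 : ε.toFun (flow U R m) = -(timeDeriv ε (laxPower U R m)).coeff 0 0 := by
    rw [flow, map_neg, timeDeriv_coeff]
  rw [d1, d2, h1, h2]
  generalize laxPower U R m = P at *
  generalize laxPower U R n = Q at *
  have hM : (P - ge1 P) * (Q - ge1 Q) - (Q - ge1 Q) * (P - ge1 P) ∈ ordLE A (-1) :=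
    commutator_mem_of_sub_mem (sub_ge1_mem P) (symbol_mem (Q.coeff 0 0) (Q.coeff (-1) 3))
      (ordLE_mono (by norm_num) (sub_ge1_symbol P)) (ordLE_mono (by norm_num) (sub_ge1_symbol Q))
      (symbol_mul_commutator_mem a1 e1 a2 e2)
  have hB : ge1 P * ge1 Q - ge1 Q * ge1 P ∈ diffOps₀ A :=
    sub_mem (mul_mem_diffOps₀ (ge1_mem P).1 (ge1_mem Q)) (mul_mem_diffOps₀ (ge1_mem Q).1 (ge1_mem P))
  -- Zero-curvature identity: expand `[P, Q]` after splitting both operators into the part kept by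
  -- the projection and the rest. The three brackets on the right have no multiplication term: the
  -- first kills constants, the second has negative order, and the last is zero.
  have key : (ge1 P * Q - Q * ge1 P) - (ge1 Q * P - P * ge1 Q)
      = (ge1 P * ge1 Q - ge1 Q * ge1 P)
        - ((P - ge1 P) * (Q - ge1 Q) - (Q - ge1 Q) * (P - ge1 P)) + (P * Q - Q * P) := by
    noncomm_ring
  have h := congrArg (fun X : SPDO A => X.coeff 0 0) key
  rw [hc, sub_self, add_zero, sub_coeff _ _ 0 0, sub_coeff _ (_ - _) 0 0, hB.2,
    hM 0 0 (by simp), sub_zero, sub_eq_zero] at h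
  rw [h]

end Commute

/-! ### Naturality of the flows under homomorphisms. -/

section Natural

variable {B : Type*} [Ring B] [Algebra ℂ B] [N2Algebra B] {φ : A →ₐ[ℂ] B}

lemma mapCoeff_laxK (hφ : IsSuperHom φ) (U : A) : mapCoeff φ (laxK U) = laxK (φ U) := by
  have h : ∀ s, mapCoeff φ (opD s) = opD s := fun s => by
    rw [opD, mapCoeff_mono, map_one, opD]
  rw [laxK_eq, laxK_eq, map_add, map_sub, mapCoeff_C_mul, mapCoeff_C_mul, ← opD_one, ← opD_two, h, h,
    h, hφ.map_D₁, hφ.map_D₂]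
  rfl

lemma isSqrt_mapCoeff (hφ : IsSuperHom φ) (hR : IsSqrt R (laxL U)) :
    IsSqrt (mapCoeff φ R) (laxL (φ U)) := by
  obtain ⟨h1, h2⟩ := isSqrt_iff.1 hR
  refine isSqrt_iff.2 ⟨?_, ?_⟩
  · rw [← mapCoeff_mul hφ, h1, laxL, map_neg, mapCoeff_mul hφ, mapCoeff_laxK hφ, laxL]
  · have h := mapCoeff_mem φ h2
    rwa [map_sub, dyPow, mapCoeff_mono, map_one] at h

/-- Every ingredient of the flow is natural. Together with `isSqrt_mapCoeff` this makes the flow at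
a superfield the evaluation of one universal superpolynomial. -/
lemma map_flow (hφ : IsSuperHom φ) (n : ℕ) :
    φ (flow U R n) = flow (φ U) (mapCoeff φ R) n := by
  have hH : mapCoeff φ (laxHat U) = laxHat (φ U) := by
    rw [laxHat, mapCoeff_C_mul, AlgHom.commutes, mapCoeff_laxK hφ, laxHat]
  have hp : ∀ k : ℕ, mapCoeff φ (laxHat U ^ k) = laxHat (φ U) ^ k := by
    intro k
    induction k with
    | zero =>
      rw [pow_zero, pow_zero, one_def, mapCoeff_mono, map_one]
      rfl
    | succ k ih => rw [pow_succ, mapCoeff_mul hφ, ih, hH, pow_succ]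
  have h : mapCoeff φ (laxPower U R n) = laxPower (φ U) (mapCoeff φ R) n := by
    rw [laxPower, mapCoeff_mul hφ, hp, laxPower]
  rw [flow, flow, ← h, map_neg, mapCoeff_coeff]

end Natural

end

end Lax

/-! ### Derivatives of a superfield as values of the free generators. -/

namespace N2Algebra

noncomputable section

variable {A : Type*} [Ring A] [Algebra ℂ A] [N2Algebra A]

/-- Homogeneous elements supercommute. -/
lemma supercomm {a b : A} (s t : Fin 4) (ha : parity a = FreeN2.sgn s • a)
    (hb : parity b = FreeN2.sgn t • b) : a * b = FreeN2.comsgn s t • (b * a) := by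
  have he : ∀ {c : A}, parity c = (1 : ℂ) • c → ∀ d, c * d = (1 : ℂ) • (d * c) := fun h d => by
    rw [one_smul] at h ⊢
    exact even_comm _ d h
  have he' : ∀ {c : A}, parity c = (1 : ℂ) • c → ∀ d, d * c = (1 : ℂ) • (c * d) := fun h d => by
    rw [one_smul] at h ⊢
    exact (even_comm _ d h).symm
  have ho : ∀ {c d : A}, parity c = (-1 : ℂ) • c → parity d = (-1 : ℂ) • d →
      c * d = (-1 : ℂ) • (d * c) := fun h h' => by
    rw [neg_one_smul] at h h' ⊢
    exact odd_anticomm _ _ h h'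
  revert s t
  refine SPDO.forall_fin_four ?_ ?_ ?_ ?_ <;> refine SPDO.forall_fin_four ?_ ?_ ?_ ?_ <;>
    intro ha hb <;>
    first
    | exact he ha b
    | exact he' hb a
    | exact ho ha hb

/-- The derivative `∂_y ^ k D^s U`. -/
def genVal (U : A) (x : Fin 4 × ℕ) : A := dy^[x.2] (![U, D₁ U, D₂ U, D₁ (D₂ U)] x.1)

lemma parity_iterate_dy (k : ℕ) (a : A) : parity (dy^[k] a) = dy^[k] (parity a) := by
  induction k generalizing a with
  | zero => rfl
  | succ k ih => rw [Function.iterate_succ_apply, ih, parity_dy, Function.iterate_succ_apply]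

lemma D₁_iterate_dy (k : ℕ) (a : A) : D₁ (dy^[k] a) = dy^[k] (D₁ a) := by
  induction k generalizing a with
  | zero => rfl
  | succ k ih => rw [Function.iterate_succ_apply, ih, D₁_dy, Function.iterate_succ_apply]

lemma D₂_iterate_dy (k : ℕ) (a : A) : D₂ (dy^[k] a) = dy^[k] (D₂ a) := by
  induction k generalizing a with
  | zero => rfl
  | succ k ih => rw [Function.iterate_succ_apply, ih, D₂_dy, Function.iterate_succ_apply]

lemma iterate_dy_smul (k : ℕ) (c : ℂ) (a : A) : dy^[k] (c • a) = c • dy^[k] a := by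
  rw [dy_iterate, map_smul, dy_iterate]

lemma parity_genVal {U : A} (hU : IsEven U) (x : Fin 4 × ℕ) :
    parity (genVal U x) = FreeN2.sgn x.1 • genVal U x := by
  obtain ⟨s, k⟩ := x
  have h1 : parity (D₁ U) = -D₁ U := hU.D₁
  have h2 : parity (D₂ U) = -D₂ U := hU.D₂
  have h3 : parity (D₁ (D₂ U)) = D₁ (D₂ U) := hU.D₂.D₁
  have h0 : parity U = U := hU
  rw [genVal, parity_iterate_dy, ← iterate_dy_smul]
  congr 1
  revert s
  refine SPDO.forall_fin_four ?_ ?_ ?_ ?_ <;> simp [FreeN2.sgn, h0, h1, h2, h3]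

lemma D₁_genVal (U : A) (x : Fin 4 × ℕ) : D₁ (genVal U x)
    = genVal U ((![1, 0, 3, 2] : Fin 4 → Fin 4) x.1, x.2 + (![0, 1, 0, 1] : Fin 4 → ℕ) x.1) := by
  obtain ⟨s, k⟩ := x
  rw [genVal, genVal, D₁_iterate_dy]
  simp only
  rw [Function.iterate_add_apply]
  congr 1
  revert s
  refine SPDO.forall_fin_four ?_ ?_ ?_ ?_ <;> simp [D₁_D₁]

lemma D₂_genVal (U : A) (x : Fin 4 × ℕ) : D₂ (genVal U x) = (![1, -1, 1, -1] : Fin 4 → ℂ) x.1 •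
    genVal U ((![2, 3, 0, 1] : Fin 4 → Fin 4) x.1, x.2 + (![0, 0, 1, 1] : Fin 4 → ℕ) x.1) := by
  obtain ⟨s, k⟩ := x
  rw [genVal, genVal, D₂_iterate_dy, ← iterate_dy_smul]
  simp only
  rw [Function.iterate_add_apply]
  congr 1
  revert s
  refine SPDO.forall_fin_four ?_ ?_ ?_ ?_ <;> simp [D₂_D₂, D₂_D₁, D₁_dy, dy_neg]

end

end N2Algebra

/-! ### Evaluation of differential superpolynomials. -/

namespace FreeN2

noncomputable section

lemma parity_eq (a : FreeN2) : parity a = par a := rfl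

lemma D₁_gen (x : Fin 4 × ℕ) : D₁ (gen x) = d₁ x := der_gen d₁ hd₁ x

lemma D₂_gen (x : Fin 4 × ℕ) : D₂ (gen x) = d₂ x := der_gen d₂ hd₂ x

lemma dy_gen (x : Fin 4 × ℕ) : dy (gen x) = gen (x.1, x.2 + 1) := by
  obtain ⟨s, k⟩ := x
  rw [dy, D₁_gen, d₁, D₁_gen, d₁]
  revert s
  refine SPDO.forall_fin_four ?_ ?_ ?_ ?_ <;> simp

lemma gen_eq_genVal (x : Fin 4 × ℕ) : gen x = genVal U x := by
  obtain ⟨s, k⟩ := x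
  induction k with
  | zero =>
    revert s
    refine SPDO.forall_fin_four ?_ ?_ ?_ ?_ <;> simp [genVal, U, D₁_gen, D₂_gen, d₁, d₂]
  | succ k ih =>
    rw [genVal, Function.iterate_succ_apply']
    exact (dy_gen (s, k)).symm.trans (congrArg dy ih)

lemma isEven_U : IsEven U := by
  rw [IsEven, parity_eq, U, par_gen]
  simp [sgn]

section Eval

variable {A : Type*} [Ring A] [Algebra ℂ A] [N2Algebra A]

/-- Evaluation of differential superpolynomials at an even superfield. -/
def eval (V : A) (hV : IsEven V) : FreeN2 →ₐ[ℂ] A := lift (genVal V) fun x y =>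
  supercomm x.1 y.1 (parity_genVal hV x) (parity_genVal hV y)

lemma eval_gen (V : A) (hV : IsEven V) (x : Fin 4 × ℕ) : eval V hV (gen x) = genVal V x :=
  lift_gen _ _ x

lemma eval_U (V : A) (hV : IsEven V) : eval V hV U = V := eval_gen V hV _

lemma eval_isSuperHom (V : A) (hV : IsEven V) : IsSuperHom (eval V hV) := by
  have hp : ∀ a, eval V hV (parity a) = parity (eval V hV a) := fun a => by
    induction a using induction with
    | h1 c => simp
    | h2 x => rw [parity_eq, par_gen, map_smul, eval_gen, parity_genVal hV]
    | h3 a b ha hb => rw [map_mul, map_mul, ha, hb, map_mul, map_mul]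
    | h4 a b ha hb => rw [map_add, map_add, ha, hb, map_add, map_add]
  refine ⟨hp, fun a => ?_, fun a => ?_⟩
  · induction a using induction with
    | h1 c => rw [D₁_algebraMap, map_zero, AlgHom.commutes, D₁_algebraMap]
    | h2 x => rw [D₁_gen, d₁, eval_gen, eval_gen, D₁_genVal]
    | h3 a b ha hb => rw [D₁_mul, map_add, map_mul, map_mul, ha, hb, hp, map_mul, D₁_mul]
    | h4 a b ha hb => rw [map_add, map_add, ha, hb, map_add, map_add]
  · induction a using induction with
    | h1 c => rw [D₂_algebraMap, map_zero, AlgHom.commutes, D₂_algebraMap]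
    | h2 x => rw [D₂_gen, d₂, map_smul, eval_gen, eval_gen, D₂_genVal]
    | h3 a b ha hb => rw [D₂_mul, map_add, map_mul, map_mul, ha, hb, hp, map_mul, D₂_mul]
    | h4 a b ha hb => rw [map_add, map_add, ha, hb, map_add, map_add]

end Eval

/-! ### Twisted derivations of the free algebra. -/

section Twisted

variable (θ : FreeN2 →ₐ[ℂ] FreeN2) (d : Fin 4 × ℕ → FreeN2)
  (hd : ∀ x y, θ (gen x) * d y + d x * gen y = comsgn x.1 y.1 • (θ (gen y) * d x + d y * gen x))

/-- A `θ`-derivation `d` is encoded by the homomorphism `a ↦ !![θ a, d a; 0, a]`. -/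
def twMat : FreeN2 →ₐ[ℂ] Matrix (Fin 2) (Fin 2) FreeN2 :=
  lift (fun x => !![θ (gen x), d x; 0, gen x]) (fun x y => by
    have h1 : θ (gen x) * θ (gen y) = comsgn x.1 y.1 • (θ (gen y) * θ (gen x)) := by
      rw [← map_mul, gen_mul x y, map_smul, map_mul]
    have h3 := gen_mul x y
    have h2 := hd x y
    ext i j
    fin_cases i <;> fin_cases j
    · simpa [Matrix.mul_apply] using h1
    · simpa [Matrix.mul_apply] using h2
    · simp [Matrix.mul_apply]
    · simpa [Matrix.mul_apply] using h3)

/-- The `θ`-derivation with prescribed values on the generators. -/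
def twDer : FreeN2 →ₗ[ℂ] FreeN2 where
  toFun a := twMat θ d hd a 0 1
  map_add' a b := by simp
  map_smul' c a := by simp

lemma twMat_eq (a : FreeN2) : twMat θ d hd a = !![θ a, twDer θ d hd a; 0, a] := by
  have h : twMat θ d hd a 0 0 = θ a ∧ twMat θ d hd a 1 0 = 0 ∧ twMat θ d hd a 1 1 = a := by
    induction a using induction with
    | h1 c => simp [Matrix.algebraMap_matrix_apply]
    | h2 x => simp [twMat, lift_gen]
    | h3 a b ha hb => simp [Matrix.mul_apply, ha, hb]
    | h4 a b ha hb => simp [ha, hb]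
  ext i j
  fin_cases i <;> fin_cases j
  · simpa using h.1
  · rfl
  · simpa using h.2.1
  · simpa using h.2.2

lemma twDer_gen (x : Fin 4 × ℕ) : twDer θ d hd (gen x) = d x := by
  simp [twDer, twMat, lift_gen]

lemma twDer_algebraMap (c : ℂ) : twDer θ d hd (algebraMap ℂ FreeN2 c) = 0 := by
  simp [twDer, Matrix.algebraMap_matrix_apply]

lemma twDer_mul (a b : FreeN2) :
    twDer θ d hd (a * b) = twDer θ d hd a * b + θ a * twDer θ d hd b := by
  have h : twDer θ d hd (a * b) = (twMat θ d hd a * twMat θ d hd b) 0 1 := by rw [← map_mul]; rfl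
  rw [h, twMat_eq θ d hd a, twMat_eq θ d hd b]
  simp [Matrix.mul_apply, add_comm]

end Twisted

/-! ### Evolutionary vector fields. -/

section Evolutionary

variable (F : FreeN2) (hF : IsEven F)

lemma parity_gen (x : Fin 4 × ℕ) : parity (gen x) = sgn x.1 • gen x := par_gen x

/-- The evolutionary vector field with characteristic `F`. -/
def evol : FreeN2 →ₗ[ℂ] FreeN2 := twDer (AlgHom.id ℂ FreeN2) (genVal F) fun x y => by
  have h1 := supercomm x.1 y.1 (parity_gen x) (parity_genVal hF y)
  have h2 := supercomm x.1 y.1 (parity_genVal hF x) (parity_gen y)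
  rw [AlgHom.id_apply, AlgHom.id_apply, h1, h2, ← smul_add, add_comm]

lemma evol_gen (x : Fin 4 × ℕ) : evol F hF (gen x) = genVal F x := twDer_gen _ _ _ x

lemma evol_mul (a b : FreeN2) : evol F hF (a * b) = evol F hF a * b + a * evol F hF b :=
  twDer_mul _ _ _ a b

lemma evol_algebraMap (c : ℂ) : evol F hF (algebraMap ℂ FreeN2 c) = 0 := twDer_algebraMap _ _ _ c

/-- The evolutionary vector field with characteristic `F`, as a time derivative. -/
def evolDerivation : TimeDerivation FreeN2 :=
  have hp : ∀ a, evol F hF (parity a) = parity (evol F hF a) := fun a => by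
    induction a using induction with
    | h1 c => rw [AlgHom.commutes, evol_algebraMap, map_zero]
    | h2 x => rw [parity_gen, map_smul, evol_gen, parity_genVal hF]
    | h3 a b ha hb => rw [map_mul, evol_mul, ha, hb, evol_mul, map_add, map_mul, map_mul]
    | h4 a b ha hb => rw [map_add, map_add, ha, hb, map_add, map_add]
  { toFun := evol F hF
    map_mul := evol_mul F hF
    map_parity := hp
    map_D₁ := fun a => by
      induction a using induction with
      | h1 c => rw [D₁_algebraMap, evol_algebraMap, map_zero, map_zero]
      | h2 x => rw [D₁_gen, d₁, evol_gen, evol_gen, D₁_genVal]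
      | h3 a b ha hb =>
        simp only [D₁_mul, map_add, evol_mul, ha, hb, hp]
        abel
      | h4 a b ha hb => rw [map_add, map_add, ha, hb, map_add, map_add]
    map_D₂ := fun a => by
      induction a using induction with
      | h1 c => rw [D₂_algebraMap, evol_algebraMap, map_zero, map_zero]
      | h2 x => rw [D₂_gen, d₂, map_smul, evol_gen, evol_gen, D₂_genVal]
      | h3 a b ha hb =>
        simp only [D₂_mul, map_add, evol_mul, ha, hb, hp]
        abel
      | h4 a b ha hb => rw [map_add, map_add, ha, hb, map_add, map_add] }

lemma evolDerivation_U : (evolDerivation F hF).toFun U = F := evol_gen F hF (0, 0)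

lemma timeDerivation_iterate_dy (δ : TimeDerivation FreeN2) (k : ℕ) (a : FreeN2) :
    δ.toFun (dy^[k] a) = dy^[k] (δ.toFun a) := by
  induction k generalizing a with
  | zero => rfl
  | succ k ih =>
    rw [Function.iterate_succ_apply, ih, dy, δ.map_D₁, δ.map_D₁, Function.iterate_succ_apply, dy]

/-- Commuting with `D₁` and `D₂`, a time derivative is determined by its value on `U`; so every time
derivative of the free algebra is evolutionary. -/
lemma timeDerivation_gen (δ : TimeDerivation FreeN2) (x : Fin 4 × ℕ) :
    δ.toFun (gen x) = genVal (δ.toFun U) x := by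
  obtain ⟨s, k⟩ := x
  rw [gen_eq_genVal, genVal, genVal, timeDerivation_iterate_dy]
  congr 1
  revert s
  refine SPDO.forall_fin_four ?_ ?_ ?_ ?_ <;> simp [δ.map_D₁, δ.map_D₂]

/-- Commuting characteristics give commuting vector fields. -/
lemma timeDerivation_comm {δ ε : TimeDerivation FreeN2}
    (h : δ.toFun (ε.toFun U) = ε.toFun (δ.toFun U)) (a : FreeN2) :
    δ.toFun (ε.toFun a) = ε.toFun (δ.toFun a) := by
  induction a using induction with
  | h1 c =>
    simp [Algebra.algebraMap_eq_smul_one, TimeDerivation.map_one]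
  | h2 x =>
    obtain ⟨s, k⟩ := x
    rw [timeDerivation_gen, timeDerivation_gen, genVal, genVal, timeDerivation_iterate_dy,
      timeDerivation_iterate_dy]
    congr 1
    revert s
    refine SPDO.forall_fin_four ?_ ?_ ?_ ?_ <;> simp [δ.map_D₁, δ.map_D₂, ε.map_D₁, ε.map_D₂, h]
  | h3 a b ha hb =>
    simp only [δ.map_mul, ε.map_mul, map_add, ha, hb]
    abel
  | h4 a b ha hb => rw [map_add, map_add, ha, hb, map_add, map_add]

end Evolutionary

/-! ### The kernel of `∂_y` on the free algebra. -/

section Kernel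

/-- The twist of the partial derivative with respect to a generator `∂_y ^ k D^s U`. -/
def twist (s : Fin 4) : FreeN2 →ₐ[ℂ] FreeN2 := if sgn s = 1 then AlgHom.id ℂ FreeN2 else par

lemma twist_gen (s : Fin 4) (x : Fin 4 × ℕ) : twist s (gen x) = comsgn s x.1 • gen x := by
  obtain ⟨t, k⟩ := x
  rw [twist]
  fin_cases s <;> fin_cases t <;> norm_num [sgn, comsgn, par_gen]

lemma comsgn_comm (s t : Fin 4) : comsgn s t = comsgn t s := by
  revert s t
  refine SPDO.forall_fin_four ?_ ?_ ?_ ?_ <;> refine SPDO.forall_fin_four ?_ ?_ ?_ ?_ <;>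
    simp [comsgn]

lemma comsgn_mul_self (s t : Fin 4) : comsgn s t * comsgn s t = 1 := by
  revert s t
  refine SPDO.forall_fin_four ?_ ?_ ?_ ?_ <;> refine SPDO.forall_fin_four ?_ ?_ ?_ ?_ <;>
    simp [comsgn]

/-- The partial derivative with respect to a generator. -/
def pd (z : Fin 4 × ℕ) : FreeN2 →ₗ[ℂ] FreeN2 :=
  twDer (twist z.1) (fun x => if x = z then 1 else 0) fun x y => by
    rw [twist_gen, twist_gen]
    by_cases hx : x = z <;> by_cases hy : y = z
    · subst hx hy
      simp
      rw [smul_smul, comsgn_mul_self, one_smul, add_comm]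
    · subst hx
      simp [hy, smul_smul, comsgn_mul_self]
    · subst hy
      simp [hx, comsgn_comm]
    · simp [hx, hy]

lemma pd_gen (z x : Fin 4 × ℕ) : pd z (gen x) = if x = z then 1 else 0 := twDer_gen _ _ _ x

lemma pd_mul (z : Fin 4 × ℕ) (a b : FreeN2) : pd z (a * b) = pd z a * b + twist z.1 a * pd z b :=
  twDer_mul _ _ _ a b

lemma pd_algebraMap (z : Fin 4 × ℕ) (c : ℂ) : pd z (algebraMap ℂ FreeN2 c) = 0 :=
  twDer_algebraMap _ _ _ c

lemma twist_dy (s : Fin 4) (a : FreeN2) : twist s (dy a) = dy (twist s a) := by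
  rw [twist]
  split_ifs
  · rfl
  · exact parity_dy a

/-- The derivation `∂_y` raises the index of a generator by one, hence `[∂/∂u_{k+1}, ∂_y] = ∂/∂u_k`.
This commutator is again a twisted derivation, and it is checked on generators. -/
lemma pd_dy (s : Fin 4) (k : ℕ) (a : FreeN2) :
    pd (s, k + 1) (dy a) = dy (pd (s, k + 1) a) + pd (s, k) a := by
  induction a using induction with
  | h1 c => simp [dy_algebraMap, pd_algebraMap, dy_zero]
  | h2 x =>
    obtain ⟨t, l⟩ := x
    rw [dy_gen, pd_gen, pd_gen, pd_gen]
    have h : dy (if (t, l) = (s, k + 1) then (1 : FreeN2) else 0) = 0 := by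
      split_ifs
      · exact dy_one
      · exact dy_zero
    rw [h, zero_add]
    simp
  | h3 a b ha hb =>
    simp only [dy_mul, map_add, pd_mul, ha, hb, dy_add, twist_dy, add_mul, mul_add]
    abel
  | h4 a b ha hb =>
    simp only [dy_add, map_add, ha, hb]
    abel

/-- The Euler derivation, which multiplies a monomial by its degree. -/
def euler : FreeN2 →ₗ[ℂ] FreeN2 := twDer (AlgHom.id ℂ FreeN2) gen fun x y => by
  rw [AlgHom.id_apply, AlgHom.id_apply, gen_mul x y, ← smul_add]

lemma euler_gen (x : Fin 4 × ℕ) : euler (gen x) = gen x := twDer_gen _ _ _ x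

lemma euler_mul (a b : FreeN2) : euler (a * b) = euler a * b + a * euler b := twDer_mul _ _ _ a b

lemma euler_algebraMap (c : ℂ) : euler (algebraMap ℂ FreeN2 c) = 0 := twDer_algebraMap _ _ _ c

lemma gen_mul_twist (x : Fin 4 × ℕ) (a : FreeN2) : gen x * twist x.1 a = a * gen x := by
  rw [gen_mul_eq, twist]
  split_ifs
  · rfl
  · rw [par_par]

/-- Euler's formula, and every superpolynomial depends on finitely many generators only. -/
lemma exists_euler_eq (a : FreeN2) : ∃ N : ℕ, ∀ M, N ≤ M →
    (∀ s, pd (s, M) a = 0) ∧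
    euler a = ∑ s : Fin 4, ∑ k ∈ Finset.range M, gen (s, k) * pd (s, k) a := by
  induction a using induction with
  | h1 c => exact ⟨0, fun M _ => by simp [pd_algebraMap, euler_algebraMap]⟩
  | h2 x =>
    obtain ⟨t, l⟩ := x
    refine ⟨l + 1, fun M hM => ⟨fun s => ?_, ?_⟩⟩
    · rw [pd_gen, if_neg]
      simp only [Prod.mk.injEq, not_and]
      omega
    · rw [Finset.sum_eq_single t, Finset.sum_eq_single l]
      · rw [pd_gen, if_pos rfl, mul_one, euler_gen]
      · intro k _ hk
        rw [pd_gen, if_neg (by simpa using hk.symm), mul_zero]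
      · intro h
        exact absurd (Finset.mem_range.2 (by omega)) h
      · intro s _ hs
        refine Finset.sum_eq_zero fun k _ => ?_
        rw [pd_gen, if_neg (by simp [hs.symm]), mul_zero]
      · simp
  | h3 a b ha hb =>
    obtain ⟨N, hN⟩ := ha
    obtain ⟨N', hN'⟩ := hb
    refine ⟨max N N', fun M hM => ?_⟩
    obtain ⟨h1, h2⟩ := hN M (le_trans (le_max_left _ _) hM)
    obtain ⟨h3, h4⟩ := hN' M (le_trans (le_max_right _ _) hM)
    refine ⟨fun s => by rw [pd_mul, h1, h3, zero_mul, mul_zero, add_zero], ?_⟩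
    rw [euler_mul, h2, h4, Finset.sum_mul, Finset.mul_sum, ← Finset.sum_add_distrib]
    refine Finset.sum_congr rfl fun s _ => ?_
    rw [Finset.sum_mul, Finset.mul_sum, ← Finset.sum_add_distrib]
    refine Finset.sum_congr rfl fun k _ => ?_
    rw [pd_mul, mul_add, ← mul_assoc, ← mul_assoc, ← mul_assoc, gen_mul_twist (s, k) a]
  | h4 a b ha hb =>
    obtain ⟨N, hN⟩ := ha
    obtain ⟨N', hN'⟩ := hb
    refine ⟨max N N', fun M hM => ?_⟩
    obtain ⟨h1, h2⟩ := hN M (le_trans (le_max_left _ _) hM)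
    obtain ⟨h3, h4⟩ := hN' M (le_trans (le_max_right _ _) hM)
    refine ⟨fun s => by rw [map_add, h1, h3, add_zero], ?_⟩
    rw [map_add, h2, h4, ← Finset.sum_add_distrib]
    refine Finset.sum_congr rfl fun s _ => ?_
    rw [← Finset.sum_add_distrib]
    refine Finset.sum_congr rfl fun k _ => ?_
    rw [map_add, mul_add]

/-- If `a_y = 0`, then `∂a/∂u_k = -∂_y (∂a/∂u_{k+1})` by `pd_dy`. These derivatives vanish for large
`k`, hence for all `k` by descending induction, and Euler's formula gives the claim. -/
lemma euler_eq_zero_of_dy_eq_zero {a : FreeN2} (ha : dy a = 0) : euler a = 0 := by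
  obtain ⟨N, hN⟩ := exists_euler_eq a
  have h : ∀ (s : Fin 4) (j k : ℕ), N ≤ k + j → pd (s, k) a = 0 := by
    intro s j
    induction j with
    | zero => exact fun k hk => (hN k hk).1 s
    | succ j ih =>
      intro k hk
      have h1 := pd_dy s k a
      rwa [ha, map_zero, ih (k + 1) (by omega), dy_zero, zero_add, eq_comm] at h1
  rw [(hN N le_rfl).2]
  refine Finset.sum_eq_zero fun s _ => Finset.sum_eq_zero fun k _ => ?_
  rw [h s N k (by omega), mul_zero]

open Polynomial in
/-- The scaling homomorphism `U ↦ t U`. -/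
def scale : FreeN2 →ₐ[ℂ] FreeN2[X] := lift (fun x => C (gen x) * X) fun x y => by
  have h : (C (gen x) * X) * (C (gen y) * X) = C (gen x * gen y) * X * X := by
    rw [C_mul, mul_assoc, ← mul_assoc X, X_mul_C, mul_assoc, mul_assoc, mul_assoc]
  have h' : (C (gen y) * X) * (C (gen x) * X) = C (gen y * gen x) * X * X := by
    rw [C_mul, mul_assoc, ← mul_assoc X, X_mul_C, mul_assoc, mul_assoc, mul_assoc]
  rw [h, h', gen_mul x y, ← smul_C, smul_mul_assoc, smul_mul_assoc]

open Polynomial in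
-- Both sides are derivations along `scale`, and on a generator `u` both give `u X`.
lemma derivative_scale (a : FreeN2) : X * derivative (scale a) = scale (euler a) := by
  induction a using induction with
  | h1 c => rw [AlgHom.commutes, euler_algebraMap, map_zero, Polynomial.algebraMap_apply, derivative_C, mul_zero]
  | h2 x =>
    rw [euler_gen, scale, lift_gen, derivative_mul, derivative_C, zero_mul, zero_add, derivative_X,
      mul_one, X_mul_C]
  | h3 a b ha hb =>
    rw [map_mul, derivative_mul, mul_add, ← mul_assoc, ha, ← mul_assoc, X_mul, mul_assoc, hb,
      euler_mul, map_add, map_mul, map_mul]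
  | h4 a b ha hb => rw [map_add, derivative_add, mul_add, ha, hb, map_add, map_add]

open Polynomial in
/-- The constants are the only superpolynomials annihilated by `∂_y`. -/
lemma exists_eq_algebraMap_of_dy_eq_zero {a : FreeN2} (ha : dy a = 0) :
    ∃ c : ℂ, a = algebraMap ℂ FreeN2 c := by
  have h1 := derivative_scale a
  rw [euler_eq_zero_of_dy_eq_zero ha, map_zero] at h1
  have h2 : derivative (scale a) = 0 := by
    ext n
    have := congrArg (fun p : FreeN2[X] => p.coeff (n + 1)) h1
    simpa [coeff_X_mul] using this
  have h3 : ∀ n, (scale a).coeff (n + 1) = 0 := by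
    intro n
    have := congrArg (fun p : FreeN2[X] => p.coeff n) h2
    simp only [coeff_derivative, coeff_zero] at this
    -- The factor `n + 1` is a nonzero complex scalar, so it can be cancelled: a polynomial with
    -- zero derivative is constant.
    have e : (scale a).coeff (n + 1) * ((n : FreeN2) + 1)
        = ((n : ℂ) + 1) • (scale a).coeff (n + 1) := by
      rw [Algebra.smul_def, map_add, map_natCast, map_one]
      exact ((Nat.cast_commute n _).add_left (Commute.one_left _)).symm
    rw [e, smul_eq_zero] at this
    exact this.resolve_left (Nat.cast_add_one_ne_zero n)
  have h4 : scale a = C ((scale a).coeff 0) := by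
    ext n
    rcases n with _ | n
    · rw [coeff_C_zero]
    · rw [h3, coeff_C_succ]
  -- Setting the parameter to `1` returns `b`, and setting it to `0` leaves the complex constant
  -- term. For `a` the two agree, as `scale a` is constant.
  have ev1 : ∀ b : FreeN2, eval₂ (RingHom.id FreeN2) 1 (scale b) = b := by
    have : ∀ b, eval₂RingHom' (RingHom.id FreeN2) 1 (fun _ => Commute.one_right _) (scale b) = b := by
      intro b
      induction b using induction with
      | h1 c => rw [AlgHom.commutes, Polynomial.algebraMap_apply]; simp
      | h2 x => rw [scale, lift_gen, map_mul]; simp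
      | h3 a b ha hb => rw [map_mul, map_mul, ha, hb]
      | h4 a b ha hb => rw [map_add, map_add, ha, hb]
    exact this
  have ev0 : ∀ b : FreeN2, ∃ c : ℂ, (scale b).coeff 0 = algebraMap ℂ FreeN2 c := by
    intro b
    induction b using induction with
    | h1 c => exact ⟨c, by rw [AlgHom.commutes, Polynomial.algebraMap_apply, coeff_C_zero]⟩
    | h2 x => exact ⟨0, by rw [scale, lift_gen, coeff_mul_X_zero, map_zero]⟩
    | h3 a b ha hb =>
      obtain ⟨c, hc⟩ := ha
      obtain ⟨c', hc'⟩ := hb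
      exact ⟨c * c', by rw [map_mul, mul_coeff_zero, hc, hc', map_mul]⟩
    | h4 a b ha hb =>
      obtain ⟨c, hc⟩ := ha
      obtain ⟨c', hc'⟩ := hb
      exact ⟨c + c', by rw [map_add, coeff_add, hc, hc', map_add]⟩
  obtain ⟨c, hc⟩ := ev0 a
  refine ⟨c, ?_⟩
  rw [← ev1 a, h4, eval₂_C, hc]
  rfl

end Kernel

end

end FreeN2

/-! ### The superconformal change of variables. -/

section HarryDym

open SPDO

variable {A : Type*} [Ring A] [Algebra ℂ A] [N2Algebra A] {U K x θ₁ θ₂ : A} {E₁ E₂ : SPDO A}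

lemma isUnit_two_of_complex_algebra : IsUnit (2 : A) := by
  rw [← map_ofNat (algebraMap ℂ A) 2]
  exact (IsUnit.mk0 (2 : ℂ) two_ne_zero).map (algebraMap ℂ A)

lemma IsSuperconformal.D₁_D₂_θ₁ (h : IsSuperconformal x θ₁ θ₂ E₁ E₂) :
    D₁ (D₂ θ₁) = -dy θ₂ := by rw [← neg_eq_iff_eq_neg, ← map_neg, ← h.D₁_θ₂, dy]

lemma IsSuperconformal.D₂_D₁_θ₁ (h : IsSuperconformal x θ₁ θ₂ E₁ E₂) :
    D₂ (D₁ θ₁) = dy θ₂ := by rw [← h.D₂_θ₂, D₂_D₂]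

/-- The logarithmic derivatives of `K = (D₁ θ₁)² + (D₂ θ₁)²`. -/
lemma IsSuperconformal.mul_D_eq (h : IsSuperconformal x θ₁ θ₂ E₁ E₂)
    (hK : K = D₁ θ₁ ^ 2 + D₂ θ₁ ^ 2) (h1 : D₁ K = 2 * K * D₁ U) (h2 : D₂ K = 2 * K * D₂ U) :
    K * D₁ U = D₁ θ₁ * dy θ₁ - D₂ θ₁ * dy θ₂ ∧ K * D₂ U = D₁ θ₁ * dy θ₂ + D₂ θ₁ * dy θ₁ := by
  have ha : parity (D₁ θ₁) = D₁ θ₁ := h.odd_θ₁.D₁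
  have hb : parity (D₂ θ₁) = D₂ θ₁ := h.odd_θ₁.D₂
  refine ⟨isUnit_two_of_complex_algebra.mul_left_cancel ?_,
    isUnit_two_of_complex_algebra.mul_left_cancel ?_⟩
  · rw [← mul_assoc, ← h1, hK, map_add, pow_two, pow_two, D₁_mul, D₁_mul, ha, hb, D₁_D₁,
      h.D₁_D₂_θ₁, ← even_comm _ (dy θ₁) ha, ← even_comm _ (-dy θ₂) hb]
    noncomm_ring
  · rw [← mul_assoc, ← h2, hK, map_add, pow_two, pow_two, D₂_mul, D₂_mul, ha, hb, D₂_D₂,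
      h.D₂_D₁_θ₁, ← even_comm _ (dy θ₂) ha, ← even_comm _ (dy θ₁) hb]
    noncomm_ring

/-- With `a = D₁ θ₁` and `b = D₂ θ₁` the chain rule reads `D₁ = a E₁ - b E₂`, `D₂ = b E₁ + a E₂`.
This even matrix has determinant `K`, and it is inverted by its adjugate. -/
lemma IsSuperconformal.C_mul_eq (h : IsSuperconformal x θ₁ θ₂ E₁ E₂)
    (hK : K = D₁ θ₁ ^ 2 + D₂ θ₁ ^ 2) : C K * E₁ = C (D₁ θ₁) * opD₁ + C (D₂ θ₁) * opD₂ ∧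
      C K * E₂ = C (D₁ θ₁) * opD₂ - C (D₂ θ₁) * opD₁ := by
  have e : C (D₂ θ₁) * C (D₁ θ₁) = C (D₁ θ₁) * C (D₂ θ₁) := by
    rw [← C_mul, ← C_mul, even_comm _ _ h.odd_θ₁.D₂]
  rw [h.chain₁, h.chain₂, h.D₁_θ₂, h.D₂_θ₂, hK, pow_two, pow_two, C_add, C_mul, C_mul, C_neg]
  simp only [mul_add, add_mul, neg_mul, mul_neg, ← mul_assoc, e]
  exact ⟨by abel, by abel⟩

/-- The identity is multiplied by the unit `K`, so that both factors become `K E₁` and `K E₂`.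
Moving `K` past `D_k` produces `-2 D_k U`, and since `a D₁ U + b D₂ U = ∂_y θ₁` the left side
becomes `(a D₁ + b D₂ - 2 ∂_y θ₁)(a D₂ - b D₁)`. -/
lemma IsSuperconformal.C_mul_E₁_mul_E₂ (h : IsSuperconformal x θ₁ θ₂ E₁ E₂)
    (hK : K = D₁ θ₁ ^ 2 + D₂ θ₁ ^ 2) (hKu : IsUnit K) (h1 : D₁ K = 2 * K * D₁ U)
    (h2 : D₂ K = 2 * K * D₂ U) : C K * (E₁ * E₂) = laxK U := by
  obtain ⟨k1, k2⟩ := h.mul_D_eq hK h1 h2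
  obtain ⟨e1, e2⟩ := h.C_mul_eq hK
  have ha : parity (D₁ θ₁) = D₁ θ₁ := h.odd_θ₁.D₁
  have hb : parity (D₂ θ₁) = D₂ θ₁ := h.odd_θ₁.D₂
  have da : D₁ (D₁ θ₁) = dy θ₁ := rfl
  have da' := h.D₂_D₁_θ₁
  have db := h.D₁_D₂_θ₁
  have db' : D₂ (D₂ θ₁) = dy θ₁ := D₂_D₂ θ₁
  generalize D₁ θ₁ = a at *
  generalize D₂ θ₁ = b at *
  generalize dy θ₁ = t₁ at *
  generalize dy θ₂ = t₂ at *
  have hKe : parity K = K := by rw [hK, map_add, map_pow, map_pow, ha, hb]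
  have hab : b * a = a * b := even_comm b a hb
  have ht : a * D₁ U + b * D₂ U = t₁ := by
    refine hKu.mul_left_cancel ?_
    have s1 : K * (a * D₁ U) = a * (K * D₁ U) := by rw [← mul_assoc, even_comm K a hKe, mul_assoc]
    have s2 : K * (b * D₂ U) = b * (K * D₂ U) := by rw [← mul_assoc, even_comm K b hKe, mul_assoc]
    rw [mul_add, s1, s2, k1, k2, hK, mul_add, mul_sub, ← mul_assoc b a, ← mul_assoc a b, hab]
    noncomm_ring
  obtain ⟨u, rfl⟩ := hKu
  have hu : C (↑u⁻¹ : A) * C (u : A) = 1 := by rw [← C_mul, u.inv_mul, C_one]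
  have cancel : ∀ X Y : SPDO A, C (u : A) * X = C (u : A) * Y → X = Y := fun X Y e => by
    rw [← one_mul X, ← hu, mul_assoc, e, ← mul_assoc, hu, one_mul]
  generalize (u : A) = K at *
  have c1 : C K * (opD₁ * E₂) = opD₁ * (C K * E₂) - C (2 * D₁ U) * (C K * E₂) := by
    rw [← mul_assoc opD₁, opD₁_mul_C, h1, hKe, mul_assoc 2 K, even_comm K _ hKe, ← mul_assoc 2,
      C_mul _ K]
    noncomm_ring
  have c2 : C K * (opD₂ * E₂) = opD₂ * (C K * E₂) - C (2 * D₂ U) * (C K * E₂) := by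
    rw [← mul_assoc opD₂, opD₂_mul_C, h2, hKe, mul_assoc 2 K, even_comm K _ hKe, ← mul_assoc 2,
      C_mul _ K]
    noncomm_ring
  have cK : ∀ c : A, C K * C c = C c * C K := fun c => by rw [← C_mul, ← C_mul, even_comm K c hKe]
  have l : C K * (C K * (E₁ * E₂))
      = (C a * opD₁ + C b * opD₂) * (C K * E₂) - C (2 * t₁) * (C K * E₂) := by
    rw [← mul_assoc (C K) E₁, e1, add_mul, mul_add, mul_assoc, mul_assoc, ← mul_assoc (C K), cK,
      ← mul_assoc (C K) (C b), cK, mul_assoc, mul_assoc, c1, c2, ← ht]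
    simp only [C_add, C_mul, two_mul]
    noncomm_ring
  refine cancel _ _ ?_
  rw [l, e2, laxK]
  have p1 : opD₁ * C a = C t₁ + C a * opD₁ := by rw [opD₁_mul_C, da, ha]
  have p2 : opD₁ * C b = C b * opD₁ - C t₂ := by
    rw [opD₁_mul_C, db, hb, C_neg, neg_add_eq_sub]
  have p3 : opD₂ * C a = C t₂ + C a * opD₂ := by rw [opD₂_mul_C, da', ha]
  have p4 : opD₂ * C b = C t₁ + C b * opD₂ := by rw [opD₂_mul_C, db', hb]
  have q : (C a * opD₁ + C b * opD₂) * (C a * opD₂ - C b * opD₁)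
      = C K * (opD₁ * opD₂) + C (a * t₁ + b * t₂) * opD₂ + C (a * t₂ - b * t₁) * opD₁ := by
    have : (C a * opD₁ + C b * opD₂) * (C a * opD₂ - C b * opD₁)
        = C a * (opD₁ * C a) * opD₂ - C a * (opD₁ * C b) * opD₁ + C b * (opD₂ * C a) * opD₂
          - C b * (opD₂ * C b) * opD₁ := by noncomm_ring
    rw [this, p1, p2, p3, p4, hK]
    simp only [C_add, C_sub, C_mul, pow_two, mul_add, add_mul, mul_sub, sub_mul, mul_assoc,
      opD₁_mul_opD₁, opD₂_mul_opD₂, opD₂_mul_opD₁, mul_neg]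
    rw [← mul_assoc (C b) (C a), ← C_mul, hab, C_mul, mul_assoc]
    abel
  have r : C K * (opD₁ * opD₂ + C (D₂ U) * opD₁ - C (D₁ U) * opD₂)
      = C K * (opD₁ * opD₂) + C (a * t₂ + b * t₁) * opD₁ - C (a * t₁ - b * t₂) * opD₂ := by
    rw [← k1, ← k2, C_mul, C_mul]
    noncomm_ring
  have w : C (2 * t₁) * (C a * opD₂ - C b * opD₁)
      = C (2 * (a * t₁)) * opD₂ - C (2 * (b * t₁)) * opD₁ := by
    rw [even_comm a t₁ ha, even_comm b t₁ hb, ← mul_assoc, ← mul_assoc, C_mul (2 * t₁),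
      C_mul (2 * t₁)]
    noncomm_ring
  rw [q, r, w]
  simp only [two_mul, C_add, C_sub]
  noncomm_ring

/-- The superconformal change of variables maps the Harry Dym operator to `L_{1m}`. -/
lemma harryDymL_eq_laxL (h : IsSuperconformal x θ₁ θ₂ E₁ E₂) (hK : K = D₁ θ₁ ^ 2 + D₂ θ₁ ^ 2)
    (hKu : IsUnit K) (h1 : D₁ K = 2 * K * D₁ U) (h2 : D₂ K = 2 * K * D₂ U) :
    harryDymL K E₁ E₂ = laxL U := by
  rw [harryDymL, h.C_mul_E₁_mul_E₂ hK hKu h1 h2, laxL]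

end HarryDym

/-! ### The Miura map to SKdV. -/

section Miura

variable {A : Type*} [Ring A] [Algebra ℂ A] [N2Algebra A]

/-- The even elements act as scalars from a commutative ring. -/
lemma N2Algebra.exists_even_scalars.{u} (A : Type u) [Ring A] [Algebra ℂ A] [N2Algebra A] :
    ∃ (Z : Type u) (_ : CommRing Z) (_ : Algebra Z A), ∀ a : A, IsEven a → ∃ z : Z, a = z • 1 :=
  ⟨Subalgebra.center ℂ A, inferInstance,
    (Subalgebra.center ℂ A).val.toRingHom.toAlgebra' fun c x =>
      (Subalgebra.mem_center_iff.1 c.2 x).symm, fun a ha =>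
    ⟨⟨a, Subalgebra.mem_center_iff.2 fun b => (even_comm a b ha).symm⟩, (mul_one a).symm⟩⟩

lemma ofNat_mul_eq_smul (n : ℕ) [n.AtLeastTwo] (a : A) :
    (ofNat(n) : A) * a = (ofNat(n) : ℂ) • a := by
  rw [Algebra.smul_def, map_ofNat]

set_option maxHeartbeats 1000000 in
-- Both sides are superpolynomials in derivatives of `U` and agree after normalization: even
-- derivatives become central scalars, odd ones are sorted by anticommutation, and a linear identity
-- over the scalars remains.
lemma miura_flow_two {U : A} {ε : TimeDerivation A} (hU : IsEven U) (hε : ε.toFun U = mkdvFlow₂ U) :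
    ε.toFun (miura U) = skdv 4 (miura U) := by
  have e0 : parity U = U := hU
  have e1 : parity (D₁ U) = -D₁ U := hU.D₁
  have e2 : parity (D₂ U) = -D₂ U := hU.D₂
  have e3 : parity (D₁ (D₂ U)) = D₁ (D₂ U) := hU.D₂.D₁
  have l : ε.toFun (miura U) = D₁ (D₂ (mkdvFlow₂ U)) + D₂ (mkdvFlow₂ U) * D₁ U
      + D₂ U * D₁ (mkdvFlow₂ U) := by
    rw [miura, map_add, ε.map_mul, ε.map_D₁, ε.map_D₂, ε.map_D₁, hε, add_assoc]
  rw [l, mkdvFlow₂, skdv]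
  simp only [map_smul, smul_mul_assoc, mul_smul_comm, ← smul_add]
  congr 1
  have sq : ∀ Φ : A, IsEven Φ → D₁ (D₂ (Φ ^ 2)) = (2 : ℂ) • (Φ * D₁ (D₂ Φ) + D₁ Φ * D₂ Φ) := by
    intro Φ hΦ
    have h1 : parity Φ = Φ := hΦ
    have h2 : D₂ Φ * Φ = Φ * D₂ Φ := (even_comm _ _ hΦ).symm
    rw [pow_two, D₂_mul, h1, h2, ← two_smul ℂ, map_smul, D₁_mul, h1, add_comm]
  have hm : IsEven (miura U) := hU.D₂.D₁.add (hU.D₂.mul hU.D₁)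
  rw [sq _ hm, dy_smul, smul_smul, show ((4 - 1) / 2 * 2 : ℂ) = 3 by norm_num,
    show (3 * 4 : ℂ) = 12 by norm_num, miura]
  simp only [mul_assoc, ofNat_mul_eq_smul, pow_succ, pow_zero, one_mul, D₁_mul, D₂_mul, dy_mul, map_add, map_sub, map_neg,
    map_smul, dy_add, dy_neg, map_mul, parity_dy, D₁_dy, D₂_dy, D₂_D₁, D₂_D₂, D₁_D₁,
    e0, e1, e2, e3, neg_neg, smul_neg, mul_neg, neg_mul]
  -- Indexing the odd derivatives by `Fin 6` provides the order in which `r1` and `r2` sort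
  -- products.
  set o : Fin 6 → A := ![D₁ U, dy (D₁ U), dy (dy (D₁ U)), D₂ U, dy (D₂ U), dy (dy (D₂ U))]
  have o0 : D₁ U = o 0 := rfl
  have o1 : dy (o 0) = o 1 := rfl
  have o2 : dy (o 1) = o 2 := rfl
  have o3 : D₂ U = o 3 := rfl
  have o4 : dy (o 3) = o 4 := rfl
  have o5 : dy (o 4) = o 5 := rfl
  have hodd : ∀ i, IsOdd (o i) := by
    intro i
    fin_cases i
    exacts [hU.D₁, hU.D₁.dy, hU.D₁.dy.dy, hU.D₂, hU.D₂.dy, hU.D₂.dy.dy]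
  obtain ⟨Z, _, _, hZ⟩ := exists_even_scalars A
  obtain ⟨u₁, hu₁⟩ := hZ _ hU.dy
  obtain ⟨u₂, hu₂⟩ := hZ _ hU.dy.dy
  obtain ⟨u₃, hu₃⟩ := hZ _ hU.dy.dy.dy
  obtain ⟨v₀, hv₀⟩ := hZ _ hU.D₂.D₁
  obtain ⟨v₁, hv₁⟩ := hZ _ hU.D₂.D₁.dy
  obtain ⟨v₃, hv₃⟩ := hZ _ hU.D₂.D₁.dy.dy.dy
  rw [hv₃, hv₁, hv₀, hu₃, hu₂, hu₁]
  simp only [o0, o3]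
  simp only [o1, o4]
  simp only [o2, o5]
  clear_value o
  have r1 : ∀ i j, j < i → o i * o j = -(o j * o i) := fun i j _ =>
    odd_anticomm _ _ (hodd i) (hodd j)
  have r2 : ∀ i j, j < i → ∀ x, o i * (o j * x) = -(o j * (o i * x)) := fun i j h x => by
    rw [← mul_assoc, r1 i j h, neg_mul, mul_assoc]
  have r3 : ∀ i, o i * o i = 0 := fun i => (hodd i).mul_self
  have r4 : ∀ i x, o i * (o i * x) = 0 := fun i x => by rw [← mul_assoc, r3, zero_mul]
  simp only [smul_mul_assoc, mul_smul_comm, one_mul, mul_add, add_mul, mul_sub, sub_mul, neg_mul, mul_neg,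
    mul_assoc]
  simp only [mul_one, Fin.isValue, Fin.reduceLT, zero_lt_one, r1, r2, r3, r4, neg_neg, mul_neg, mul_zero, neg_zero,
    smul_zero, add_zero, zero_add, ofNat_smul_eq_nsmul ℂ]
  module

end Miura

/-! ### The complex structure `J` and multiplication terms of operators. -/

namespace SPDO

noncomputable section

variable {A : Type*} [Ring A] [Algebra ℂ A] [N2Algebra A]

/-- The multiplication term of an operator. -/
def constTerm : SPDO A →ₗ[ℂ] A where
  toFun P := P.coeff 0 0
  map_add' _ _ := rfl
  map_smul' _ _ := rfl

lemma constTerm_apply (P : SPDO A) : constTerm P = P.coeff 0 0 := rfl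

lemma constTerm_C_mul (a : A) (P : SPDO A) : constTerm (C a * P) = a * constTerm P := by
  rw [constTerm_apply, C_mul_coeff, constTerm_apply]

lemma constTerm_C (a : A) : constTerm (C a) = a := by
  rw [constTerm_apply, C_coeff, if_pos ⟨rfl, rfl⟩]

lemma constTerm_of_mem {P : SPDO A} (h : P ∈ ordLE A (-1)) : constTerm P = 0 := h 0 0 (by simp)

lemma constTerm_of_mem_diffOps₀ {P : SPDO A} (h : P ∈ diffOps₀ A) : constTerm P = 0 := h.2

/-- The inverse of `gaugeDy`. -/
def gaugeInv (U : A) : SPDO A := ↑(gaugeUnit U)⁻¹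

lemma gaugeDy_mul_gaugeInv (U : A) : gaugeDy U * gaugeInv U = 1 := by
  rw [← gaugeUnit_val, gaugeInv, Units.mul_inv]

lemma gaugeInv_mul_gaugeDy (U : A) : gaugeInv U * gaugeDy U = 1 := by
  rw [← gaugeUnit_val, gaugeInv, Units.inv_mul]

lemma gaugeInv_mem (U : A) : gaugeInv U ∈ ordLE A (-2) := gaugeUnit_inv_mem U

lemma gaugeInv_commute {U : A} {X : SPDO A} (h : Commute (gaugeDy U) X) :
    Commute (gaugeInv U) X := by
  rw [← gaugeUnit_val] at h
  exact h.units_inv_left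

/-- The operator `d₁ d₂ (d₁²)⁻¹`, a complex structure commuting with `gaugeDy`. -/
def gaugeJ (U : A) : SPDO A := gaugeD₁ U * gaugeD₂ U * gaugeInv U

/-- The commutator of `d₁ d₂` with an even superfield. -/
def gaugeComm (U e : A) : SPDO A :=
  C (D₁ e) * gaugeD₂ U - C (D₂ e) * gaugeD₁ U + C (D₁ (D₂ e))

/-- The commutator of `gaugeJ` with a superfield. -/
def gaugeJComm (U e : A) : SPDO A := gaugeJ U * C e - C e * gaugeJ U

section

variable {U e : A}

lemma gaugeDy_mul_C (U e : A) : gaugeDy U * C e = C e * gaugeDy U + (C (dy e) - C (dy U * e - e * dy U)) := by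
  rw [gaugeDy, sub_mul, dyPow_one_mul_C, mul_sub, C_sub, C_mul, C_mul]
  abel

lemma gaugeDy_mul_C_even (he : IsEven e) : gaugeDy U * C e = C e * gaugeDy U + C (dy e) := by
  rw [gaugeDy_mul_C, even_comm e _ he, sub_self, C_zero, sub_zero]

lemma gaugeD₁_commute_gaugeDy (hU : IsEven U) : Commute (gaugeDy U) (gaugeD₁ U) := by
  rw [← gaugeD₁_sq hU]
  exact (Commute.refl _).mul_left (Commute.refl _)

lemma gaugeD₂_commute_gaugeDy (hU : IsEven U) : Commute (gaugeDy U) (gaugeD₂ U) := by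
  rw [← gaugeD₂_sq hU]
  exact (Commute.refl _).mul_left (Commute.refl _)

lemma gaugeJ_commute_gaugeDy (hU : IsEven U) : Commute (gaugeJ U) (gaugeDy U) :=
  ((((gaugeD₁_commute_gaugeDy hU).mul_right (gaugeD₂_commute_gaugeDy hU))).mul_right
    (gaugeInv_commute (Commute.refl _)).symm).symm

lemma gaugeJ_mul_gaugeDy (U : A) : gaugeJ U * gaugeDy U = gaugeD₁ U * gaugeD₂ U := by
  rw [gaugeJ, mul_assoc, gaugeInv_mul_gaugeDy, mul_one]

lemma gaugeDy_mul_gaugeJ (hU : IsEven U) : gaugeDy U * gaugeJ U = gaugeD₁ U * gaugeD₂ U := by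
  rw [← (gaugeJ_commute_gaugeDy hU).eq, gaugeJ_mul_gaugeDy]

lemma gaugeD₁_mul_gaugeD₂_sq (hU : IsEven U) :
    gaugeD₁ U * gaugeD₂ U * (gaugeD₁ U * gaugeD₂ U) = -(gaugeDy U * gaugeDy U) := by
  have h : gaugeD₁ U * gaugeD₂ U * (gaugeD₁ U * gaugeD₂ U)
      = gaugeD₁ U * (gaugeD₂ U * gaugeD₁ U) * gaugeD₂ U := by noncomm_ring
  have h' : gaugeD₁ U * -(gaugeD₁ U * gaugeD₂ U) * gaugeD₂ U
      = -(gaugeD₁ U * gaugeD₁ U * (gaugeD₂ U * gaugeD₂ U)) := by noncomm_ring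
  rw [h, gaugeD₂_mul_gaugeD₁ hU, h', gaugeD₁_sq hU, gaugeD₂_sq hU]

lemma gaugeJ_mul_self (hU : IsEven U) : gaugeJ U * gaugeJ U = -1 := by
  have h : Commute (gaugeInv U) (gaugeD₁ U * gaugeD₂ U) :=
    gaugeInv_commute ((gaugeD₁_commute_gaugeDy hU).mul_right (gaugeD₂_commute_gaugeDy hU))
  have e : gaugeJ U * gaugeJ U
      = gaugeD₁ U * gaugeD₂ U * (gaugeInv U * (gaugeD₁ U * gaugeD₂ U)) * gaugeInv U := by
    rw [gaugeJ]
    noncomm_ring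
  rw [e, h.eq, ← mul_assoc, gaugeD₁_mul_gaugeD₂_sq hU, neg_mul, neg_mul, mul_assoc, mul_assoc,
    ← mul_assoc (gaugeDy U) (gaugeInv U), gaugeDy_mul_gaugeInv, one_mul, gaugeDy_mul_gaugeInv]

lemma gaugeD₁_mul_gaugeD₂_mem (U : A) : gaugeD₁ U * gaugeD₂ U ∈ ordLE A 2 :=
  mul_mem_of_le (gaugeD₁_mem U) (gaugeD₂_mem U) (by norm_num)

lemma gaugeJ_mem (U : A) : gaugeJ U ∈ ordLE A 0 :=
  mul_mem_of_le (gaugeD₁_mul_gaugeD₂_mem U) (gaugeInv_mem U) (by norm_num)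

lemma gaugeComm_mem (U e : A) : gaugeComm U e ∈ ordLE A 1 :=
  add_mem (sub_mem (mul_mem_of_le (C_mem _) (gaugeD₂_mem U) (by norm_num))
    (mul_mem_of_le (C_mem _) (gaugeD₁_mem U) (by norm_num))) (ordLE_mono (by norm_num) (C_mem _))

lemma gaugeD₁_mul_gaugeD₂_mul_C (hU : IsEven U) (he : IsEven e) :
    gaugeD₁ U * gaugeD₂ U * C e = C e * (gaugeD₁ U * gaugeD₂ U) + gaugeComm U e := by
  have h1 : parity e = e := he
  have h2 : parity (D₂ e) = -D₂ e := he.D₂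
  rw [mul_assoc, gaugeD₂_mul_C U hU, h1, mul_add, ← mul_assoc _ (C e), gaugeD₁_mul_C U hU,
    gaugeD₁_mul_C U hU, h1, h2, C_neg, gaugeComm]
  noncomm_ring

/-- From `J p = d₁ d₂` and `[p, e] = e_y`. Multiplying by `p` on the right removes the inverse
hidden in `J`, so multiplication terms can be computed without expanding `p⁻¹`. -/
lemma gaugeJComm_mul_gaugeDy (hU : IsEven U) (he : IsEven e) :
    gaugeJComm U e * gaugeDy U = gaugeComm U e - gaugeJ U * C (dy e) := by
  have h1 : C e * gaugeDy U = gaugeDy U * C e - C (dy e) := by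
    rw [gaugeDy_mul_C_even he, add_sub_cancel_right]
  rw [gaugeJComm, sub_mul, mul_assoc, h1, mul_sub, ← mul_assoc, mul_assoc (C e), gaugeJ_mul_gaugeDy,
    gaugeD₁_mul_gaugeD₂_mul_C hU he]
  abel

lemma gaugeJComm_mem (hU : IsEven U) (he : IsEven e) : gaugeJComm U e ∈ ordLE A (-1) := by
  have h : gaugeJComm U e = (gaugeComm U e - gaugeJ U * C (dy e)) * gaugeInv U := by
    rw [← gaugeJComm_mul_gaugeDy hU he, mul_assoc, gaugeDy_mul_gaugeInv, mul_one]
  rw [h]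
  exact mul_mem_of_le (sub_mem (gaugeComm_mem U e)
    (mul_mem_of_le (gaugeJ_mem U) (C_mem _) (by norm_num))) (gaugeInv_mem U) (by norm_num)

lemma gaugeJ_mul_C (U e : A) : gaugeJ U * C e = C e * gaugeJ U + gaugeJComm U e := by
  rw [gaugeJComm, add_sub_cancel]

lemma gaugeJ_sub_opJ_mem (U : A) : gaugeJ U - opJ ∈ ordLE A (-1) := by
  have h : gaugeJ U - opJ = (gaugeD₁ U - opD₁) * gaugeD₂ U * gaugeInv U
      + opD₁ * (gaugeD₂ U - opD₂) * gaugeInv U + opD₁ * opD₂ * (gaugeInv U - dyPow (-1)) := by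
    rw [gaugeJ, opJ, opD_three]
    noncomm_ring
  have h1 : gaugeD₁ U - opD₁ ∈ ordLE A 0 := by
    rw [gaugeD₁, sub_sub_cancel_left]
    exact neg_mem (C_mem _)
  have h2 : gaugeD₂ U - opD₂ ∈ ordLE A 0 := by
    rw [gaugeD₂, sub_sub_cancel_left]
    exact neg_mem (C_mem _)
  rw [h]
  refine add_mem (add_mem ?_ ?_) ?_
  · exact mul_mem_of_le (mul_mem h1 (gaugeD₂_mem U)) (gaugeInv_mem U) (by norm_num)
  · exact mul_mem_of_le (mul_mem opD₁_mem h2) (gaugeInv_mem U) (by norm_num)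
  · exact mul_mem_of_le (mul_mem opD₁_mem opD₂_mem) (gaugeUnit_inv U) (by norm_num)

lemma constTerm_gaugeJ (U : A) : constTerm (gaugeJ U) = 0 := by
  rw [← sub_add_cancel (gaugeJ U) opJ, map_add, constTerm_of_mem (gaugeJ_sub_opJ_mem U), opJ,
    constTerm_apply, mul_dyPow_coeff, opD, mono_coeff]
  simp

lemma constTerm_gaugeD₁ (U : A) : constTerm (gaugeD₁ U) = -D₁ U := by
  rw [gaugeD₁, map_sub, constTerm_C, constTerm_apply, opD₁, mono_coeff]
  simp

lemma constTerm_gaugeD₂ (U : A) : constTerm (gaugeD₂ U) = -D₂ U := by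
  rw [gaugeD₂, map_sub, constTerm_C, constTerm_apply, opD₂, mono_coeff]
  simp

lemma constTerm_gaugeDy (U : A) : constTerm (gaugeDy U) = -dy U := by
  rw [gaugeDy, map_sub, constTerm_C, constTerm_apply, dyPow, mono_coeff]
  simp

lemma isEven_miura (hU : IsEven U) : IsEven (miura U) := hU.D₂.D₁.add (hU.D₂.mul hU.D₁)

/-- Expanding `d₁ d₂` gives the first-order terms of `K`; the remaining multiplication term is the
Miura superfield. -/
lemma laxK_eq_gauge (hU : IsEven U) : laxK U = gaugeD₁ U * gaugeD₂ U + C (miura U) := by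
  have h2 : parity (D₂ U) = -D₂ U := hU.D₂
  rw [laxK, gaugeD₁, gaugeD₂, miura, sub_mul, mul_sub, mul_sub, opD₁_mul_C, h2,
    odd_anticomm _ _ hU.D₂ hU.D₁]
  simp only [C_add, C_neg, C_mul]
  noncomm_ring

lemma laxK_eq_gaugeJ (hU : IsEven U) : laxK U = gaugeDy U * gaugeJ U + C (miura U) := by
  rw [gaugeDy_mul_gaugeJ hU, laxK_eq_gauge hU]

lemma gaugeJ_mul_laxK (hU : IsEven U) :
    gaugeJ U * laxK U = gaugeJ U * C (miura U) - gaugeDy U := by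
  rw [laxK_eq_gaugeJ hU, mul_add, ← mul_assoc, (gaugeJ_commute_gaugeDy hU).eq, mul_assoc,
    gaugeJ_mul_self hU]
  noncomm_ring

/-- Because `K = d₁ d₂ + Φ` kills constants. -/
lemma constTerm_gaugeD₁_mul_gaugeD₂ (hU : IsEven U) :
    constTerm (gaugeD₁ U * gaugeD₂ U) = -miura U := by
  have h := constTerm_of_mem_diffOps₀ (laxK_mem_diffOps₀ U)
  rw [laxK_eq_gauge hU, map_add, constTerm_C] at h
  exact eq_neg_of_add_eq_zero_left h

lemma constTerm_gaugeJComm (hU : IsEven U) (he : IsEven e) : constTerm (gaugeJComm U e) = 0 :=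
  constTerm_of_mem (gaugeJComm_mem hU he)

lemma constTerm_gaugeJComm_mul (hU : IsEven U) (he : IsEven e) {P : SPDO A} (hP : P ∈ ordLE A 0) :
    constTerm (gaugeJComm U e * P) = 0 :=
  constTerm_of_mem (mul_mem_of_le (gaugeJComm_mem hU he) hP (by norm_num))

lemma constTerm_gaugeJ_mul_C (hU : IsEven U) (he : IsEven e) :
    constTerm (gaugeJ U * C e) = 0 := by
  rw [gaugeJ_mul_C, map_add, constTerm_C_mul, constTerm_gaugeJ, mul_zero,
    constTerm_gaugeJComm hU he, add_zero]

lemma constTerm_gaugeComm (U e : A) :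
    constTerm (gaugeComm U e) = D₁ (D₂ e) - D₁ e * D₂ U + D₂ e * D₁ U := by
  rw [gaugeComm, map_add, map_sub, constTerm_C_mul, constTerm_C_mul, constTerm_C,
    constTerm_gaugeD₁, constTerm_gaugeD₂]
  noncomm_ring

lemma constTerm_gaugeJComm_mul_gaugeDy (hU : IsEven U) (he : IsEven e) :
    constTerm (gaugeJComm U e * gaugeDy U) = constTerm (gaugeComm U e) := by
  rw [gaugeJComm_mul_gaugeDy hU he, map_sub, constTerm_gaugeJ_mul_C hU he.dy, sub_zero]

lemma gaugeJ_mul_C_mul_gaugeJ (hU : IsEven U) :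
    gaugeJ U * C e * gaugeJ U = gaugeJComm U e * gaugeJ U - C e := by
  rw [gaugeJ_mul_C, add_mul, mul_assoc, gaugeJ_mul_self hU]
  noncomm_ring

lemma gaugeComm_mul_gaugeJ (hU : IsEven U) : gaugeComm U e * gaugeJ U
    = C (D₁ (D₂ e)) * gaugeJ U - C (D₁ e) * gaugeD₁ U - C (D₂ e) * gaugeD₂ U := by
  have h1 : gaugeD₁ U * gaugeJ U = gaugeD₂ U := by
    rw [gaugeJ, ← mul_assoc, ← mul_assoc, gaugeD₁_sq hU, (gaugeD₂_commute_gaugeDy hU).eq, mul_assoc,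
      gaugeDy_mul_gaugeInv, mul_one]
  have h2 : gaugeD₂ U * gaugeJ U = -gaugeD₁ U := by
    rw [gaugeJ, ← mul_assoc, ← mul_assoc, gaugeD₂_mul_gaugeD₁ hU, neg_mul, mul_assoc (gaugeD₁ U),
      gaugeD₂_sq hU, neg_mul, mul_assoc, gaugeDy_mul_gaugeInv, mul_one]
  rw [gaugeComm, add_mul, sub_mul, mul_assoc, mul_assoc, h1, h2]
  noncomm_ring

lemma gaugeJComm_mul_laxK (hU : IsEven U) (he : IsEven e) : gaugeJComm U e * laxK U
    = gaugeComm U e * gaugeJ U - gaugeJ U * C (dy e) * gaugeJ U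
      + gaugeJComm U e * C (miura U) := by
  rw [laxK_eq_gaugeJ hU, mul_add, ← mul_assoc, gaugeJComm_mul_gaugeDy hU he, sub_mul]

lemma constTerm_gaugeComm_mul_gaugeJ (hU : IsEven U) : constTerm (gaugeComm U e * gaugeJ U)
    = D₁ e * D₁ U + D₂ e * D₂ U := by
  rw [gaugeComm_mul_gaugeJ hU, map_sub, map_sub, constTerm_C_mul, constTerm_C_mul, constTerm_C_mul,
    constTerm_gaugeD₁, constTerm_gaugeD₂, constTerm_gaugeJ]
  noncomm_ring

lemma constTerm_gaugeJComm_mul_laxK (hU : IsEven U) (he : IsEven e) :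
    constTerm (gaugeJComm U e * laxK U) = dy e + D₁ e * D₁ U + D₂ e * D₂ U := by
  rw [gaugeJComm_mul_laxK hU he, map_add, map_sub, constTerm_gaugeJComm_mul hU he (C_mem _),
    constTerm_gaugeComm_mul_gaugeJ hU, gaugeJ_mul_C_mul_gaugeJ hU, map_sub,
    constTerm_gaugeJComm_mul hU he.dy (gaugeJ_mem U), constTerm_C]
  abel

lemma constTerm_gaugeJ_mul_laxK (hU : IsEven U) : constTerm (gaugeJ U * laxK U) = dy U := by
  rw [gaugeJ_mul_laxK hU, map_sub, constTerm_gaugeJ_mul_C hU (isEven_miura hU), constTerm_gaugeDy,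
    zero_sub, neg_neg]

lemma constTerm_gaugeJ_mul_C_mul_laxK (hU : IsEven U) (he : IsEven e) :
    constTerm (gaugeJ U * C e * laxK U) = e * dy U + (dy e + D₁ e * D₁ U + D₂ e * D₂ U) := by
  rw [gaugeJ_mul_C, add_mul, map_add, mul_assoc, constTerm_C_mul, constTerm_gaugeJ_mul_laxK hU,
    constTerm_gaugeJComm_mul_laxK hU he]

lemma constTerm_gaugeJ_mul_C_mul_gaugeJ_mul_laxK (hU : IsEven U) (he : IsEven e) :
    constTerm (gaugeJ U * C e * gaugeJ U * laxK U) = -constTerm (gaugeComm U e) := by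
  have h1 : gaugeJ U * C e * gaugeJ U * laxK U
      = gaugeJ U * C e * gaugeJ U * C (miura U) - gaugeJ U * C e * gaugeDy U := by
    rw [mul_assoc, gaugeJ_mul_laxK hU]
    noncomm_ring
  rw [h1, map_sub, gaugeJ_mul_C_mul_gaugeJ hU, sub_mul, map_sub, mul_assoc,
    constTerm_gaugeJComm_mul hU he (mul_mem_of_le (gaugeJ_mem U) (C_mem _) (by norm_num)),
    constTerm_C_mul, constTerm_C, gaugeJ_mul_C, add_mul, map_add, mul_assoc, gaugeJ_mul_gaugeDy,
    constTerm_C_mul, constTerm_gaugeD₁_mul_gaugeD₂ hU, constTerm_gaugeJComm_mul_gaugeDy hU he]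
  noncomm_ring

lemma gaugeInv_commutator_mem (U : A) {k : ℤ} {X : SPDO A} (hX : X ∈ ordLE A k) :
    gaugeInv U * X - X * gaugeInv U ∈ ordLE A (k - 4) := by
  have h : gaugeInv U * X - X * gaugeInv U
      = -(gaugeInv U * (gaugeDy U * X - X * gaugeDy U) * gaugeInv U) := by
    have : gaugeInv U * (gaugeDy U * X - X * gaugeDy U) * gaugeInv U
        = gaugeInv U * gaugeDy U * X * gaugeInv U - gaugeInv U * X * (gaugeDy U * gaugeInv U) := by
      noncomm_ring
    rw [this, gaugeInv_mul_gaugeDy, gaugeDy_mul_gaugeInv]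
    noncomm_ring
  have h' : gaugeDy U * X - X * gaugeDy U ∈ ordLE A k := by
    have e : gaugeDy U * X - X * gaugeDy U
        = (dyPow 1 * X - X * dyPow 1) - (C (dy U) * X - X * C (dy U)) := by
      rw [gaugeDy]
      noncomm_ring
    rw [e]
    exact sub_mem (dyPow_one_commutator_mem hX)
      (sub_mem (mul_mem_of_le (C_mem _) hX (by omega)) (mul_mem_of_le hX (C_mem _) (by omega)))
  rw [h]
  exact neg_mem (mul_mem_of_le (mul_mem (gaugeInv_mem U) h') (gaugeInv_mem U) (by omega))

/-- The leading part of `[d₁ d₂, e]` is `(D₁ e) d₂ - (D₂ e) d₁`. In its square the terms with `(D_k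
e)²` vanish, and the two mixed terms agree and give `-2 (D₁ e)(D₂ e) d₁ d₂`. -/
lemma gaugeComm_mul_self_mem (hU : IsEven U) (he : IsEven e) : gaugeComm U e * gaugeComm U e
    + (2 : ℂ) • (C (D₁ e * D₂ e) * (gaugeD₁ U * gaugeD₂ U)) ∈ ordLE A 1 := by
  have p1 : parity (D₁ e) = -D₁ e := he.D₁
  have p2 : parity (D₂ e) = -D₂ e := he.D₂
  have s1 : C (D₁ e) * C (D₁ e) = 0 := by rw [← C_mul, he.D₁.mul_self, C_zero]
  have s2 : C (D₂ e) * C (D₂ e) = 0 := by rw [← C_mul, he.D₂.mul_self, C_zero]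
  have s3 : C (D₂ e) * C (D₁ e) = -(C (D₁ e) * C (D₂ e)) := by
    rw [← C_mul, odd_anticomm _ _ he.D₂ he.D₁, C_neg, C_mul]
  have q11 := gaugeD₁_mul_C U hU (D₁ e)
  have q12 := gaugeD₁_mul_C U hU (D₂ e)
  have q21 := gaugeD₂_mul_C U hU (D₁ e)
  have q22 := gaugeD₂_mul_C U hU (D₂ e)
  rw [p1, C_neg] at q11 q21
  rw [p2, C_neg] at q12 q22
  have main : (C (D₁ e) * gaugeD₂ U - C (D₂ e) * gaugeD₁ U)
      * (C (D₁ e) * gaugeD₂ U - C (D₂ e) * gaugeD₁ U)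
      + (2 : ℂ) • (C (D₁ e * D₂ e) * (gaugeD₁ U * gaugeD₂ U))
      = C (D₁ e) * C (D₂ (D₁ e)) * gaugeD₂ U - C (D₁ e) * C (D₂ (D₂ e)) * gaugeD₁ U
        - C (D₂ e) * C (D₁ (D₁ e)) * gaugeD₂ U + C (D₂ e) * C (D₁ (D₂ e)) * gaugeD₁ U := by
    have x : (C (D₁ e) * gaugeD₂ U - C (D₂ e) * gaugeD₁ U)
        * (C (D₁ e) * gaugeD₂ U - C (D₂ e) * gaugeD₁ U)
        = C (D₁ e) * (gaugeD₂ U * C (D₁ e)) * gaugeD₂ U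
          - C (D₁ e) * (gaugeD₂ U * C (D₂ e)) * gaugeD₁ U
          - C (D₂ e) * (gaugeD₁ U * C (D₁ e)) * gaugeD₂ U
          + C (D₂ e) * (gaugeD₁ U * C (D₂ e)) * gaugeD₁ U := by noncomm_ring
    rw [x, q11, q12, q21, q22, C_mul]
    simp only [mul_add, add_mul, mul_neg, neg_mul, ← mul_assoc, s1, s2, s3, zero_mul, neg_zero,
      add_zero, neg_neg]
    rw [mul_assoc _ (gaugeD₂ U) (gaugeD₁ U), gaugeD₂_mul_gaugeD₁ hU, two_smul]
    noncomm_ring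
  have w1 : C (D₁ e) * gaugeD₂ U - C (D₂ e) * gaugeD₁ U ∈ ordLE A 1 :=
    sub_mem (mul_mem_of_le (C_mem _) (gaugeD₂_mem U) (by norm_num))
      (mul_mem_of_le (C_mem _) (gaugeD₁_mem U) (by norm_num))
  have w2 : ∀ a b : A, C a * C b * gaugeD₁ U ∈ ordLE A 1 := fun a b =>
    mul_mem_of_le (mul_mem (C_mem _) (C_mem _)) (gaugeD₁_mem U) (by norm_num)
  have w3 : ∀ a b : A, C a * C b * gaugeD₂ U ∈ ordLE A 1 := fun a b =>
    mul_mem_of_le (mul_mem (C_mem _) (C_mem _)) (gaugeD₂_mem U) (by norm_num)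
  have e' : gaugeComm U e * gaugeComm U e
      + (2 : ℂ) • (C (D₁ e * D₂ e) * (gaugeD₁ U * gaugeD₂ U))
      = ((C (D₁ e) * gaugeD₂ U - C (D₂ e) * gaugeD₁ U)
        * (C (D₁ e) * gaugeD₂ U - C (D₂ e) * gaugeD₁ U)
        + (2 : ℂ) • (C (D₁ e * D₂ e) * (gaugeD₁ U * gaugeD₂ U)))
        + (C (D₁ e) * gaugeD₂ U - C (D₂ e) * gaugeD₁ U) * C (D₁ (D₂ e))
        + C (D₁ (D₂ e)) * gaugeComm U e := by
    rw [gaugeComm]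
    noncomm_ring
  rw [e', main]
  exact add_mem (add_mem (add_mem (sub_mem (sub_mem (w3 _ _) (w2 _ _)) (w3 _ _)) (w2 _ _))
    (mul_mem_of_le w1 (C_mem _) (by norm_num)))
    (mul_mem_of_le (C_mem _) (gaugeComm_mem U e) (by norm_num))

/-- Up to negative order the product is `[d₁ d₂, e]² p⁻¹`, hence `-2 (D₁ e)(D₂ e) J`, and `J` has no
multiplication term. -/
lemma constTerm_gaugeJComm_mul_gaugeComm (hU : IsEven U) (he : IsEven e) :
    constTerm (gaugeJComm U e * gaugeComm U e) = 0 := by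
  have h : gaugeJComm U e = (gaugeComm U e - gaugeJ U * C (dy e)) * gaugeInv U := by
    rw [← gaugeJComm_mul_gaugeDy hU he, mul_assoc, gaugeDy_mul_gaugeInv, mul_one]
  have h' : gaugeJComm U e * gaugeComm U e
      = (gaugeComm U e * gaugeComm U e
          + (2 : ℂ) • (C (D₁ e * D₂ e) * (gaugeD₁ U * gaugeD₂ U))) * gaugeInv U
        - (2 : ℂ) • (C (D₁ e * D₂ e) * gaugeJ U)
        + gaugeComm U e * (gaugeInv U * gaugeComm U e - gaugeComm U e * gaugeInv U)
        - gaugeJ U * C (dy e) * (gaugeInv U * gaugeComm U e) := by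
    rw [h, gaugeJ]
    simp only [add_mul, smul_mul_assoc, mul_assoc, sub_mul, mul_sub]
    abel
  rw [h', map_sub, map_add, map_sub, map_smul, constTerm_C_mul, constTerm_gaugeJ, mul_zero,
    smul_zero, constTerm_of_mem (mul_mem_of_le (gaugeComm_mul_self_mem hU he) (gaugeInv_mem U)
      (by norm_num)), constTerm_of_mem (mul_mem_of_le (gaugeComm_mem U e)
      (gaugeInv_commutator_mem U (gaugeComm_mem U e)) (by norm_num)),
    constTerm_of_mem (mul_mem_of_le (mul_mem (gaugeJ_mem U) (C_mem _))
      (mul_mem (gaugeInv_mem U) (gaugeComm_mem U e)) (by norm_num))]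
  simp

end

end

end SPDO

/-- The defect of the approximate square root `p - (f J + J f) / 2` of `-(p J + f)²`. -/
lemma approx_sqrt_sq {S : Type*} [Ring S] [Algebra ℂ S] {p J f : S} (hJ : J * J = -1)
    (hpJ : J * p = p * J) :
    (p - (1 / 2 : ℂ) • (f * J + J * f)) * (p - (1 / 2 : ℂ) • (f * J + J * f))
      = -((p * J + f) * (p * J + f)) + ((1 / 2 : ℂ) • (J * (p * f - f * p) - (p * f - f * p) * J)
        + (1 / 2 : ℂ) • ((f * (J * f - f * J) + (J * f - f * J) * f) * J)
        + (1 / 4 : ℂ) • ((J * f - f * J) * (J * f - f * J))) := by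
  have hJ' : ∀ x, J * (J * x) = -x := fun x => by rw [← mul_assoc, hJ, neg_one_mul]
  have hpJ' : ∀ x, J * (p * x) = p * (J * x) := fun x => by rw [← mul_assoc, hpJ, mul_assoc]
  simp only [mul_add, add_mul, mul_sub, sub_mul, smul_mul_assoc, mul_smul_comm, mul_assoc, hJ, hpJ,
    hJ', hpJ', mul_neg, mul_one, smul_add, smul_sub, smul_smul]
  module

/-! ### Expansion of the square root of the Lax operator. -/

namespace SPDO

noncomputable section

variable {A : Type*} [Ring A] [Algebra ℂ A] [N2Algebra A]

/-- The square root of `laxL U` up to terms of order less than `-1`. -/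
def approxSqrt (U : A) : SPDO A :=
  gaugeDy U - (1 / 2 : ℂ) • (C (miura U) * gaugeJ U + gaugeJ U * C (miura U))

/-- The difference of the square of `approxSqrt U` and `laxL U`. -/
def sqrtDefect (U : A) : SPDO A :=
  (1 / 2 : ℂ) • gaugeJComm U (dy (miura U))
    + (1 / 2 : ℂ) • ((C (miura U) * gaugeJComm U (miura U)
      + gaugeJComm U (miura U) * C (miura U)) * gaugeJ U)
    + (1 / 4 : ℂ) • (gaugeJComm U (miura U) * gaugeJComm U (miura U))

section

variable {U : A} {R : SPDO A}

lemma approxSqrt_sq (hU : IsEven U) :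
    approxSqrt U * approxSqrt U = laxL U + sqrtDefect U := by
  have h : gaugeDy U * C (miura U) - C (miura U) * gaugeDy U = C (dy (miura U)) := by
    rw [gaugeDy_mul_C_even (isEven_miura hU), add_sub_cancel_left]
  rw [approxSqrt, approx_sqrt_sq (gaugeJ_mul_self hU) (gaugeJ_commute_gaugeDy hU).eq, h,
    ← laxK_eq_gaugeJ hU, laxL]
  rfl

lemma sqrtDefect_mem (hU : IsEven U) : sqrtDefect U ∈ ordLE A (-1) := by
  have hφ := isEven_miura hU
  have h := gaugeJComm_mem hU hφ
  exact add_mem (add_mem (smul_mem_ordLE _ (gaugeJComm_mem hU hφ.dy))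
    (smul_mem_ordLE _ (mul_mem_of_le (add_mem (mul_mem_of_le (C_mem _) h (k := -1) (by norm_num))
      (mul_mem_of_le h (C_mem _) (by norm_num))) (gaugeJ_mem U) (by norm_num))))
    (smul_mem_ordLE _ (mul_mem_of_le h h (by norm_num)))

lemma approxSqrt_sub_gaugeDy_mem (U : A) : approxSqrt U - gaugeDy U ∈ ordLE A 0 := by
  rw [approxSqrt, sub_sub_cancel_left]
  exact neg_mem (smul_mem_ordLE _ (add_mem (mul_mem_of_le (C_mem _) (gaugeJ_mem U) (by norm_num))
    (mul_mem_of_le (gaugeJ_mem U) (C_mem _) (by norm_num))))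

lemma approxSqrt_sub_mem (U : A) : approxSqrt U - dyPow 1 ∈ ordLE A 1 := by
  have h := add_mem (approxSqrt_sub_gaugeDy_mem U) (gaugeDy_sub_mem U)
  rw [sub_add_sub_cancel] at h
  exact ordLE_mono (by norm_num) h

lemma sub_mem_of_sq_sub_mem {R Q : SPDO A} (hR : R - dyPow 1 ∈ ordLE A 1)
    (hQ : Q - dyPow 1 ∈ ordLE A 1) {k : ℤ} (h : R * R - Q * Q ∈ ordLE A (k + 2)) :
    R - Q ∈ ordLE A k := by
  refine mem_of_anticomm_mem hR hQ k ?_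
  have e : (R - Q) * R + Q * (R - Q) = R * R - Q * Q := by noncomm_ring
  rwa [e]

/-- The defect of the square has order at most -1/2, and dividing by `2 ∂_y` lowers this to -3/2.
That is enough for the flows `n = 0, 1`, where the root is multiplied by at most one factor `K` of
order 1. -/
lemma sqrt_sub_approxSqrt_mem (hU : IsEven U) (hR : IsSqrt R (laxL U)) :
    R - approxSqrt U ∈ ordLE A (-3) := by
  obtain ⟨h1, h2⟩ := isSqrt_iff.1 hR
  refine sub_mem_of_sq_sub_mem h2 (approxSqrt_sub_mem U) ?_
  rw [h1, approxSqrt_sq hU, sub_add_cancel_left]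
  exact neg_mem (sqrtDefect_mem hU)

/-- One more Newton step, with `p⁻¹` in place of `∂_y⁻¹`. The error is of order at most -5/2, so it
stays negative after multiplication by `K²`, as the flow `n = 2` requires. -/
lemma sqrt_sub_correctedSqrt_mem (hU : IsEven U) (hR : IsSqrt R (laxL U)) :
    R - (approxSqrt U - (1 / 2 : ℂ) • (sqrtDefect U * gaugeInv U)) ∈ ordLE A (-5) := by
  obtain ⟨h1, h2⟩ := isSqrt_iff.1 hR
  have hE := sqrtDefect_mem hU
  have hET : sqrtDefect U * gaugeInv U ∈ ordLE A (-3) :=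
    mul_mem_of_le hE (gaugeInv_mem U) (by norm_num)
  have hq := approxSqrt_sub_gaugeDy_mem U
  have hsq := approxSqrt_sq hU
  have hT1 := gaugeDy_mul_gaugeInv U
  have hT2 := gaugeInv_mul_gaugeDy U
  have hpE := gaugeInv_commutator_mem U hE
  refine sub_mem_of_sq_sub_mem h2 ?_ ?_
  · rw [sub_right_comm]
    exact sub_mem (approxSqrt_sub_mem U) (smul_mem_ordLE _ (ordLE_mono (by norm_num) hET))
  rw [h1]
  generalize sqrtDefect U = E at *
  generalize approxSqrt U = Q at *
  generalize gaugeInv U = T at *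
  have e : laxL U - (Q - (1 / 2 : ℂ) • (E * T)) * (Q - (1 / 2 : ℂ) • (E * T))
      = (1 / 2 : ℂ) • ((Q - gaugeDy U) * (E * T) + E * T * (Q - gaugeDy U)
        + gaugeDy U * (E * T - T * E)) - (1 / 4 : ℂ) • (E * T * (E * T)) := by
    have a1 : laxL U = Q * Q - E := by rw [hsq, add_sub_cancel_right]
    have a2 : gaugeDy U * (T * E) = E := by rw [← mul_assoc, hT1, one_mul]
    have a3 : E * T * gaugeDy U = E := by rw [mul_assoc, hT2, mul_one]
    rw [a1, mul_sub (gaugeDy U), a2, mul_sub (E * T), a3]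
    simp only [mul_sub, sub_mul, smul_mul_assoc, mul_smul_comm, smul_add, smul_sub, smul_smul]
    module
  rw [e]
  refine sub_mem (smul_mem_ordLE _ (add_mem (add_mem ?_ ?_) ?_)) (smul_mem_ordLE _ ?_)
  · exact mul_mem_of_le hq hET (by norm_num)
  · exact mul_mem_of_le hET hq (by norm_num)
  · rw [← neg_sub (T * E), mul_neg]
    exact neg_mem (mul_mem_of_le (gaugeDy_mem U) hpE (by norm_num))
  · exact mul_mem_of_le hET hET (by norm_num)

lemma constTerm_approxSqrt (hU : IsEven U) : constTerm (approxSqrt U) = -dy U := by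
  rw [approxSqrt, map_sub, map_smul, map_add, constTerm_C_mul, constTerm_gaugeJ,
    constTerm_gaugeJ_mul_C hU (isEven_miura hU), constTerm_gaugeDy]
  simp

lemma constTerm_approxSqrt_mul_laxK (hU : IsEven U) : constTerm (approxSqrt U * laxK U)
    = -((1 / 2 : ℂ) • (2 * (miura U * dy U)
      + (dy (miura U) + D₁ (miura U) * D₁ U + D₂ (miura U) * D₂ U))) := by
  rw [approxSqrt, sub_mul, smul_mul_assoc, add_mul, map_sub, map_smul, map_add, mul_assoc,
    constTerm_C_mul, constTerm_gaugeJ_mul_laxK hU, constTerm_gaugeJ_mul_C_mul_laxK hU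
    (isEven_miura hU), constTerm_of_mem_diffOps₀ (mul_mem_diffOps₀ (gaugeDy_mem_diffOps U)
    (laxK_mem_diffOps₀ U)), zero_sub, two_mul]
  simp only [add_assoc]

/-- Moving `Φ` to the right of `K` costs `[d₁ d₂, Φ]`, whose product with `[J, Φ]` has no
multiplication term. Then `[J, Φ] K` is expanded without any inverse of `p`. -/
lemma constTerm_gaugeJComm_mul_C_mul_laxK (hU : IsEven U) :
    constTerm (gaugeJComm U (miura U) * C (miura U) * laxK U)
      = miura U * (dy (miura U) + D₁ (miura U) * D₁ U + D₂ (miura U) * D₂ U) := by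
  have hφ := isEven_miura hU
  have h1 : parity (miura U) = miura U := hφ
  have hc : C (miura U) * laxK U = laxK U * C (miura U) - gaugeComm U (miura U) := by
    rw [laxK_eq_gauge hU, add_mul, gaugeD₁_mul_gaugeD₂_mul_C hU hφ, mul_add]
    abel
  have d1 : constTerm (gaugeD₁ U * C (miura U)) = D₁ (miura U) - miura U * D₁ U := by
    rw [gaugeD₁_mul_C U hU, h1, map_add, constTerm_C, constTerm_C_mul, constTerm_gaugeD₁]
    noncomm_ring
  have d2 : constTerm (gaugeD₂ U * C (miura U)) = D₂ (miura U) - miura U * D₂ U := by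
    rw [gaugeD₂_mul_C U hU, h1, map_add, constTerm_C, constTerm_C_mul, constTerm_gaugeD₂]
    noncomm_ring
  have hg : constTerm (gaugeComm U (miura U) * gaugeJ U * C (miura U))
      = miura U * (D₁ (miura U) * D₁ U + D₂ (miura U) * D₂ U) := by
    rw [gaugeComm_mul_gaugeJ hU, sub_mul, sub_mul, map_sub, map_sub, mul_assoc, mul_assoc, mul_assoc,
      constTerm_C_mul, constTerm_C_mul, constTerm_C_mul, d1, d2, constTerm_gaugeJ_mul_C hU hφ,
      mul_sub, mul_sub, hφ.D₁.mul_self, hφ.D₂.mul_self, ← mul_assoc, ← mul_assoc,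
      ← even_comm _ _ h1, ← even_comm _ (D₂ _) h1]
    noncomm_ring
  rw [mul_assoc, hc, mul_sub, map_sub, constTerm_gaugeJComm_mul_gaugeComm hU hφ, sub_zero, ← mul_assoc,
    gaugeJComm_mul_laxK hU hφ, add_mul, sub_mul, map_add, map_sub, hg, gaugeJ_mul_C_mul_gaugeJ hU,
    sub_mul, map_sub, mul_assoc, constTerm_gaugeJComm_mul hU hφ.dy
      (mul_mem_of_le (gaugeJ_mem U) (C_mem _) (by norm_num)), constTerm_C_mul, constTerm_C, mul_assoc,
    constTerm_gaugeJComm_mul hU hφ (mul_mem_of_le (C_mem _) (C_mem _) (by norm_num)),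
    ← even_comm _ (dy _) h1]
  noncomm_ring

lemma constTerm_gaugeJComm_mul_laxK_sq (hU : IsEven U) :
    constTerm (gaugeJComm U (miura U) * laxK U * laxK U)
      = D₁ (D₂ (miura U)) * dy U + constTerm (gaugeComm U (dy (miura U)))
        + miura U * (dy (miura U) + D₁ (miura U) * D₁ U + D₂ (miura U) * D₂ U) := by
  have hφ := isEven_miura hU
  have hK := laxK_mem_diffOps₀ U
  have h1 : ∀ X : A, constTerm (C X * gaugeD₁ U * laxK U) = 0 := fun X =>
    constTerm_of_mem_diffOps₀ (mul_mem_diffOps₀ (mul_mem_diffOps (C_mem_diffOps X)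
      (gaugeD₁_mem_diffOps U)) hK)
  have h2 : ∀ X : A, constTerm (C X * gaugeD₂ U * laxK U) = 0 := fun X =>
    constTerm_of_mem_diffOps₀ (mul_mem_diffOps₀ (mul_mem_diffOps (C_mem_diffOps X)
      (gaugeD₂_mem_diffOps U)) hK)
  rw [gaugeJComm_mul_laxK hU hφ, add_mul, sub_mul, map_add, map_sub,
    constTerm_gaugeJComm_mul_C_mul_laxK hU, constTerm_gaugeJ_mul_C_mul_gaugeJ_mul_laxK hU hφ.dy,
    gaugeComm_mul_gaugeJ hU, sub_mul, sub_mul, map_sub, map_sub, h1, h2, mul_assoc, constTerm_C_mul,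
    constTerm_gaugeJ_mul_laxK hU]
  abel

/-- The factor `p` absorbs the inverses: `J p = d₁ d₂ = K - Φ`, and `[J, Φ] p` is given by
`gaugeJComm_mul_gaugeDy`, which makes the quadratic term of the defect drop out. -/
lemma constTerm_sqrtDefect_mul_gaugeDy (hU : IsEven U) : constTerm (sqrtDefect U * gaugeDy U)
    = (1 / 2 : ℂ) • constTerm (gaugeComm U (dy (miura U)))
      + miura U * (dy (miura U) + D₁ (miura U) * D₁ U + D₂ (miura U) * D₂ U) := by
  have hφ := isEven_miura hU
  have hd : gaugeD₁ U * gaugeD₂ U = laxK U - C (miura U) := by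
    rw [laxK_eq_gauge hU, add_sub_cancel_right]
  have h1 : constTerm (gaugeJComm U (miura U) * C (miura U) * (gaugeD₁ U * gaugeD₂ U))
      = miura U * (dy (miura U) + D₁ (miura U) * D₁ U + D₂ (miura U) * D₂ U) := by
    rw [hd, mul_sub, map_sub, constTerm_gaugeJComm_mul_C_mul_laxK hU, mul_assoc,
      constTerm_gaugeJComm_mul hU hφ (mul_mem_of_le (C_mem _) (C_mem _) (by norm_num)), sub_zero]
  have h2 : constTerm (gaugeJComm U (miura U) * (gaugeD₁ U * gaugeD₂ U))
      = dy (miura U) + D₁ (miura U) * D₁ U + D₂ (miura U) * D₂ U := by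
    rw [hd, mul_sub, map_sub, constTerm_gaugeJComm_mul_laxK hU hφ,
      constTerm_gaugeJComm_mul hU hφ (C_mem _), sub_zero]
  have h3 : constTerm (gaugeJComm U (miura U) * (gaugeJComm U (miura U) * gaugeDy U)) = 0 := by
    rw [gaugeJComm_mul_gaugeDy hU hφ, mul_sub, map_sub, constTerm_gaugeJComm_mul_gaugeComm hU hφ,
      constTerm_gaugeJComm_mul hU hφ (mul_mem_of_le (gaugeJ_mem U) (C_mem _) (by norm_num)), sub_zero]
  rw [sqrtDefect, add_mul, add_mul, smul_mul_assoc, smul_mul_assoc, smul_mul_assoc, mul_assoc _ (gaugeJ U),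
    gaugeJ_mul_gaugeDy, add_mul, mul_assoc (C _), mul_assoc _ _ (gaugeDy U)]
  simp only [map_add, map_smul, constTerm_C_mul]
  rw [h1, h2, h3, constTerm_gaugeJComm_mul_gaugeDy hU hφ.dy]
  module

/-- As `p⁻¹ K²` is `-p` plus terms of order at most 0, and the defect has negative order, only `-p`
contributes. -/
lemma constTerm_sqrtDefect_mul_gaugeInv_mul_laxK_sq (hU : IsEven U) :
    constTerm (sqrtDefect U * gaugeInv U * laxK U * laxK U)
      = -constTerm (sqrtDefect U * gaugeDy U) := by
  have h : sqrtDefect U * gaugeInv U * laxK U * laxK U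
      = sqrtDefect U * (gaugeJ U * C (miura U) + gaugeInv U * C (miura U) * laxK U)
        - sqrtDefect U * gaugeDy U := by
    have h1 : gaugeInv U * laxK U = gaugeJ U + gaugeInv U * C (miura U) := by
      rw [laxK_eq_gaugeJ hU, mul_add, ← mul_assoc, gaugeInv_mul_gaugeDy, one_mul]
    rw [mul_assoc _ (gaugeInv U), h1, mul_assoc, add_mul, gaugeJ_mul_laxK hU]
    noncomm_ring
  rw [h, map_sub, constTerm_of_mem, zero_sub]
  exact mul_mem_of_le (sqrtDefect_mem hU) (add_mem (mul_mem_of_le (gaugeJ_mem U) (C_mem _)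
    (k := 0) (by norm_num)) (mul_mem_of_le (mul_mem (gaugeInv_mem U) (C_mem _)) (laxK_mem U)
    (by norm_num))) (by norm_num)

lemma constTerm_approxSqrt_mul_laxK_sq (hU : IsEven U) :
    constTerm (approxSqrt U * laxK U * laxK U) = -(miura U * (miura U * dy U
      + (dy (miura U) + D₁ (miura U) * D₁ U + D₂ (miura U) * D₂ U)))
      - (1 / 2 : ℂ) • constTerm (gaugeJComm U (miura U) * laxK U * laxK U) := by
  have hφ := isEven_miura hU
  have hK := laxK_mem_diffOps₀ U
  have h1 : constTerm (gaugeJ U * laxK U * laxK U) = miura U * dy U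
      + (dy (miura U) + D₁ (miura U) * D₁ U + D₂ (miura U) * D₂ U) := by
    rw [gaugeJ_mul_laxK hU, sub_mul, map_sub, constTerm_gaugeJ_mul_C_mul_laxK hU hφ,
      constTerm_of_mem_diffOps₀ (mul_mem_diffOps₀ (gaugeDy_mem_diffOps U) hK), sub_zero]
  have h2 : approxSqrt U * laxK U * laxK U = gaugeDy U * (laxK U * laxK U)
      - C (miura U) * (gaugeJ U * laxK U * laxK U)
      - (1 / 2 : ℂ) • (gaugeJComm U (miura U) * laxK U * laxK U) := by
    rw [approxSqrt, gaugeJ_mul_C]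
    simp only [sub_mul, smul_mul_assoc, add_mul, mul_assoc]
    module
  rw [h2, map_sub, map_sub, map_smul, constTerm_C_mul, h1, constTerm_of_mem_diffOps₀
    (mul_mem_diffOps₀ (gaugeDy_mem_diffOps U) (mul_mem_diffOps₀ hK.1 hK)), zero_sub]

end

end

end SPDO

/-! ### The first flows in terms of the Miura superfield. -/

section Flows

open SPDO

variable {A : Type*} [Ring A] [Algebra ℂ A] [N2Algebra A] {U : A} {R : SPDO A}

/-- The flow `n = 0` is the trivial one. -/
lemma flow_zero (hU : IsEven U) (hR : IsSqrt R (laxL U)) : flow U R 0 = dy U := by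
  have h := constTerm_of_mem (ordLE_mono (by norm_num) (sqrt_sub_approxSqrt_mem hU hR))
  rw [map_sub, sub_eq_zero, constTerm_approxSqrt hU] at h
  rw [flow, laxPower, pow_zero, one_mul, ← constTerm_apply, h, neg_neg]

lemma flow_one_eq_miura (hU : IsEven U) (hR : IsSqrt R (laxL U)) :
    flow U R 1 = (Complex.I / 2 : ℂ) • (2 * (miura U * dy U)
      + (dy (miura U) + D₁ (miura U) * D₁ U + D₂ (miura U) * D₂ U)) := by
  have h := constTerm_of_mem (mul_mem_of_le (sqrt_sub_approxSqrt_mem hU hR) (laxK_mem U)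
    (by norm_num))
  rw [sub_mul, map_sub, sub_eq_zero, constTerm_approxSqrt_mul_laxK hU] at h
  rw [flow, laxPower, pow_one, ← (commute_sqrt_laxHat hR).eq, laxHat_eq, mul_smul_comm,
    ← constTerm_apply, map_smul, h, smul_neg, neg_neg, smul_smul]
  congr 1
  ring

/-- Here `L̂² = -K²`, so the flow is the multiplication term of `R K²`, for which the corrected root
is accurate enough. -/
lemma flow_two_eq_miura (hU : IsEven U) (hR : IsSqrt R (laxL U)) :
    flow U R 2 = -((1 / 4 : ℂ) • (4 * (miura U * (miura U * dy U
      + (dy (miura U) + D₁ (miura U) * D₁ U + D₂ (miura U) * D₂ U)))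
      + 2 * (D₁ (D₂ (miura U)) * dy U)
      + (D₁ (D₂ (dy (miura U))) - D₁ (dy (miura U)) * D₂ U + D₂ (dy (miura U)) * D₁ U))) := by
  have h := constTerm_of_mem (mul_mem_of_le (sqrt_sub_correctedSqrt_mem hU hR)
    (mul_mem (laxK_mem U) (laxK_mem U)) (by norm_num))
  rw [sub_mul, map_sub, sub_eq_zero, sub_mul, smul_mul_assoc, map_sub, map_smul, ← mul_assoc,
    ← mul_assoc _ (laxK U), ← mul_assoc _ (laxK U), constTerm_approxSqrt_mul_laxK_sq hU,
    constTerm_sqrtDefect_mul_gaugeInv_mul_laxK_sq hU, constTerm_sqrtDefect_mul_gaugeDy hU,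
    constTerm_gaugeJComm_mul_laxK_sq hU, constTerm_gaugeComm] at h
  have hc : laxHat U ^ 2 * R = -(R * laxK U * laxK U) := by
    rw [← ((commute_sqrt_laxHat hR).pow_right 2).eq, pow_two, laxHat_sq, laxL, mul_neg, mul_assoc]
  rw [flow, laxPower, hc, ← constTerm_apply, map_neg, h, ofNat_mul_eq_smul, ofNat_mul_eq_smul]
  simp only [mul_add]
  module

end Flows

/-! ### The first flows in terms of `U`. -/

section ExplicitFlows

open SPDO

variable {A : Type*} [Ring A] [Algebra ℂ A] [N2Algebra A] {U : A} {R : SPDO A}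

/-- The first non-trivial flow. -/
lemma flow_one (hU : IsEven U) (hR : IsSqrt R (laxL U)) : flow U R 1 = mkdvFlow₁ U := by
  have e2 : parity (D₂ U) = -D₂ U := hU.D₂
  rw [flow_one_eq_miura hU hR, mkdvFlow₁, miura]
  congr 1
  simp only [ofNat_mul_eq_smul, D₁_mul, D₂_mul, dy_mul, map_add, dy_add,
    D₁_dy, D₂_dy, D₂_D₁, D₂_D₂, D₁_D₁, e2, mul_neg, neg_mul, neg_neg]
  set o : Fin 4 → A := ![D₁ U, dy (D₁ U), D₂ U, dy (D₂ U)]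
  have o0 : D₁ U = o 0 := rfl
  have o1 : dy (o 0) = o 1 := rfl
  have o2 : D₂ U = o 2 := rfl
  have o3 : dy (o 2) = o 3 := rfl
  have hodd : ∀ i, IsOdd (o i) := by
    intro i
    fin_cases i
    exacts [hU.D₁, hU.D₁.dy, hU.D₂, hU.D₂.dy]
  obtain ⟨Z, _, _, hZ⟩ := exists_even_scalars A
  obtain ⟨u₁, hu₁⟩ := hZ _ hU.dy
  obtain ⟨v₀, hv₀⟩ := hZ _ hU.D₂.D₁
  obtain ⟨v₁, hv₁⟩ := hZ _ hU.D₂.D₁.dy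
  rw [hv₁, hv₀, hu₁]
  simp only [o0, o2]
  simp only [o1, o3]
  clear_value o
  have r1 : ∀ i j, j < i → o i * o j = -(o j * o i) := fun i j _ =>
    odd_anticomm _ _ (hodd i) (hodd j)
  have r3 : ∀ i, o i * o i = 0 := fun i => (hodd i).mul_self
  simp only [smul_mul_assoc, mul_smul_comm, one_mul, add_mul, neg_mul, mul_assoc]
  simp only [mul_one, Fin.isValue, Fin.reduceLT, r1, r3, smul_zero, add_zero, zero_add,
    ofNat_smul_eq_nsmul ℂ]
  module

/-- The second non-trivial flow. -/
lemma flow_two (hU : IsEven U) (hR : IsSqrt R (laxL U)) : flow U R 2 = mkdvFlow₂ U := by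
  have e0 : parity U = U := hU
  have e2 : parity (D₂ U) = -D₂ U := hU.D₂
  rw [flow_two_eq_miura hU hR, mkdvFlow₂, miura, ← smul_neg]
  congr 1
  simp only [mul_assoc, ofNat_mul_eq_smul, pow_succ, pow_zero, one_mul, D₁_mul, D₂_mul, dy_mul,
    map_add, map_neg, dy_add, dy_neg, parity_dy, D₁_dy, D₂_dy, D₂_D₁, D₂_D₂, D₁_D₁, e0, e2, mul_neg, neg_mul, neg_neg]
  set o : Fin 6 → A := ![D₁ U, dy (D₁ U), dy (dy (D₁ U)), D₂ U, dy (D₂ U), dy (dy (D₂ U))]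
  have o0 : D₁ U = o 0 := rfl
  have o1 : dy (o 0) = o 1 := rfl
  have o2 : dy (o 1) = o 2 := rfl
  have o3 : D₂ U = o 3 := rfl
  have o4 : dy (o 3) = o 4 := rfl
  have o5 : dy (o 4) = o 5 := rfl
  have hodd : ∀ i, IsOdd (o i) := by
    intro i
    fin_cases i
    exacts [hU.D₁, hU.D₁.dy, hU.D₁.dy.dy, hU.D₂, hU.D₂.dy, hU.D₂.dy.dy]
  obtain ⟨Z, _, _, hZ⟩ := exists_even_scalars A
  obtain ⟨u₁, hu₁⟩ := hZ _ hU.dy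
  obtain ⟨u₂, hu₂⟩ := hZ _ hU.dy.dy
  obtain ⟨u₃, hu₃⟩ := hZ _ hU.dy.dy.dy
  obtain ⟨v₀, hv₀⟩ := hZ _ hU.D₂.D₁
  obtain ⟨v₁, hv₁⟩ := hZ _ hU.D₂.D₁.dy
  rw [hv₁, hv₀, hu₃, hu₂, hu₁]
  simp only [o0, o3]
  simp only [o1, o4]
  simp only [o2, o5]
  clear_value o
  have r1 : ∀ i j, j < i → o i * o j = -(o j * o i) := fun i j _ =>
    odd_anticomm _ _ (hodd i) (hodd j)
  have r2 : ∀ i j, j < i → ∀ x, o i * (o j * x) = -(o j * (o i * x)) := fun i j h x => by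
    rw [← mul_assoc, r1 i j h, neg_mul, mul_assoc]
  have r3 : ∀ i, o i * o i = 0 := fun i => (hodd i).mul_self
  have r4 : ∀ i x, o i * (o i * x) = 0 := fun i x => by rw [← mul_assoc, r3, zero_mul]
  simp only [smul_mul_assoc, mul_smul_comm, one_mul, mul_add, add_mul, neg_mul, mul_neg, mul_assoc]
  simp only [mul_one, Fin.isValue, Fin.reduceLT, zero_lt_one, r1, r2, r3, r4, neg_neg, mul_neg,
    mul_zero, neg_zero, smul_zero, add_zero, zero_add, ofNat_smul_eq_nsmul ℂ]
  module

end ExplicitFlows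

/-! ### The Lax equations on the free algebra and the main theorem. -/

section

open SPDO

lemma FreeN2.laxEquation_iff {R : SPDO FreeN2} (hR : IsSqrt R (laxL FreeN2.U)) (n : ℕ)
    (ε : TimeDerivation FreeN2) : LaxEquation n FreeN2.U ε ↔
      ∃ c : ℂ, ε.toFun FreeN2.U = flow FreeN2.U R n + algebraMap ℂ FreeN2 c := by
  refine ⟨fun h => ?_, fun ⟨c, hc⟩ => laxEquation_of_flow FreeN2.isEven_U hR hc⟩
  have h1 := dy_eq_of_laxEquation FreeN2.isEven_U hR h
  rw [← sub_eq_zero, ← dy_sub] at h1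
  obtain ⟨c, hc⟩ := FreeN2.exists_eq_algebraMap_of_dy_eq_zero h1
  exact ⟨c, by rw [← hc, add_sub_cancel]⟩

end

theorem proposition1 :
    -- `L_{1m}` is the image of `L₁` under a superconformal change of variables with
    -- `W = K = e^{2U}`, where `U = (1/2) log K` enters through its superderivatives only
    (∀ (A : Type*) [Ring A] [Algebra ℂ A] [N2Algebra A] (U K x θ₁ θ₂ : A) (E₁ E₂ : SPDO A),
      IsEven U → IsSuperconformal x θ₁ θ₂ E₁ E₂ →
      K = D₁ θ₁ ^ 2 + D₂ θ₁ ^ 2 → IsUnit K → D₁ K = 2 * K * D₁ U → D₂ K = 2 * K * D₂ U →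
      harryDymL K E₁ E₂ = laxL U) ∧
    -- the two square roots of `L_{1m}`
    (∀ (A : Type*) [Ring A] [Algebra ℂ A] [N2Algebra A] (U : A), IsEven U →
      laxHat U * laxHat U = laxL U ∧ ∃! R : SPDO A, SPDO.IsSqrt R (laxL U)) ∧
    -- the hierarchy: differential superpolynomials `F n` and evolutionary vector fields `δ n`
    (∃ (F : ℕ → FreeN2) (δ : ℕ → TimeDerivation FreeN2),
      (∀ n, IsEven (F n) ∧ (δ n).toFun FreeN2.U = F n) ∧
      -- the `n`-th Lax equation is the evolution equation `U_{τ_n} = F n`, up to a constant that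
      -- the Lax operator does not see
      (∀ (n : ℕ) (ε : TimeDerivation FreeN2), LaxEquation n FreeN2.U ε ↔
        ∃ c : ℂ, ε.toFun FreeN2.U = F n + algebraMap ℂ FreeN2 c) ∧
      -- the flows commute
      (∀ (m n : ℕ) (a : FreeN2),
        (δ m).toFun ((δ n).toFun a) = (δ n).toFun ((δ m).toFun a)) ∧
      -- the trivial flow and the first two non-trivial ones
      F 0 = dy FreeN2.U ∧ F 1 = mkdvFlow₁ FreeN2.U ∧ F 2 = mkdvFlow₂ FreeN2.U ∧
      -- the same in every algebra of superfields
      (∀ (A : Type*) [Ring A] [Algebra ℂ A] [N2Algebra A] (U : A), IsEven U →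
        ∃ φ : FreeN2 →ₐ[ℂ] A, IsSuperHom φ ∧ φ FreeN2.U = U ∧
          ∀ (n : ℕ) (ε : TimeDerivation A),
            (ε.toFun U = φ (F n) → LaxEquation n U ε) ∧
            (LaxEquation n U ε → dy (ε.toFun U) = dy (φ (F n))))) ∧
    -- the Miura map takes solutions of the second flow to solutions of `SKdV_4`
    (∀ (A : Type*) [Ring A] [Algebra ℂ A] [N2Algebra A] (U : A) (ε : TimeDerivation A), IsEven U →
      ε.toFun U = mkdvFlow₂ U → ε.toFun (miura U) = skdv 4 (miura U)) := by
  refine ⟨fun A _ _ _ U K x θ₁ θ₂ E₁ E₂ hU h hK hKu h1 h2 => harryDymL_eq_laxL h hK hKu h1 h2,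
    fun A _ _ _ U _ => ⟨laxHat_sq U, existsUnique_isSqrt U⟩, ?_,
    fun A _ _ _ U ε hU hε => miura_flow_two hU hε⟩
  -- The root at the universal superfield supplies all the `F n` at once.
  obtain ⟨R, hR, -⟩ := existsUnique_isSqrt FreeN2.U
  have hU := FreeN2.isEven_U
  have hF := fun n => isEven_flow hU hR n
  refine ⟨fun n => flow FreeN2.U R n, fun n => FreeN2.evolDerivation _ (hF n),
    fun n => ⟨hF n, FreeN2.evolDerivation_U _ _⟩, fun n ε => FreeN2.laxEquation_iff hR n ε,
    fun m n a => FreeN2.timeDerivation_comm ?_ a, flow_zero hU hR, flow_one hU hR, flow_two hU hR,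
    fun A _ _ _ V hV => ⟨FreeN2.eval V hV, FreeN2.eval_isSuperHom V hV, FreeN2.eval_U V hV,
      fun n ε => ?_⟩⟩
  · rw [FreeN2.evolDerivation_U, FreeN2.evolDerivation_U]
    exact flow_comm hU hR (FreeN2.evolDerivation_U _ _) (FreeN2.evolDerivation_U _ _)
  · have hφ := FreeN2.eval_isSuperHom V hV
    have hS := isSqrt_mapCoeff hφ hR
    rw [FreeN2.eval_U] at hS
    rw [map_flow hφ, FreeN2.eval_U]
    exact ⟨fun h => laxEquation_of_flow (c := 0) hV hS (by rw [h, map_zero, add_zero]),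
      fun h => dy_eq_of_laxEquation hV hS h⟩
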